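/- Let $X$ be a locally finite connected graph (loops and multiple edges allowed), regarded as a topological space. Let $Maps(X)$ be the group of proper homotopy equivalences $X\to X$ up to proper homotopy, topologized as follows. Let $\hat X=X\sqcup\partial X$ be the Freudenthal (end) compactification of $X$, and let $PH(X)$ be the set of pairs $(\hat f,\hat g)$ of continuous maps $\hat X\to\hat X$ that are extensions of proper homotopy equivalences $f,g:X\to X$ which are inverse to each other up to proper homotopy; give $PH(X)$ the subspace topology of the product of two copies of $C(\hat X,\hat X)$ with the compact-open topology, and give $Maps(X)$ the quotient topology with respect to $(\hat f,\hat g)\mapsto[f]$. Let $Aut(\pi_1(X))$ carry the topology of pointwise convergence ($\pi_1(X)$ being discrete), and let $Out(\pi_1(X))=Aut(\pi_1(X))/Inn(\pi_1(X))$ carry the quotient topology. Let $\Psi:Maps(X)\to Out(\pi_1(X))$ be the homomorphism that sends $[h]$ to the outer class of $h_*:\pi_1(X)\to\pi_1(X)$. The genus of $X$ is the rank of the free group $\pi_1(X)$; the core of $X$ is the smallest subgraph containing all immersed (i.e. locally injective) loops $S^1\to X$; and $X$ is a core graph if it equals its core. Then: 1. $\Psi$ is continuous. 2. If the genus of $X$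 is infinite, then the image of $\Psi$ is not a closed subgroup of $Out(\pi_1(X))$. 3. If the genus of $X$ is infinite and $X$ is a core graph, then $\Psi$ is injective, but it is not a homeomorphism onto its image. -/

import Mathlib

open Topology Set
open scoped unitInterval

/-! ## Graphs -/

/-- A graph, with loops and multiple edges allowed: a set `V` of vertices, a set `E` of edges, each
edge having two (possibly equal) endpoints. The order of the endpoints only serves to
parametrize the edge by `[0,1]`. -/
structure TopGraph (V : Type*) (E : Type*) where
  src : E → V
  tgt : E → V

namespace TopGraph

variable {V E : Type*} (G : TopGraph V E)

/-- Every vertex is an endpoint of only finitely many edges. -/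
def LocallyFinite : Prop := ∀ v : V, {e : E | G.src e = v ∨ G.tgt e = v}.Finite

/-- The disjoint union of one point for each vertex and one copy of `[0,1]` for each edge. -/
abbrev Pieces (V E : Type*) : Type _ := (Σ _ : V, Unit) ⊕ (Σ _ : E, I)

/-- The endpoints of each interval are glued to the endpoints of the edge. -/
inductive Glue : Pieces V E → Pieces V E → Prop
  | src (e : E) : Glue (Sum.inr ⟨e, 0⟩) (Sum.inl ⟨G.src e, ()⟩)
  | tgt (e : E) : Glue (Sum.inr ⟨e, 1⟩) (Sum.inl ⟨G.tgt e, ()⟩)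

/-- The graph as a topological space (a 1-dimensional CW complex): the quotient of the disjoint
union of points and intervals by the gluing. -/
def Space : Type _ := Quot G.Glue

instance : TopologicalSpace G.Space :=
  inferInstanceAs (TopologicalSpace (Quot G.Glue))

/-- The point of the space given by a vertex. -/
def vertexPt (v : V) : G.Space := Quot.mk _ (Sum.inl ⟨v, ()⟩)

/-- The point with parameter `t` on the edge `e`. -/
def edgePt (e : E) (t : I) : G.Space := Quot.mk _ (Sum.inr ⟨e, t⟩)

instance : LocallyPathConnectedSpace G.Space := by
  have : LocallyPathConnectedSpace I := (convex_Icc (0 : ℝ) 1).locallyPathConnectedSpace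
  have : LocallyPathConnectedSpace Unit :=
    LocallyPathConnectedSpace.of_bases (p := fun _ (_ : Unit) => True)
      (s := fun _ _ => Set.univ) (fun x => by
        refine ⟨fun t => ⟨fun ht => ⟨(), trivial, ?_⟩, ?_⟩⟩
        · intro y _
          exact Subsingleton.elim x y ▸ mem_of_mem_nhds ht
        · rintro ⟨_, _, h⟩
          exact Filter.mem_of_superset Filter.univ_mem h) (fun _ _ _ => isPathConnected_univ)
  exact inferInstanceAs (LocallyPathConnectedSpace (Quot G.Glue))

instance [ConnectedSpace G.Space] : PathConnectedSpace G.Space :=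
  pathConnectedSpace_iff_connectedSpace.2 inferInstance

/-- `S` is (the underlying space of) a subgraph: a set of vertices together with a set of closed
edges whose endpoints belong to the set of vertices. -/
def IsSubgraph (S : Set G.Space) : Prop :=
  ∃ (V' : Set V) (E' : Set E), (∀ e ∈ E', G.src e ∈ V' ∧ G.tgt e ∈ V') ∧
    S = G.vertexPt '' V' ∪ {x | ∃ e ∈ E', ∃ t : I, x = G.edgePt e t}

/-- An immersed loop: a locally injective map from the circle. -/
def IsImmersedLoop (γ : C(Circle, G.Space)) : Prop :=
  ∀ z : Circle, ∃ U ∈ 𝓝 z, InjOn γ U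

/-- The core: the smallest subgraph that contains all immersed loops. -/
def core : Set G.Space :=
  ⋂₀ {S | G.IsSubgraph S ∧ ∀ γ : C(Circle, G.Space), G.IsImmersedLoop γ → range γ ⊆ S}

/-- A core graph is a graph that is equal to its core. -/
def IsCoreGraph : Prop := G.core = univ

end TopGraph

namespace ProperMaps

/-! ## Proper homotopy and the mapping class group -/

section Proper

variable {X Y Z : Type*} [TopologicalSpace X] [TopologicalSpace Y] [TopologicalSpace Z]

/-- Two maps are properly homotopic if they are the two ends of a homotopy which is a proper map
from the cylinder. -/
def ProperHomotopic (f g : C(X, Y)) : Prop :=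
  ∃ H : ContinuousMap.Homotopy f g, IsProperMap (fun p : I × X => H p)

theorem ProperHomotopic.refl {f : C(X, Y)} (hf : IsProperMap f) : ProperHomotopic f f :=
  ⟨ContinuousMap.Homotopy.refl f, hf.comp isProperMap_snd_of_compactSpace⟩

theorem ProperHomotopic.symm {f g : C(X, Y)} (h : ProperHomotopic f g) : ProperHomotopic g f := by
  obtain ⟨H, hH⟩ := h
  refine ⟨H.symm, ?_⟩
  have : IsProperMap (Prod.map unitInterval.symm (id : X → X)) :=
    (unitInterval.symmHomeomorph.isProperMap).prodMap isProperMap_id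
  exact hH.comp this

theorem isProperMap_sumElim {f : X → Z} {g : Y → Z} (hf : IsProperMap f) (hg : IsProperMap g) :
    IsProperMap (Sum.elim f g) := by
  rw [isProperMap_iff_ultrafilter]
  refine ⟨hf.continuous.sumElim hg.continuous, fun 𝒰 z hz => ?_⟩
  have hu : range (Sum.inl : X → X ⊕ Y) ∪ range Sum.inr ∈ 𝒰 := by
    rw [range_inl_union_range_inr]; exact Filter.univ_mem
  rcases Ultrafilter.union_mem_iff.1 hu with h | h
  · have hc : (Ultrafilter.comap 𝒰 Sum.inl_injective h).map Sum.inl = 𝒰 :=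
      Ultrafilter.coe_injective (by simpa using Filter.map_comap_of_mem h)
    obtain ⟨x, hx, hle⟩ := hf.ultrafilter_le_nhds_of_tendsto
      (𝒰 := Ultrafilter.comap 𝒰 Sum.inl_injective h) (y := z) (by
        rw [← hc] at hz
        exact hz)
    refine ⟨Sum.inl x, hx, ?_⟩
    rw [← hc]
    exact (continuous_inl.tendsto x).mono_left hle
  · have hc : (Ultrafilter.comap 𝒰 Sum.inr_injective h).map Sum.inr = 𝒰 :=
      Ultrafilter.coe_injective (by simpa using Filter.map_comap_of_mem h)
    obtain ⟨x, hx, hle⟩ := hg.ultrafilter_le_nhds_of_tendsto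
      (𝒰 := Ultrafilter.comap 𝒰 Sum.inr_injective h) (y := z) (by
        rw [← hc] at hz
        exact hz)
    refine ⟨Sum.inr x, hx, ?_⟩
    rw [← hc]
    exact (continuous_inr.tendsto x).mono_left hle

theorem ProperHomotopic.trans {f g h : C(X, Y)} (h₁ : ProperHomotopic f g)
    (h₂ : ProperHomotopic g h) : ProperHomotopic f h := by
  obtain ⟨H, hH⟩ := h₁
  obtain ⟨K, hK⟩ := h₂
  refine ⟨H.trans K, ?_⟩
  let a : I → I := fun t => ⟨t / 2, by
    have h0 := t.2.1; have h1 := t.2.2; exact ⟨by linarith, by linarith⟩⟩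
  let b : I → I := fun t => ⟨(t + 1) / 2, by
    have h0 := t.2.1; have h1 := t.2.2; exact ⟨by linarith, by linarith⟩⟩
  have ha : Continuous a := by fun_prop
  have hb : Continuous b := by fun_prop
  let q : (I × X) ⊕ (I × X) → I × X := Sum.elim (Prod.map a id) (Prod.map b id)
  have hq : Continuous q := (ha.prodMap continuous_id).sumElim (hb.prodMap continuous_id)
  refine isProperMap_of_comp_of_surj hq (H.trans K).continuous ?_ ?_
  · have : (fun p : I × X => (H.trans K) p) ∘ q
        = Sum.elim (fun p : I × X => H p) (fun p : I × X => K p) := by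
      funext p
      rcases p with ⟨t, x⟩ | ⟨t, x⟩
      · have h1 := t.2.2
        have hle : ((a t : I) : ℝ) ≤ 1 / 2 := by
          change (t : ℝ) / 2 ≤ 1 / 2
          linarith
        change (H.trans K) (a t, x) = H (t, x)
        rw [ContinuousMap.Homotopy.trans_apply, dif_pos hle]
        congr 2
        apply Subtype.ext
        change 2 * ((t : ℝ) / 2) = t
        ring
      · have h0 := t.2.1
        change (H.trans K) (b t, x) = K (t, x)
        rw [ContinuousMap.Homotopy.trans_apply]
        split_ifs with hle
        · have hle' : ((t : ℝ) + 1) / 2 ≤ 1 / 2 := hle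
          have ht : t = 0 := Subtype.ext (by change (t : ℝ) = 0; linarith)
          subst ht
          have e : (⟨2 * ((b 0 : I) : ℝ),
              (unitInterval.mul_pos_mem_iff zero_lt_two).2 ⟨(b 0).2.1, hle⟩⟩ : I) = 1 := by
            apply Subtype.ext
            change 2 * (((0 : ℝ) + 1) / 2) = 1
            ring
          change H ((⟨2 * ((b 0 : I) : ℝ), _⟩ : I), x) = _
          rw [e]
          simp
        · congr 2
          apply Subtype.ext
          change 2 * (((t : ℝ) + 1) / 2) - 1 = t
          ring
    change IsProperMap ((fun p : I × X => (H.trans K) p) ∘ q)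
    rw [this]
    exact isProperMap_sumElim hH hK
  · rintro ⟨t, x⟩
    have h0 := t.2.1
    have h1 := t.2.2
    by_cases ht : (t : ℝ) ≤ 1 / 2
    · refine ⟨Sum.inl (⟨2 * t, by linarith, by linarith⟩, x), ?_⟩
      refine Prod.ext (Subtype.ext ?_) rfl
      change 2 * (t : ℝ) / 2 = t
      ring
    · refine ⟨Sum.inr (⟨2 * t - 1, by linarith, by linarith⟩, x), ?_⟩
      refine Prod.ext (Subtype.ext ?_) rfl
      change (2 * (t : ℝ) - 1 + 1) / 2 = t
      ring

theorem ProperHomotopic.comp {f f' : C(Y, Z)} {g g' : C(X, Y)} (hf' : IsProperMap f')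
    (hg : IsProperMap g) (h₁ : ProperHomotopic f f') (h₂ : ProperHomotopic g g') :
    ProperHomotopic (f.comp g) (f'.comp g') := by
  obtain ⟨H, hH⟩ := h₁
  obtain ⟨K, hK⟩ := h₂
  refine ProperHomotopic.trans (g := f'.comp g) ?_ ?_
  · refine ⟨⟨⟨fun p => H (p.1, g p.2), by fun_prop⟩, by simp, by simp⟩, ?_⟩
    exact hH.comp (isProperMap_id.prodMap hg)
  · refine ⟨⟨⟨fun p => f' (K p), by fun_prop⟩, by simp, by simp⟩, ?_⟩
    exact hf'.comp hK

/-- `f` and `g` are proper homotopy equivalences which are inverse to each other. -/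
def AreProperInverse (f : C(X, Y)) (g : C(Y, X)) : Prop :=
  IsProperMap f ∧ IsProperMap g ∧
    ProperHomotopic (f.comp g) (ContinuousMap.id Y) ∧
    ProperHomotopic (g.comp f) (ContinuousMap.id X)

/-- A proper homotopy equivalence: a proper map with a proper inverse up to proper homotopy. -/
def IsProperHomotopyEquiv (f : C(X, Y)) : Prop := ∃ g : C(Y, X), AreProperInverse f g

theorem AreProperInverse.symm {f : C(X, Y)} {g : C(Y, X)} (h : AreProperInverse f g) :
    AreProperInverse g f := ⟨h.2.1, h.1, h.2.2.2, h.2.2.1⟩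

theorem AreProperInverse.comp {f : C(Y, Z)} {f' : C(Z, Y)} {g : C(X, Y)} {g' : C(Y, X)}
    (h : AreProperInverse f f') (k : AreProperInverse g g') :
    AreProperInverse (f.comp g) (g'.comp f') := by
  refine ⟨h.1.comp k.1, k.2.1.comp h.2.1, ?_, ?_⟩
  · have h₁ : ProperHomotopic (f.comp ((g.comp g').comp f'))
        (f.comp ((ContinuousMap.id Y).comp f')) :=
      ProperHomotopic.comp h.1 ((k.1.comp k.2.1).comp h.2.1) (.refl h.1)
        (ProperHomotopic.comp isProperMap_id h.2.1 k.2.2.1 (.refl h.2.1))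
    exact h₁.trans h.2.2.1
  · have h₁ : ProperHomotopic (g'.comp ((f'.comp f).comp g))
        (g'.comp ((ContinuousMap.id Y).comp g)) :=
      ProperHomotopic.comp k.2.1 ((h.2.1.comp h.1).comp k.1) (.refl k.2.1)
        (ProperHomotopic.comp isProperMap_id k.1 h.2.2.2 (.refl k.1))
    exact h₁.trans k.2.2.2

theorem areProperInverse_id : AreProperInverse (ContinuousMap.id X) (ContinuousMap.id X) :=
  ⟨isProperMap_id, isProperMap_id, .refl isProperMap_id, .refl isProperMap_id⟩

end Proper

section MappingClassGroup

variable (X : Type*) [TopologicalSpace X]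

/-- The proper homotopy equivalences of `X`. -/
def SelfEquiv : Type _ := {f : C(X, X) // IsProperHomotopyEquiv f}

/-- Proper homotopy, as an equivalence relation on proper homotopy equivalences. -/
instance selfEquivSetoid : Setoid (SelfEquiv X) where
  r f g := ProperHomotopic f.1 g.1
  iseqv := ⟨fun f => .refl f.2.choose_spec.1, fun h => h.symm, fun h k => h.trans k⟩

/-- The mapping class group: proper homotopy equivalences of `X` up to proper homotopy. -/
def Maps : Type _ := Quotient (selfEquivSetoid X)

variable {X}

/-- The class of a proper homotopy equivalence. -/
def Maps.mk (f : C(X, X)) (hf : IsProperHomotopyEquiv f) : Maps X :=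
  Quotient.mk (selfEquivSetoid X) ⟨f, hf⟩

/-- Composition of proper homotopy equivalences. -/
def SelfEquiv.comp (f g : SelfEquiv X) : SelfEquiv X :=
  ⟨f.1.comp g.1, _, f.2.choose_spec.comp g.2.choose_spec⟩

/-- An inverse, up to proper homotopy. -/
noncomputable def SelfEquiv.inv (f : SelfEquiv X) : SelfEquiv X :=
  ⟨f.2.choose, f.1, f.2.choose_spec.symm⟩

instance : Mul (Maps X) :=
  ⟨Quotient.map₂ SelfEquiv.comp (fun _ f' hf g _ hg =>
    ProperHomotopic.comp f'.2.choose_spec.1 g.2.choose_spec.1 hf hg)⟩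

instance : One (Maps X) := ⟨Maps.mk (ContinuousMap.id X) ⟨_, areProperInverse_id⟩⟩

noncomputable instance : Inv (Maps X) := ⟨fun a => Quotient.mk _ (Quotient.out a).inv⟩

/-- The group structure on the mapping class group, given by composition. -/
noncomputable instance : Group (Maps X) :=
  Group.ofLeftAxioms
    (by
      rintro ⟨f⟩ ⟨g⟩ ⟨h⟩
      rfl)
    (by
      rintro ⟨f⟩
      rfl)
    (by
      intro a
      have h : Maps.mk _ (Quotient.out a).inv.2 * Maps.mk _ (Quotient.out a).2 = (1 : Maps X) :=
        Quotient.sound (s := selfEquivSetoid X) (by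
          change ProperHomotopic _ _
          exact (Quotient.out a).2.choose_spec.2.2.2)
      rwa [show Maps.mk _ (Quotient.out a).2 = a from Quotient.out_eq a] at h)

end MappingClassGroup

/-! ## Ends and the end compactification -/

section Ends

open TopologicalSpace (Compacts)

variable (X : Type*) [TopologicalSpace X]

/-- `U` is a component of the complement of `K`. -/
def IsComplComponent {X : Type*} [TopologicalSpace X] (K : Compacts X) (U : Set X) : Prop :=
  ∃ x ∈ (K : Set X)ᶜ, U = connectedComponentIn (K : Set X)ᶜ x

/-- The space of ends, the inverse limit of the sets of components of `X ∖ K` over the compact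
subsets `K`: an end chooses a component of each `X ∖ K`, compatibly with inclusions. -/
def Ends : Type _ :=
  {ε : Compacts X → Set X // (∀ K, IsComplComponent K (ε K)) ∧
    ∀ K L : Compacts X, (K : Set X) ⊆ L → ε L ⊆ ε K}

/-- The set underlying the end (Freudenthal) compactification: the disjoint union of `X` and its
space of ends. -/
inductive EndCompactification : Type _
  | pt (x : X) : EndCompactification
  | ofEnd (ε : Ends X) : EndCompactification

variable {X}

/-- For a component `U` of `X ∖ K`, the union of `U` and the set of ends that map to `U`. -/
def hatSet (K : Compacts X) (U : Set X) : Set (EndCompactification X) :=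
  EndCompactification.pt '' U ∪ EndCompactification.ofEnd '' {ε | ε.1 K = U}

/-- The topology of the end compactification is generated by the open subsets of `X` and the sets
`hatSet K U` for `K` compact and `U` a component of `X ∖ K`. -/
instance : TopologicalSpace (EndCompactification X) :=
  TopologicalSpace.generateFrom
    ({S | ∃ U : Set X, IsOpen U ∧ S = EndCompactification.pt '' U} ∪
      {S | ∃ (K : Compacts X) (U : Set X), IsComplComponent K U ∧ S = hatSet K U})

/-- `F` is an extension of `f` to the end compactification. -/
def Extends (F : C(EndCompactification X, EndCompactification X)) (f : C(X, X)) : Prop :=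
  ∀ x, F (.pt x) = .pt (f x)

variable (X)

/-- The space of pairs of self-maps of the end compactification that are extensions of proper
homotopy equivalences of `X` which are each other's inverses. It carries the subspace topology
of the product of two copies of the function space with the compact-open topology. -/
def PH : Type _ :=
  {p : C(EndCompactification X, EndCompactification X) ×
      C(EndCompactification X, EndCompactification X) //
    ∃ f g : C(X, X), AreProperInverse f g ∧ Extends p.1 f ∧ Extends p.2 g}

instance : TopologicalSpace (PH X) := instTopologicalSpaceSubtype

variable {X}

/-- The map that sends a pair to the class of the restriction to `X` of its first member. -/
noncomputable def PH.toMaps (p : PH X) : Maps X :=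
  Maps.mk p.2.choose ⟨_, p.2.choose_spec.choose_spec.1⟩

/-- The quotient topology on the mapping class group. -/
noncomputable instance : TopologicalSpace (Maps X) := TopologicalSpace.coinduced PH.toMaps inferInstance

end Ends

/-! ## Outer automorphisms -/

section Out

variable (Γ : Type*) [Group Γ]

/-- The topology of pointwise convergence on the automorphism group of a discrete group, i.e. the
topology induced from the permutations of the underlying set. -/
@[reducible] def autTopology : TopologicalSpace (MulAut Γ) :=
  TopologicalSpace.induced (fun φ : MulAut Γ => (φ : Γ → Γ))
    (@Pi.topologicalSpace Γ (fun _ => Γ) (fun _ => ⊥))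

instance conj_range_normal : (MulAut.conj : Γ →* MulAut Γ).range.Normal where
  conj_mem := by
    rintro _ ⟨c, rfl⟩ φ
    refine ⟨φ c, ?_⟩
    ext x
    simp [MulAut.conj_apply]

/-- The outer automorphism group. -/
def Out : Type _ := MulAut Γ ⧸ (MulAut.conj : Γ →* MulAut Γ).range

instance : Group (Out Γ) :=
  inferInstanceAs (Group (MulAut Γ ⧸ (MulAut.conj : Γ →* MulAut Γ).range))

variable {Γ}

/-- The outer class of an automorphism. -/
def Out.mk (φ : MulAut Γ) : Out Γ := QuotientGroup.mk φ

/-- The quotient topology on the outer automorphism group. -/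
instance : TopologicalSpace (Out Γ) := TopologicalSpace.coinduced Out.mk (autTopology Γ)

theorem Out.mk_mul (φ ψ : MulAut Γ) : Out.mk (φ * ψ) = Out.mk φ * Out.mk ψ := rfl

theorem Out.mk_eq {φ ψ : MulAut Γ} (c : Γ) (h : ∀ x, ψ x = c * φ x * c⁻¹) :
    Out.mk ψ = Out.mk φ := by
  have : ψ = MulAut.conj c * φ := by
    ext x
    simp [h, MulAut.conj_apply]
  rw [this, Out.mk_mul]
  have h1 : Out.mk (MulAut.conj c) = (1 : Out Γ) :=
    (QuotientGroup.eq_one_iff _).2 ⟨c, rfl⟩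
  rw [h1, one_mul]

variable (Γ) in
/-- The rank of a group: the smallest cardinality of a generating set, `⊤` if there is no finite
one. For a free group it is the cardinality of a free basis (`⊤` if infinite). -/
noncomputable def rank : ℕ∞ := ⨅ S : {S : Set Γ // Subgroup.closure S = ⊤}, S.1.encard

end Out

/-! ## The action on the fundamental group -/

section Psi

open CategoryTheory

variable {X : Type*} [TopologicalSpace X]

/-- The genus: the rank of the fundamental group. -/
noncomputable def genus (x₀ : X) : ℕ∞ := rank (FundamentalGroup X x₀)

/-- The endomorphism of `π₁(X, x₀)` induced by `f` and a path from `f x₀` to `x₀`: the induced map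
`π₁(X, x₀) → π₁(X, f x₀)` followed by the change of base point along the path. -/
noncomputable def inducedHom {x₀ : X} (f : C(X, X)) (p : Path (f x₀) x₀) :
    FundamentalGroup X x₀ →* FundamentalGroup X x₀ :=
  (FundamentalGroup.fundamentalGroupMulEquivOfPath p).toMonoidHom.comp (FundamentalGroup.map f x₀)

/-- The morphism of the fundamental groupoid given by a path. -/
abbrev arrow {x y : X} (p : Path x y) : FundamentalGroupoid.mk x ⟶ FundamentalGroupoid.mk y :=
  Path.Homotopic.Quotient.mk p

theorem inducedHom_apply {x₀ : X} (f : C(X, X)) (p : Path (f x₀) x₀) (γ : FundamentalGroup X x₀) :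
    inducedHom f p γ = Groupoid.inv (arrow p) ≫ (FundamentalGroupoid.map f).map γ ≫ arrow p :=
  rfl

theorem groupoid_aux {C : Type*} [Groupoid C] {x a b : C} {F : a ⟶ a} {F' : b ⟶ b} {h : a ⟶ b}
    (nat : F ≫ h = h ≫ F') (p : a ⟶ x) (q : b ⟶ x) :
    Groupoid.inv q ≫ F' ≫ q = Groupoid.inv (Groupoid.inv p ≫ h ≫ q) ≫
      (Groupoid.inv p ≫ F ≫ p) ≫ Groupoid.inv p ≫ h ≫ q := by
  have nat' : F' = Groupoid.inv h ≫ F ≫ h := by rw [nat]; simp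
  simp [nat', Groupoid.inv_eq_inv]

theorem groupoid_aux' {C D : Type*} [Groupoid C] [Groupoid D] (T : C ⥤ D) {x y : C} {z : D}
    (F : x ⟶ x) (q : x ⟶ y) (p : T.obj y ⟶ z) :
    Groupoid.inv (T.map q ≫ p) ≫ T.map F ≫ T.map q ≫ p =
      Groupoid.inv p ≫ T.map (Groupoid.inv q ≫ F ≫ q) ≫ p := by
  simp [Groupoid.inv_eq_inv]

theorem inducedHom_conj {x₀ : X} {f g : C(X, X)} (H : ContinuousMap.Homotopy f g)
    (p : Path (f x₀) x₀) (q : Path (g x₀) x₀) :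
    ∃ c : FundamentalGroup X x₀, ∀ γ, inducedHom g q γ = c * inducedHom f p γ * c⁻¹ := by
  let h : FundamentalGroupoid.mk (f x₀) ⟶ FundamentalGroupoid.mk (g x₀) := arrow (H.evalAt x₀)
  refine ⟨(Groupoid.inv (arrow p) ≫ h ≫ arrow q : FundamentalGroupoid.mk x₀ ⟶ _), fun γ => ?_⟩
  have nat : (FundamentalGroupoid.map f).map γ ≫ h = h ≫ (FundamentalGroupoid.map g).map γ :=
    (FundamentalGroupoidFunctor.homotopicMapsNatIso H).naturality γ
  exact groupoid_aux nat (arrow p) (arrow q)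

theorem inducedHom_comp {x₀ : X} (f g : C(X, X)) (p : Path (f x₀) x₀) (q : Path (g x₀) x₀) :
    ∃ r : Path ((f.comp g) x₀) x₀, ∀ γ,
      inducedHom (f.comp g) r γ = inducedHom f p (inducedHom g q γ) := by
  refine ⟨(q.map f.continuous).trans p, fun γ => ?_⟩
  have e' : (FundamentalGroupoid.map (f.comp g)).map γ =
      (FundamentalGroupoid.map f).map ((FundamentalGroupoid.map g).map γ) := by
    obtain ⟨γ⟩ := γ
    rfl
  refine Eq.trans ?_ (groupoid_aux' (FundamentalGroupoid.map f)
    ((FundamentalGroupoid.map g).map γ) (arrow q) (arrow p))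
  exact congrArg (fun δ => Groupoid.inv (arrow ((q.map f.continuous).trans p)) ≫ δ ≫
    arrow ((q.map f.continuous).trans p)) e'

theorem inducedHom_id {x₀ : X} (γ : FundamentalGroup X x₀) :
    inducedHom (ContinuousMap.id X) (Path.refl x₀) γ = γ := by
  have e' : (FundamentalGroupoid.map (ContinuousMap.id X)).map γ = γ := by
    obtain ⟨γ⟩ := γ
    rfl
  have h : Groupoid.inv (𝟙 (FundamentalGroupoid.mk x₀)) ≫ γ ≫ 𝟙 (FundamentalGroupoid.mk x₀) = γ := by
    simp [Groupoid.inv_eq_inv]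
  exact (congrArg (fun δ => Groupoid.inv (𝟙 (FundamentalGroupoid.mk x₀)) ≫ δ ≫
    𝟙 (FundamentalGroupoid.mk x₀)) e').trans h

theorem inducedHom_comp_conj {x₀ : X} {f g : C(X, X)} (p : Path (f x₀) x₀) (q : Path (g x₀) x₀)
    (H : ContinuousMap.Homotopy (f.comp g) (ContinuousMap.id X)) :
    ∃ c : FundamentalGroup X x₀, ∀ γ, inducedHom f p (inducedHom g q γ) = c * γ * c⁻¹ := by
  obtain ⟨r, hr⟩ := inducedHom_comp f g p q
  obtain ⟨c, hc⟩ := inducedHom_conj H.symm (Path.refl x₀) r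
  refine ⟨c, fun γ => ?_⟩
  rw [← hr, hc, inducedHom_id]

theorem inducedHom_bijective [PathConnectedSpace X] {x₀ : X} {f : C(X, X)}
    (hf : IsProperHomotopyEquiv f) (p : Path (f x₀) x₀) : Function.Bijective (inducedHom f p) := by
  obtain ⟨g, -, -, ⟨H, -⟩, ⟨K, -⟩⟩ := hf
  let q : Path (g x₀) x₀ := PathConnectedSpace.somePath _ _
  obtain ⟨c, hc⟩ := inducedHom_comp_conj p q H
  obtain ⟨d, hd⟩ := inducedHom_comp_conj q p K
  constructor
  · intro a b hab
    have h := hd a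
    rw [hab, hd b] at h
    exact (mul_left_cancel (mul_right_cancel h)).symm
  · intro b
    refine ⟨inducedHom g q (c⁻¹ * b * c), ?_⟩
    rw [hc]
    group

/-- The automorphism of `π₁(X, x₀)` induced by a proper homotopy equivalence and a path from
`f x₀` to `x₀`. -/
noncomputable def inducedAut [PathConnectedSpace X] {x₀ : X} (f : SelfEquiv X)
    (p : Path (f.1 x₀) x₀) : MulAut (FundamentalGroup X x₀) :=
  MulEquiv.ofBijective (inducedHom f.1 p) (inducedHom_bijective f.2 p)

/-- The outer class of the automorphism induced by a proper homotopy equivalence; it does not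
depend on the path. -/
noncomputable def outerClass [PathConnectedSpace X] (x₀ : X) (f : SelfEquiv X) :
    Out (FundamentalGroup X x₀) :=
  Out.mk (inducedAut f (PathConnectedSpace.somePath (f.1 x₀) x₀))

theorem outerClass_eq [PathConnectedSpace X] {x₀ : X} (f : SelfEquiv X) (p : Path (f.1 x₀) x₀) :
    outerClass x₀ f = Out.mk (inducedAut f p) := by
  obtain ⟨c, hc⟩ := inducedHom_conj (ContinuousMap.Homotopy.refl f.1) p
    (PathConnectedSpace.somePath (f.1 x₀) x₀)
  exact Out.mk_eq c hc

theorem outerClass_congr [PathConnectedSpace X] (x₀ : X) (f g : SelfEquiv X)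
    (h : ProperHomotopic f.1 g.1) : outerClass x₀ f = outerClass x₀ g := by
  obtain ⟨H, -⟩ := h
  obtain ⟨c, hc⟩ := inducedHom_conj H (PathConnectedSpace.somePath (f.1 x₀) x₀)
    (PathConnectedSpace.somePath (g.1 x₀) x₀)
  exact (Out.mk_eq c hc).symm

/-- The homomorphism `Ψ` from the mapping class group to the outer automorphism group of the
fundamental group that sends the class of `h` to the outer class of the induced automorphism. -/
noncomputable def Psi [PathConnectedSpace X] (x₀ : X) :
    Maps X →* Out (FundamentalGroup X x₀) :=
  MonoidHom.mk' (Quotient.lift (outerClass x₀) (outerClass_congr x₀)) (by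
    rintro ⟨f⟩ ⟨g⟩
    change outerClass x₀ (f.comp g) = outerClass x₀ f * outerClass x₀ g
    let p : Path (f.1 x₀) x₀ := PathConnectedSpace.somePath _ _
    let q : Path (g.1 x₀) x₀ := PathConnectedSpace.somePath _ _
    obtain ⟨r, hr⟩ := inducedHom_comp f.1 g.1 p q
    rw [outerClass_eq (f.comp g) r, outerClass_eq f p, outerClass_eq g q, ← Out.mk_mul]
    congr 1
    ext γ
    exact hr γ)

end Psi

end ProperMaps

/-! ### Points of a graph and functions on it -/

namespace TopGraph

variable {V E : Type*} (G : TopGraph V E)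

/-! Continuity. Every point of a graph has a neighbourhood in which paths with the same ends are
homotopic in the graph (`exists_slim`). So a map close to `f₀` in the compact-open topology acts on
a fixed path class as `f₀` does, up to short paths at the ends (`nearbyAgree`). Near each of its
points, an open set of automorphisms is controlled by finitely many elements of the fundamental
group, and this gives `continuous_Psi`.

Holonomy. The computations take place in the free group on all edges. The covering graph with this
deck group assigns to a path class its holonomy `hol`, the word of edges crossed, and a class with
given ends is determined by its holonomy (`EdgeGen.eq_of_hol_eq`). The exponent sum `crossing` of
one edge takes values in an abelian group, so it does not see inner automorphisms.

Image and topology. In infinite genus there are edges `b k` with detours whose circuits converge to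
an end (`exists_circuits`). Twisting means appending to `b k`, `k > 0`, a loop that crosses `b 0`
once. Finite twists are the identity off a compact set, hence proper homotopy equivalences. The
twist along all `b k` with `k > 0` is a limit of them in the automorphism group. It is not in the
image of `Ψ`: a proper map moves almost all circuits off `b 0`, while this twist makes each of those
circuits cross `b 0` once. The twists along single edges `b n` tend to the identity in the outer
automorphism group. In the mapping class group they stay outside the neighbourhood of `1` on which
the image of every circuit of index `k > 0` has crossing number zero with `b 0`. That set is open
because the circuits together with their limit end form a compact subset of the end
compactification.

Injectivity. If `h` acts trivially, there is a natural family of classes `Γ x` from `h x` to `x`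
(`exists_natural`). A proper homotopy needs tracks that leave every compact set. In a core graph
almost all vertices carry an essential loop far out (`finite_inessential`); otherwise a tree-like
part would have a height function that no immersed loop can climb. Such a loop and its image under
`h` are conjugate by `Γ`, and both avoid a given finite set of edges. Malnormality of free factors
(`FreeGroup.mem_of_conj_mem`) then puts a representative of `Γ` there too. The squares over the
edges are filled far out by means of retractions onto connected subgraphs. -/

theorem edgePt_zero (e : E) : G.edgePt e 0 = G.vertexPt (G.src e) := Quot.sound (.src e)

theorem edgePt_one (e : E) : G.edgePt e 1 = G.vertexPt (G.tgt e) := Quot.sound (.tgt e)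

section Lift

variable {Z : Type*} {G}

/-- A function on a graph, given by its values on the vertices and on the edges. -/
def lift (φ : V → Z) (P : E → I → Z) (h0 : ∀ e, P e 0 = φ (G.src e))
    (h1 : ∀ e, P e 1 = φ (G.tgt e)) : G.Space → Z :=
  Quot.lift (Sum.elim (fun v => φ v.1) (fun p => P p.1 p.2)) (by
    rintro _ _ (e | e)
    · exact h0 e
    · exact h1 e)

@[simp] theorem lift_vertexPt (φ : V → Z) (P : E → I → Z) (h0 h1) (v : V) :
    lift (G := G) φ P h0 h1 (G.vertexPt v) = φ v := rfl

@[simp] theorem lift_edgePt (φ : V → Z) (P : E → I → Z) (h0 h1) (e : E) (t : I) :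
    lift (G := G) φ P h0 h1 (G.edgePt e t) = P e t := rfl

theorem exists_pt (x : G.Space) :
    (∃ v, x = G.vertexPt v) ∨ ∃ e, ∃ t : I, 0 < t ∧ t < 1 ∧ x = G.edgePt e t := by
  rcases x with ⟨⟨v, -⟩ | ⟨e, t⟩⟩
  · exact .inl ⟨v, rfl⟩
  · rcases eq_or_ne t 0 with rfl | h0
    · exact .inl ⟨_, G.edgePt_zero e⟩
    rcases eq_or_ne t 1 with rfl | h1
    · exact .inl ⟨_, G.edgePt_one e⟩
    exact .inr ⟨e, t, unitInterval.pos_iff_ne_zero.2 h0, unitInterval.lt_one_iff_ne_one.2 h1, rfl⟩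

open Classical in
/-- The normal form of a point: a vertex, or an edge with a parameter strictly between the ends. -/
noncomputable def normalForm : G.Space → V ⊕ (E × I) :=
  lift .inl (fun e t => if t = 0 then .inl (G.src e) else if t = 1 then .inl (G.tgt e) else
    .inr (e, t)) (fun e => by simp) (fun e => by simp)

theorem normalForm_edgePt {e : E} {t : I} (h0 : 0 < t) (h1 : t < 1) :
    normalForm (G.edgePt e t) = .inr (e, t) := by
  simp [normalForm, h0.ne', h1.ne]

variable (G) in
theorem vertexPt_injective : Function.Injective G.vertexPt := fun v w h => by
  simpa [normalForm] using congrArg normalForm h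

theorem edgePt_ne_vertexPt {e : E} {t : I} (h0 : 0 < t) (h1 : t < 1) (v : V) :
    G.edgePt e t ≠ G.vertexPt v := fun h => by
  have := congrArg normalForm h
  rw [normalForm_edgePt h0 h1] at this
  simp [normalForm] at this

theorem edgePt_inj {e e' : E} {t t' : I} (h0 : 0 < t) (h1 : t < 1)
    (h : G.edgePt e t = G.edgePt e' t') : e = e' ∧ t = t' := by
  rcases eq_or_ne t' 0 with rfl | h0'
  · exact (edgePt_ne_vertexPt h0 h1 _ (h.trans (G.edgePt_zero e'))).elim
  rcases eq_or_ne t' 1 with rfl | h1'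
  · exact (edgePt_ne_vertexPt h0 h1 _ (h.trans (G.edgePt_one e'))).elim
  have := congrArg normalForm h
  rw [normalForm_edgePt h0 h1, normalForm_edgePt (unitInterval.pos_iff_ne_zero.2 h0')
    (unitInterval.lt_one_iff_ne_one.2 h1')] at this
  simpa using this

end Lift

/-! ### The topology of a graph -/

section Topology

variable {Z T : Type*} [TopologicalSpace Z] [TopologicalSpace T] {G}

theorem isQuotientMap_mk : IsQuotientMap (Quot.mk G.Glue : Pieces V E → G.Space) :=
  isQuotientMap_quot_mk

variable (G) in
theorem continuous_edgePt (e : E) : Continuous (G.edgePt e) :=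
  (isQuotientMap_mk (G := G)).continuous.comp
    (continuous_inr.comp continuous_sigmaMk)

theorem continuous_of_edges {f : G.Space → Z} (h : ∀ e, Continuous fun t => f (G.edgePt e t)) :
    Continuous f := by
  refine (isQuotientMap_mk (G := G)).continuous_iff.2 (continuous_sum_dom.2 ⟨?_, ?_⟩)
  · exact continuous_sigma fun v => continuous_of_discreteTopology
  · exact continuous_sigma fun e => h e

/-- The product of a quotient map with a locally compact space is again a quotient map. With `T` the
unit interval, this allows homotopies to be defined edge by edge. -/
theorem continuous_prod_of_edges [LocallyCompactSpace T] {f : T × G.Space → Z}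
    (hv : ∀ v, Continuous fun t => f (t, G.vertexPt v))
    (he : ∀ e, Continuous fun p : T × I => f (p.1, G.edgePt e p.2)) : Continuous f := by
  refine (isQuotientMap_mk (G := G)).continuous_lift_prod_right ?_
  refine ContinuousMap.continuous_uncurry_of_continuous
    ⟨fun s : Pieces V E => (⟨fun t => f (t, Quot.mk _ s), ?_⟩ : C(T, Z)), ?_⟩ |>.comp
      continuous_swap
  · rcases s with ⟨v, -⟩ | ⟨e, t⟩
    · exact hv v
    · exact (he e).comp (by fun_prop : Continuous fun x : T => (x, t))
  · refine continuous_sum_dom.2 ⟨continuous_sigma fun v => continuous_of_discreteTopology,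
      continuous_sigma fun e => ?_⟩
    exact (ContinuousMap.curry
      ⟨fun p : I × T => f (p.2, G.edgePt e p.1), (he e).comp continuous_swap⟩).continuous

theorem isOpen_of_edges {U : Set G.Space} (h : ∀ e, IsOpen (G.edgePt e ⁻¹' U)) : IsOpen U := by
  refine (isQuotientMap_mk (G := G)).isOpen_preimage.1 (isOpen_sum_iff.2 ⟨?_, ?_⟩)
  · exact isOpen_sigma_iff.2 fun v => isOpen_discrete _
  · exact isOpen_sigma_iff.2 h

theorem isClosed_of_edges {U : Set G.Space} (h : ∀ e, IsClosed (G.edgePt e ⁻¹' U)) :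
    IsClosed U := by
  rw [← isOpen_compl_iff]
  exact isOpen_of_edges fun e => (h e).isOpen_compl

open Classical in
/-- A continuous function on the graph that vanishes only at the vertex `v`. -/
noncomputable def vertexDist (v : V) : G.Space → ℝ :=
  lift (fun w => if w = v then 0 else 1)
    (fun e t => min (if G.src e = v then (t : ℝ) else 1) (if G.tgt e = v then 1 - (t : ℝ) else 1))
    (fun e => by split_ifs <;> simp) (fun e => by split_ifs <;> simp)

theorem continuous_vertexDist (v : V) : Continuous (vertexDist (G := G) v) := by
  refine continuous_of_edges fun e => ?_
  simp only [vertexDist, lift_edgePt]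
  split_ifs <;> fun_prop

theorem vertexDist_self (v : V) : vertexDist (G := G) v (G.vertexPt v) = 0 := by
  simp [vertexDist]

theorem vertexDist_lt {v : V} {x : G.Space} {r : ℝ} (hr : r ≤ 1) (h : vertexDist v x < r) :
    x = G.vertexPt v ∨ ∃ e, ∃ t : I, x = G.edgePt e t ∧
      ((G.src e = v ∧ (t : ℝ) < r) ∨ (G.tgt e = v ∧ 1 - r < (t : ℝ))) := by
  rcases exists_pt x with ⟨w, rfl⟩ | ⟨e, t, h0, h1, rfl⟩
  · left
    by_contra hne
    rw [vertexDist, lift_vertexPt, if_neg (fun h' => hne (congrArg _ h'))] at h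
    linarith
  · refine .inr ⟨e, t, rfl, ?_⟩
    rw [vertexDist, lift_edgePt, min_lt_iff] at h
    rcases h with h | h <;> split_ifs at h with hh
    · exact .inl ⟨hh, h⟩
    · linarith
    · exact .inr ⟨hh, by linarith⟩
    · linarith

open Classical in
/-- A continuous function on the graph that vanishes only at the point with parameter `s` on the
edge `e`, if `s` is not an end of the interval. -/
noncomputable def edgeDist (e : E) (s : I) : G.Space → ℝ :=
  lift (fun _ => min (s : ℝ) (1 - s))
    (fun e' t => if e' = e then min |(t : ℝ) - s| (min (s : ℝ) (1 - s)) else min (s : ℝ) (1 - s))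
    (fun e' => by
      have := s.2.1
      split_ifs
      · simp [abs_of_nonneg this]
      · rfl)
    (fun e' => by
      have := s.2.2
      split_ifs
      · simp [abs_of_nonneg (sub_nonneg.2 this)]
      · rfl)

theorem continuous_edgeDist (e : E) (s : I) : Continuous (edgeDist (G := G) e s) := by
  refine continuous_of_edges fun e => ?_
  simp only [edgeDist, lift_edgePt]
  split_ifs <;> fun_prop

theorem edgeDist_self {e : E} {s : I} : edgeDist (G := G) e s (G.edgePt e s) = 0 := by
  have := s.2.1
  have := s.2.2
  simp [edgeDist, *]

theorem edgeDist_lt {e : E} {s : I} {x : G.Space} {r : ℝ} (hr : r ≤ min (s : ℝ) (1 - s))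
    (h : edgeDist e s x < r) : ∃ t : I, x = G.edgePt e t ∧ |(t : ℝ) - s| < r := by
  rcases exists_pt x with ⟨w, rfl⟩ | ⟨e', t, h0, h1, rfl⟩
  · exact absurd h hr.not_gt
  · rw [edgeDist, lift_edgePt] at h
    split_ifs at h with hh
    · subst hh
      rcases min_lt_iff.1 h with h | h
      · exact ⟨t, rfl, h⟩
      · linarith
    · linarith

-- A continuous real function whose only zero is `x` separates `x` from every other point; this is
-- the source of the Hausdorff property.
open Classical in
variable (G) in
theorem exists_separating (x : G.Space) :
    ∃ u : G.Space → ℝ, Continuous u ∧ u x = 0 ∧ ∀ y, u y = 0 → y = x := by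
  rcases exists_pt x with ⟨w, rfl⟩ | ⟨e, s, h0, h1, rfl⟩
  · refine ⟨_, continuous_vertexDist w, vertexDist_self w, fun y hy => ?_⟩
    rcases vertexDist_lt le_rfl (hy.trans_lt one_pos) with h | ⟨e, t, rfl, h⟩
    · exact h
    · have ht0 := t.2.1
      have ht1 := t.2.2
      simp only [vertexDist, lift_edgePt] at hy
      rcases min_choice (if G.src e = w then (t : ℝ) else 1)
        (if G.tgt e = w then 1 - (t : ℝ) else 1) with h' | h' <;> rw [h'] at hy <;>
        split_ifs at hy with hh
      · rw [show t = 0 from Subtype.ext hy, edgePt_zero, hh]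
      · norm_num at hy
      · rw [show t = 1 from Subtype.ext (by change (t : ℝ) = 1; linarith), edgePt_one, hh]
      · norm_num at hy
  · refine ⟨_, continuous_edgeDist e s, edgeDist_self, fun y hy => ?_⟩
    have h0' : (0 : ℝ) < s := h0
    have h1' : (s : ℝ) < 1 := h1
    obtain ⟨t, rfl, ht⟩ := edgeDist_lt le_rfl
      (hy.trans_lt (lt_min h0' (by linarith) : 0 < min (s : ℝ) (1 - s)))
    simp only [edgeDist, lift_edgePt, if_true] at hy
    rw [min_eq_left ht.le, abs_eq_zero] at hy
    rw [show t = s from Subtype.ext (by linarith)]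

instance : T2Space G.Space := by
  refine ⟨fun x y hxy => ?_⟩
  obtain ⟨u, hu, hux, huy⟩ := G.exists_separating x
  exact separated_by_continuous hu fun h => hxy (huy y (h ▸ hux)).symm

end Topology

/-! ### Subgraphs spanned by edges -/

/-- The union of the closed edges in `S`. -/
def carrier (S : Set E) : Set G.Space := {x | ∃ e ∈ S, ∃ t : I, x = G.edgePt e t}

section Carrier

variable {G}

theorem edgePt_mem_carrier {S : Set E} {e : E} (he : e ∈ S) (t : I) :
    G.edgePt e t ∈ G.carrier S := ⟨e, he, t, rfl⟩

theorem mem_of_edgePt_mem_carrier {S : Set E} {e : E} {t : I} (h0 : 0 < t) (h1 : t < 1)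
    (h : G.edgePt e t ∈ G.carrier S) : e ∈ S := by
  obtain ⟨e', he', t', h⟩ := h
  exact (edgePt_inj h0 h1 h).1 ▸ he'

theorem vertexPt_mem_carrier {S : Set E} {v : V} :
    G.vertexPt v ∈ G.carrier S ↔ ∃ e ∈ S, G.src e = v ∨ G.tgt e = v := by
  constructor
  · rintro ⟨e, he, t, h⟩
    rcases eq_or_ne t 0 with rfl | h0
    · exact ⟨e, he, .inl (G.vertexPt_injective (h.trans (G.edgePt_zero e)).symm)⟩
    rcases eq_or_ne t 1 with rfl | h1
    · exact ⟨e, he, .inr (G.vertexPt_injective (h.trans (G.edgePt_one e)).symm)⟩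
    exact (edgePt_ne_vertexPt (unitInterval.pos_iff_ne_zero.2 h0)
      (unitInterval.lt_one_iff_ne_one.2 h1) v h.symm).elim
  · rintro ⟨e, he, rfl | rfl⟩
    · exact ⟨e, he, 0, (G.edgePt_zero e).symm⟩
    · exact ⟨e, he, 1, (G.edgePt_one e).symm⟩

theorem carrier_mono {S T : Set E} (h : S ⊆ T) : G.carrier S ⊆ G.carrier T := by
  rintro _ ⟨e, he, t, rfl⟩
  exact edgePt_mem_carrier (h he) t

theorem src_mem_carrier {S : Set E} {e : E} (he : e ∈ S) : G.vertexPt (G.src e) ∈ G.carrier S :=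
  vertexPt_mem_carrier.2 ⟨e, he, .inl rfl⟩

theorem tgt_mem_carrier {S : Set E} {e : E} (he : e ∈ S) : G.vertexPt (G.tgt e) ∈ G.carrier S :=
  vertexPt_mem_carrier.2 ⟨e, he, .inr rfl⟩

variable (G) in
theorem isClosed_carrier (S : Set E) : IsClosed (G.carrier S) := by
  refine isClosed_of_edges fun e => ?_
  by_cases he : e ∈ S
  · convert isClosed_univ
    exact eq_univ_of_forall fun t => edgePt_mem_carrier he t
  · have : G.edgePt e ⁻¹' G.carrier S ⊆ {0, 1} := by
      intro t ht
      by_contra h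
      simp only [mem_insert_iff, mem_singleton_iff, not_or] at h
      exact he (mem_of_edgePt_mem_carrier (unitInterval.pos_iff_ne_zero.2 h.1)
        (unitInterval.lt_one_iff_ne_one.2 h.2) ht)
    exact ((toFinite {(0 : I), 1}).subset this).isClosed

theorem isCompact_carrier {S : Set E} (hS : S.Finite) : IsCompact (G.carrier S) := by
  have : G.carrier S = ⋃ e ∈ S, range (G.edgePt e) := by
    ext x
    simp only [carrier, mem_ofPred_eq, mem_iUnion, mem_range, exists_prop, eq_comm]
  rw [this]
  exact hS.isCompact_biUnion fun e _ => isCompact_range (G.continuous_edgePt e)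

/-- The edges that have an endpoint in common with an edge in `S`. -/
def touching (G : TopGraph V E) (S : Set E) : Set E :=
  {e | G.vertexPt (G.src e) ∈ G.carrier S ∨ G.vertexPt (G.tgt e) ∈ G.carrier S}

theorem subset_touching (S : Set E) : S ⊆ G.touching S := fun _ he => .inl (src_mem_carrier he)

theorem finite_vertices (S : Set E) (hS : S.Finite) :
    {v | G.vertexPt v ∈ G.carrier S}.Finite := by
  refine ((hS.image G.src).union (hS.image G.tgt)).subset ?_
  intro v hv
  obtain ⟨e, he, rfl | rfl⟩ := vertexPt_mem_carrier.1 hv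
  exacts [.inl ⟨e, he, rfl⟩, .inr ⟨e, he, rfl⟩]

theorem LocallyFinite.finite_edges (hG : G.LocallyFinite) {W : Set V} (hW : W.Finite) :
    {e | G.src e ∈ W ∨ G.tgt e ∈ W}.Finite := by
  refine (hW.biUnion fun v _ => hG v).subset ?_
  rintro e (h | h)
  · exact mem_biUnion h (Or.inl rfl)
  · exact mem_biUnion h (Or.inr rfl)

theorem LocallyFinite.finite_touching (hG : G.LocallyFinite) {S : Set E} (hS : S.Finite) :
    (G.touching S).Finite := hG.finite_edges (finite_vertices S hS)

/-- The layer of touching edges is a buffer: the two closed subgraphs on its sides share not even a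
vertex. Hence `carrier (touching S)` is a neighbourhood of `carrier S`, and avoidance of compact
sets can be phrased with subgraphs. -/
theorem disjoint_carrier_compl_touching (S : Set E) :
    Disjoint (G.carrier S) (G.carrier (G.touching S)ᶜ) := by
  rw [Set.disjoint_left]
  rintro x hx ⟨e, he, t, rfl⟩
  rcases eq_or_ne t 0 with rfl | h0
  · exact he (.inl (G.edgePt_zero e ▸ hx))
  rcases eq_or_ne t 1 with rfl | h1
  · exact he (.inr (G.edgePt_one e ▸ hx))
  exact he (subset_touching S (mem_of_edgePt_mem_carrier (unitInterval.pos_iff_ne_zero.2 h0)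
    (unitInterval.lt_one_iff_ne_one.2 h1) hx))

/-- Every vertex is an endpoint of an edge. -/
def NoIsolated (G : TopGraph V E) : Prop := ∀ v, ∃ e, G.src e = v ∨ G.tgt e = v

theorem NoIsolated.carrier_univ (h : G.NoIsolated) (x : G.Space) : x ∈ G.carrier univ := by
  rcases exists_pt x with ⟨v, rfl⟩ | ⟨e, t, -, -, rfl⟩
  · obtain ⟨e, he⟩ := h v
    exact vertexPt_mem_carrier.2 ⟨e, mem_univ e, he⟩
  · exact edgePt_mem_carrier (mem_univ e) t

theorem NoIsolated.mem_carrier_compl (h : G.NoIsolated) {S : Set E} {x : G.Space}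
    (hx : x ∉ G.carrier S) : x ∈ G.carrier Sᶜ := by
  obtain ⟨e, -, t, rfl⟩ := h.carrier_univ x
  exact edgePt_mem_carrier (mem_compl fun he => hx (edgePt_mem_carrier he t)) t

theorem carrier_mem_nhds (h : G.NoIsolated) {S : Set E} {x : G.Space} (hx : x ∈ G.carrier S) :
    G.carrier (G.touching S) ∈ 𝓝 x := by
  refine Filter.mem_of_superset ((G.isClosed_carrier (G.touching S)ᶜ).isOpen_compl.mem_nhds
    fun hx' => disjoint_left.1 (disjoint_carrier_compl_touching S) hx hx') fun y hy => ?_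
  by_contra hy'
  exact hy (h.mem_carrier_compl hy')

/-- Every point has a neighbourhood carried by finitely many edges, so compactness reduces all later
properness questions to finite sets of edges. -/
theorem exists_finite_carrier (hG : G.LocallyFinite) (h : G.NoIsolated) {K : Set G.Space}
    (hK : IsCompact K) : ∃ S : Set E, S.Finite ∧ K ⊆ G.carrier S := by
  refine hK.induction_on (p := fun K => ∃ S : Set E, S.Finite ∧ K ⊆ G.carrier S)
    ⟨∅, finite_empty, empty_subset _⟩ (fun s t hst ⟨S, hS, h⟩ => ⟨S, hS, hst.trans h⟩)
    (fun s t ⟨S, hS, h⟩ ⟨S', hS', h'⟩ => ⟨S ∪ S', hS.union hS', union_subset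
      (h.trans (carrier_mono subset_union_left)) (h'.trans (carrier_mono subset_union_right))⟩)
    fun x _ => ?_
  obtain ⟨e, -, t, rfl⟩ := h.carrier_univ x
  exact ⟨_, mem_nhdsWithin_of_mem_nhds
    (carrier_mem_nhds h (edgePt_mem_carrier (mem_singleton e) t)), G.touching {e},
    hG.finite_touching (finite_singleton e), Subset.rfl⟩

theorem weaklyLocallyCompactSpace (hG : G.LocallyFinite) (h : G.NoIsolated) :
    WeaklyLocallyCompactSpace G.Space := by
  refine ⟨fun x => ?_⟩
  obtain ⟨e, -, t, rfl⟩ := h.carrier_univ x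
  exact ⟨_, isCompact_carrier (hG.finite_touching (finite_singleton e)),
    carrier_mem_nhds h (edgePt_mem_carrier (mem_singleton e) t)⟩

end Carrier

end TopGraph

/-! ### Classes of paths -/

namespace ProperMaps

open CategoryTheory

variable {X Y : Type*} [TopologicalSpace X] [TopologicalSpace Y]

theorem exists_arrow {x y : X} (κ : FundamentalGroupoid.mk x ⟶ FundamentalGroupoid.mk y) :
    ∃ p : Path x y, arrow p = κ := Path.Homotopic.Quotient.mk_surjective κ

theorem arrow_eq_iff {x y : X} {p q : Path x y} : arrow p = arrow q ↔ p.Homotopic q :=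
  Path.Homotopic.Quotient.eq

theorem arrow_trans {x y z : X} (p : Path x y) (q : Path y z) :
    arrow (p.trans q) = arrow p ≫ arrow q := rfl

theorem arrow_symm {x y : X} (p : Path x y) : arrow p.symm = inv (arrow p) :=
  (Groupoid.inv_eq_inv (arrow p) : Groupoid.inv (arrow p) = _)

theorem arrow_refl (x : X) : arrow (Path.refl x) = 𝟙 (FundamentalGroupoid.mk x) := rfl

theorem arrow_subpath_comp {x y : X} (p : Path x y) (s t u : I) :
    arrow (p.subpath s t) ≫ arrow (p.subpath t u) = arrow (p.subpath s u) :=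
  arrow_eq_iff.2 ⟨Path.Homotopy.subpathTransSubpath p s t u⟩

/-- The class of the image of a path under a map. -/
abbrev mapArrow (f : C(X, Y)) {x y : X}
    (κ : FundamentalGroupoid.mk x ⟶ FundamentalGroupoid.mk y) :
    FundamentalGroupoid.mk (f x) ⟶ FundamentalGroupoid.mk (f y) :=
  (FundamentalGroupoid.map f).map κ

theorem mapArrow_arrow (f : C(X, Y)) {x y : X} (p : Path x y) :
    mapArrow f (arrow p) = arrow (p.map f.continuous) := rfl

theorem mapArrow_comp (f : C(X, Y)) {x y z : X}
    (κ : FundamentalGroupoid.mk x ⟶ FundamentalGroupoid.mk y)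
    (κ' : FundamentalGroupoid.mk y ⟶ FundamentalGroupoid.mk z) :
    mapArrow f (κ ≫ κ') = mapArrow f κ ≫ mapArrow f κ' := (FundamentalGroupoid.map f).map_comp κ κ'

theorem mapArrow_id (f : C(X, Y)) (x : X) :
    mapArrow f (𝟙 (FundamentalGroupoid.mk x)) = 𝟙 (FundamentalGroupoid.mk (f x)) := rfl

theorem mapArrow_inv (f : C(X, Y)) {x y : X}
    (κ : FundamentalGroupoid.mk x ⟶ FundamentalGroupoid.mk y) :
    mapArrow f (inv κ) = inv (mapArrow f κ) := (FundamentalGroupoid.map f).map_inv κ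

theorem mapArrow_evalAt {f g : C(X, Y)} (H : ContinuousMap.Homotopy f g) {x y : X}
    (κ : FundamentalGroupoid.mk x ⟶ FundamentalGroupoid.mk y) :
    mapArrow f κ ≫ arrow (H.evalAt y) = arrow (H.evalAt x) ≫ mapArrow g κ :=
  (FundamentalGroupoidFunctor.homotopicMapsNatIso H).naturality κ

/-- A property of classes of paths that is compatible with composition and inversion holds for a
path if it holds for its small pieces. -/
theorem arrow_induction {P : ∀ {x y : X}, (FundamentalGroupoid.mk x ⟶ FundamentalGroupoid.mk y) →
    Prop} (hinv : ∀ {x y : X} (κ : FundamentalGroupoid.mk x ⟶ FundamentalGroupoid.mk y),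
      P κ → P (inv κ))
    (hcomp : ∀ {x y z : X} (κ : FundamentalGroupoid.mk x ⟶ FundamentalGroupoid.mk y)
      (κ' : FundamentalGroupoid.mk y ⟶ FundamentalGroupoid.mk z), P κ → P κ' → P (κ ≫ κ'))
    {x y : X} (p : Path x y) (hloc : ∀ s : I, ∀ᶠ t in 𝓝 s, P (arrow (p.subpath s t))) :
    P (arrow p) := by
  -- A symmetric and transitive relation on the connected interval that holds locally relates `0` to
  -- `1`.
  let Q : I → I → Prop := fun s t => P (arrow (p.subpath s t))
  have : Std.Symm Q := ⟨fun s t h => by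
    have : arrow (p.subpath t s) = inv (arrow (p.subpath s t)) := by
      rw [← arrow_symm, Path.symm_subpath]
    simpa only [Q, this] using hinv _ h⟩
  have h01 : Q 0 1 := PreconnectedSpace.induction₂ Q hloc
    ⟨fun s t u h h' => by
      change P _
      rw [← arrow_subpath_comp p s t u]
      exact hcomp _ _ h h'⟩ 0 1
  change P (arrow (p.subpath 0 1)) at h01
  rw [Path.subpath_zero_one] at h01
  generalize_proofs h0 h1 at h01
  revert h01 h0 h1
  generalize p 0 = a
  generalize p 1 = b
  rintro rfl rfl h
  exact h

/-- Any two paths in `N` with the same ends are homotopic in the ambient space. -/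
def Slim (N : Set X) : Prop :=
  ∀ ⦃x y : X⦄ (p q : Path x y), range p ⊆ N → range q ⊆ N → arrow p = arrow q

/-- The images under `R` of two paths in `N` are the same constant path; naturality of the homotopy
along its tracks carries this equality back to the two paths. -/
theorem slim_of_homotopy {N : Set X} {R : C(X, X)}
    (H : ContinuousMap.Homotopy (ContinuousMap.id X) R) (z : X) (hR : ∀ x ∈ N, R x = z) :
    Slim N := by
  intro x y p q hp hq
  have e : p.map R.continuous = q.map R.continuous := by
    ext t
    exact (hR _ (hp ⟨t, rfl⟩)).trans (hR _ (hq ⟨t, rfl⟩)).symm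
  have hp' := mapArrow_evalAt H (arrow p)
  have hq' := mapArrow_evalAt H (arrow q)
  rw [mapArrow_arrow R p, e] at hp'
  rw [mapArrow_arrow R q, ← hp'] at hq'
  exact ((cancel_mono _).1 hq').symm

end ProperMaps

namespace TopGraph

open CategoryTheory ProperMaps

variable {V E : Type*} (G : TopGraph V E)

/-- The edge as a path. -/
def edgePath (e : E) : Path (G.vertexPt (G.src e)) (G.vertexPt (G.tgt e)) :=
  ⟨⟨G.edgePt e, G.continuous_edgePt e⟩, G.edgePt_zero e, G.edgePt_one e⟩

/-- The path along an edge between two of its points. -/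
def segment (e : E) (s t : I) : Path (G.edgePt e s) (G.edgePt e t) := (G.edgePath e).subpath s t

theorem range_segment (e : E) (s t : I) : range (G.segment e s t) = G.edgePt e '' uIcc s t :=
  (G.edgePath e).range_subpath s t

/-- The class of the path along an edge between two of its points. -/
def seg (e : E) (s t : I) :
    FundamentalGroupoid.mk (G.edgePt e s) ⟶ FundamentalGroupoid.mk (G.edgePt e t) :=
  arrow (G.segment e s t)

variable {G}

theorem seg_comp (e : E) (s t u : I) : G.seg e s t ≫ G.seg e t u = G.seg e s u :=
  arrow_subpath_comp (G.edgePath e) s t u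

theorem seg_self (e : E) (s : I) : G.seg e s s = 𝟙 _ := by
  have : G.segment e s s = Path.refl (G.edgePt e s) := (G.edgePath e).subpath_self s
  rw [seg, this, arrow_refl]

theorem inv_seg (e : E) (s t : I) : inv (G.seg e s t) = G.seg e t s := by
  rw [IsIso.inv_eq_of_hom_inv_id]
  rw [seg_comp, seg_self]

/-! ### Maps defined on the edges -/

section MapOf

variable {Z : Type*} [TopologicalSpace Z]

/-- The continuous map that is given by a path for each edge. -/
def mapOf (φ : V → Z) (P : ∀ e, Path (φ (G.src e)) (φ (G.tgt e))) : C(G.Space, Z) where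
  toFun := lift φ (fun e t => P e t) (fun e => (P e).source) (fun e => (P e).target)
  continuous_toFun := continuous_of_edges fun e => (P e).continuous

/-- A homotopy given by its tracks on the vertices and by squares on the edges. -/
def homotopyOfSquares {f g : C(G.Space, Z)} (γ : ∀ v, Path (f (G.vertexPt v)) (g (G.vertexPt v)))
    (F : E → C(I × I, Z)) (h0 : ∀ e s, F e (0, s) = f (G.edgePt e s))
    (h1 : ∀ e s, F e (1, s) = g (G.edgePt e s)) (hs : ∀ e t, F e (t, 0) = γ (G.src e) t)
    (ht : ∀ e t, F e (t, 1) = γ (G.tgt e) t) : ContinuousMap.Homotopy f g where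
  toFun p := lift (G := G) (fun v => γ v p.1) (fun e s => F e (p.1, s)) (fun e => hs e p.1)
    (fun e => ht e p.1) p.2
  continuous_toFun := continuous_prod_of_edges (fun v => (γ v).continuous)
    (fun e => (F e).continuous)
  map_zero_left x := by
    rcases x with ⟨⟨v, -⟩ | ⟨e, s⟩⟩
    exacts [(γ v).source, h0 e s]
  map_one_left x := by
    rcases x with ⟨⟨v, -⟩ | ⟨e, s⟩⟩
    exacts [(γ v).target, h1 e s]

/-- Homotopies of the paths give a homotopy of the maps. -/
def mapOfHomotopy {φ : V → Z} {P Q : ∀ e, Path (φ (G.src e)) (φ (G.tgt e))}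
    (H : ∀ e, (P e).Homotopy (Q e)) : ContinuousMap.Homotopy (mapOf φ P) (mapOf φ Q) :=
  homotopyOfSquares (fun v => Path.refl (φ v)) (fun e => (H e).toHomotopy.toContinuousMap)
    (fun e s => (H e).map_zero_left s) (fun e s => (H e).map_one_left s)
    (fun e t => (H e).source t) (fun e t => (H e).target t)

theorem mapOf_edgePath : mapOf G.vertexPt G.edgePath = ContinuousMap.id G.Space :=
  ContinuousMap.ext fun x => by rcases x with ⟨⟨v, -⟩ | ⟨e, s⟩⟩ <;> rfl

end MapOf

/-! ### Small neighbourhoods -/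

/-- A map of the graph homotopic to the identity that reparametrizes the edges. -/
theorem exists_reparam (ρ : E → C(I, I)) (h0 : ∀ e, ρ e 0 = 0) (h1 : ∀ e, ρ e 1 = 1) :
    ∃ R : C(G.Space, G.Space), Nonempty (ContinuousMap.Homotopy (ContinuousMap.id G.Space) R) ∧
      (∀ v, R (G.vertexPt v) = G.vertexPt v) ∧ ∀ e t, R (G.edgePt e t) = G.edgePt e (ρ e t) :=
  ⟨mapOf G.vertexPt fun e => (G.edgePath e).reparam (ρ e) (ρ e).continuous (h0 e) (h1 e),
    ⟨mapOf_edgePath (G := G) ▸ mapOfHomotopy fun _ => Path.Homotopy.reparam _ _ _ _ _⟩,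
    fun _ => rfl, fun _ _ => rfl⟩

/-- A reparametrization that is constant near `s` and fixes the ends. -/
def focus (s : I) : C(I, I) where
  toFun t := ⟨max (min (2 * t) s) (2 * t - 1), by
    have := t.2.1; have := t.2.2; have := s.2.1; have := s.2.2
    exact ⟨le_max_of_le_left (le_min (by linarith) s.2.1), max_le (min_le_of_right_le s.2.2)
      (by linarith)⟩⟩
  continuous_toFun := by fun_prop

theorem focus_zero (s : I) : focus s 0 = 0 := Subtype.ext (by
  change max (min (2 * (0 : ℝ)) s) (2 * (0 : ℝ) - 1) = 0
  have := s.2.1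
  rw [mul_zero, min_eq_left this, max_eq_left (by linarith)])

theorem focus_one (s : I) : focus s 1 = 1 := Subtype.ext (by
  change max (min (2 * (1 : ℝ)) s) (2 * (1 : ℝ) - 1) = 1
  have := s.2.2
  rw [min_eq_right (by linarith), max_eq_right (by linarith)]; norm_num)

theorem focus_eq {s t : I} (h : (s : ℝ) ≤ 2 * t) (h' : 2 * (t : ℝ) - 1 ≤ s) : focus s t = s :=
  Subtype.ext (by
    change max (min (2 * (t : ℝ)) s) (2 * (t : ℝ) - 1) = s
    rw [min_eq_right h, max_eq_left h'])

/-- A reparametrization that is constant near the ends of the interval. -/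
def flatten : C(I, I) where
  toFun t := ⟨max 0 (min 1 (3 * t - 1)), le_max_left _ _, max_le zero_le_one (min_le_left _ _)⟩
  continuous_toFun := by fun_prop

theorem flatten_eq_zero {t : I} (h : (t : ℝ) ≤ 1 / 3) : flatten t = 0 := Subtype.ext (by
  change max 0 (min 1 (3 * (t : ℝ) - 1)) = 0
  exact max_eq_left (min_le_of_right_le (by linarith)))

theorem flatten_eq_one {t : I} (h : 2 / 3 ≤ (t : ℝ)) : flatten t = 1 := Subtype.ext (by
  change max 0 (min 1 (3 * (t : ℝ) - 1)) = 1
  rw [min_eq_left (by linarith)]; simp)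

/-- Flattening every edge near its ends is homotopic to the identity and collapses the star of
radius `1/3` to `v`. -/
theorem slim_vertexDist (v : V) : Slim {x : G.Space | vertexDist v x < 1 / 3} := by
  obtain ⟨R, ⟨H⟩, hv, he⟩ := exists_reparam (G := G) (fun _ => flatten)
    (fun _ => flatten_eq_zero (by norm_num)) (fun _ => flatten_eq_one (by norm_num))
  refine slim_of_homotopy H (G.vertexPt v) fun x hx => ?_
  rcases vertexDist_lt (by norm_num) hx with rfl | ⟨e, t, rfl, ⟨rfl, h⟩ | ⟨rfl, h⟩⟩
  · exact hv v
  · rw [he, flatten_eq_zero h.le, edgePt_zero]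
  · rw [he, flatten_eq_one (by linarith), edgePt_one]

theorem slim_edgeDist (e : E) (s : I) :
    Slim {x : G.Space | edgeDist e s x < min (s : ℝ) (1 - s) / 2} := by
  obtain ⟨R, ⟨H⟩, -, he⟩ := exists_reparam (G := G) (fun _ => focus s)
    (fun _ => focus_zero s) (fun _ => focus_one s)
  refine slim_of_homotopy H (G.edgePt e s) fun x hx => ?_
  have h0 := min_le_left (s : ℝ) (1 - s)
  have h1 := min_le_right (s : ℝ) (1 - s)
  have h2 : 0 ≤ min (s : ℝ) (1 - s) := le_min s.2.1 (by linarith [s.2.2])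
  obtain ⟨t, rfl, h⟩ := edgeDist_lt (by linarith) hx
  rw [abs_lt] at h
  rw [he, focus_eq (by linarith) (by linarith)]

theorem exists_slim (z : G.Space) : ∃ N ∈ 𝓝 z, Slim N := by
  rcases exists_pt z with ⟨v, rfl⟩ | ⟨e, s, h0, h1, rfl⟩
  · refine ⟨_, (isOpen_lt (continuous_vertexDist v) continuous_const).mem_nhds ?_,
      slim_vertexDist v⟩
    simp [vertexDist_self]
  · refine ⟨_, (isOpen_lt (continuous_edgeDist e s) continuous_const).mem_nhds ?_,
      slim_edgeDist e s⟩
    have h0' : (0 : ℝ) < s := h0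
    have h1' : (s : ℝ) < 1 := h1
    simp only [mem_ofPred_eq, edgeDist_self]
    have : 0 < min (s : ℝ) (1 - s) := lt_min h0' (by linarith)
    linarith

/-! ### Classes generated by the edges in a set -/

/-- The class is a composition of classes of paths along edges in `S`. -/
inductive EdgeGen (S : Set E) : ∀ {x y : G.Space},
    (FundamentalGroupoid.mk x ⟶ FundamentalGroupoid.mk y) → Prop
  | id (x : G.Space) : EdgeGen S (𝟙 (FundamentalGroupoid.mk x))
  | seg {e : E} (he : e ∈ S) (s t : I) : EdgeGen S (G.seg e s t)
  | comp {x y z : G.Space} {κ : FundamentalGroupoid.mk x ⟶ FundamentalGroupoid.mk y}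
      {κ' : FundamentalGroupoid.mk y ⟶ FundamentalGroupoid.mk z} :
      EdgeGen S κ → EdgeGen S κ' → EdgeGen S (κ ≫ κ')

theorem EdgeGen.inv {S : Set E} {x y : G.Space}
    {κ : FundamentalGroupoid.mk x ⟶ FundamentalGroupoid.mk y} (h : EdgeGen S κ) :
    EdgeGen S (CategoryTheory.inv κ) := by
  induction h with
  | id x => simpa using EdgeGen.id x
  | seg he s t => rw [inv_seg]; exact .seg he t s
  | comp _ _ h h' => rw [IsIso.inv_comp]; exact .comp h' h

theorem EdgeGen.mono {S T : Set E} (hST : S ⊆ T) {x y : G.Space}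
    {κ : FundamentalGroupoid.mk x ⟶ FundamentalGroupoid.mk y} (h : EdgeGen S κ) :
    EdgeGen T κ := by
  induction h with
  | id x => exact .id x
  | seg he s t => exact .seg (hST he) s t
  | comp _ _ h h' => exact .comp h h'

theorem EdgeGen.exists_finite {S : Set E} {x y : G.Space}
    {κ : FundamentalGroupoid.mk x ⟶ FundamentalGroupoid.mk y} (h : EdgeGen S κ) :
    ∃ T ⊆ S, T.Finite ∧ EdgeGen T κ := by
  induction h with
  | id x => exact ⟨∅, empty_subset _, finite_empty, .id x⟩
  | @seg e he s t =>
    exact ⟨{e}, singleton_subset_iff.2 he, finite_singleton e, .seg (mem_singleton e) s t⟩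
  | comp _ _ h h' =>
    obtain ⟨T, hTS, hT, h⟩ := h
    obtain ⟨T', hTS', hT', h'⟩ := h'
    exact ⟨T ∪ T', union_subset hTS hTS', hT.union hT',
      .comp (h.mono subset_union_left) (h'.mono subset_union_right)⟩

/-- The starting point is inserted because the constant class may sit at a point off the edges of
`S`. -/
theorem EdgeGen.exists_path {S : Set E} {x y : G.Space}
    {κ : FundamentalGroupoid.mk x ⟶ FundamentalGroupoid.mk y} (h : EdgeGen S κ) :
    ∃ p : Path x y, arrow p = κ ∧ range p ⊆ insert x (G.carrier S) := by
  induction h with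
  | id x => exact ⟨Path.refl x, rfl, by simp⟩
  | seg he s t =>
    refine ⟨_, rfl, ?_⟩
    rw [range_segment]
    rintro _ ⟨t, -, rfl⟩
    exact .inr (edgePt_mem_carrier he t)
  | comp _ _ h h' =>
    obtain ⟨p, rfl, hp⟩ := h
    obtain ⟨q, rfl, hq⟩ := h'
    refine ⟨p.trans q, rfl, ?_⟩
    rw [Path.trans_range]
    refine union_subset hp (hq.trans (insert_subset ?_ (subset_insert _ _)))
    exact hp p.target_mem_range

/-- A point of the carrier close to `z` is `z` itself or lies on an edge of `S` through `z`, and the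
straight segment along that edge does not leave the neighbourhood. Slimness lets this segment
replace any other short path. -/
theorem exists_local_edgeGen {S : Set E} {z : G.Space} (hz : z ∈ G.carrier S) :
    ∃ N ∈ 𝓝 z, Slim N ∧ ∀ y ∈ N, y ∈ G.carrier S →
      ∃ p : Path z y, range p ⊆ N ∧ EdgeGen S (arrow p) := by
  rcases exists_pt z with ⟨v, rfl⟩ | ⟨e, s, h0, h1, rfl⟩
  · refine ⟨_, (isOpen_lt (continuous_vertexDist v) continuous_const).mem_nhds (by
      simp [vertexDist_self]), slim_vertexDist v, fun y hy hyS => ?_⟩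
    by_cases hyv : y = G.vertexPt v
    · subst hyv
      exact ⟨Path.refl _, by simp [vertexDist_self], .id _⟩
    rcases vertexDist_lt (by norm_num) hy with rfl | ⟨e, t, rfl, ⟨rfl, h⟩ | ⟨rfl, h⟩⟩
    · exact (hyv rfl).elim
    · have he : e ∈ S := by
        refine mem_of_edgePt_mem_carrier (unitInterval.pos_iff_ne_zero.2 ?_)
          (unitInterval.lt_one_iff_ne_one.2 ?_) hyS
        · rintro rfl
          exact hyv (G.edgePt_zero e)
        · rintro rfl
          norm_num at h
      rw [← edgePt_zero]
      refine ⟨G.segment e 0 t, ?_, .seg he 0 t⟩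
      rw [range_segment]
      rintro _ ⟨u, hu, rfl⟩
      rw [uIcc_of_le unitInterval.nonneg'] at hu
      have : (u : ℝ) ≤ t := hu.2
      change vertexDist _ _ < _
      simp only [vertexDist, lift_edgePt, if_true]
      exact (min_le_left _ _).trans_lt (by linarith)
    · have he : e ∈ S := by
        refine mem_of_edgePt_mem_carrier (unitInterval.pos_iff_ne_zero.2 ?_)
          (unitInterval.lt_one_iff_ne_one.2 ?_) hyS
        · rintro rfl
          norm_num at h
        · rintro rfl
          exact hyv (G.edgePt_one e)
      rw [← edgePt_one]
      refine ⟨G.segment e 1 t, ?_, .seg he 1 t⟩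
      rw [range_segment]
      rintro _ ⟨u, hu, rfl⟩
      rw [uIcc_of_ge unitInterval.le_one'] at hu
      have : (t : ℝ) ≤ u := hu.1
      change vertexDist _ _ < _
      simp only [vertexDist, lift_edgePt, if_true]
      exact (min_le_right _ _).trans_lt (by linarith)
  · have he : e ∈ S := mem_of_edgePt_mem_carrier h0 h1 hz
    have h0' : (0 : ℝ) < s := h0
    have h1' : (s : ℝ) < 1 := h1
    have hpos : 0 < min (s : ℝ) (1 - s) := lt_min h0' (by linarith)
    refine ⟨_, (isOpen_lt (continuous_edgeDist e s) continuous_const).mem_nhds (by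
      simp only [mem_ofPred_eq, edgeDist_self]; linarith), slim_edgeDist e s, fun y hy _ => ?_⟩
    obtain ⟨t, rfl, h⟩ := edgeDist_lt (by linarith) hy
    refine ⟨G.segment e s t, ?_, .seg he s t⟩
    rw [range_segment]
    rintro _ ⟨u, hu, rfl⟩
    have : |(u : ℝ) - s| ≤ |(t : ℝ) - s| := abs_sub_left_of_mem_uIcc (a := (s : ℝ)) hu
    change edgeDist _ _ _ < _
    simp only [edgeDist, lift_edgePt, if_true]
    exact (min_le_left _ _).trans_lt (by linarith)

/-- The class of a path that runs in the edges of `S` is generated by these edges. -/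
theorem edgeGen_of_range_subset {S : Set E} {x y : G.Space} (p : Path x y)
    (hp : range p ⊆ G.carrier S) : EdgeGen S (arrow p) := by
  refine arrow_induction (P := fun κ => EdgeGen S κ) (fun _ h => h.inv) (fun _ _ h h' => h.comp h')
    p fun s => ?_
  obtain ⟨N, hN, hslim, h⟩ := exists_local_edgeGen (hp ⟨s, rfl⟩)
  have hev : ∀ᶠ t in 𝓝 s, uIcc s t ⊆ p ⁻¹' N := by
    have hmem : p ⁻¹' N ∈ 𝓝 s := p.continuous.continuousAt hN
    exact (Filter.Tendsto.uIcc tendsto_const_nhds Filter.tendsto_id).eventually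
      (Filter.eventually_smallSets_subset.2 hmem)
  filter_upwards [hev] with t ht
  obtain ⟨q, hq, hgen⟩ := h (p t) (ht right_mem_uIcc) (hp ⟨t, rfl⟩)
  rwa [hslim (p.subpath s t) q (by
    rw [Path.range_subpath]
    exact image_subset_iff.2 ht) hq]

end TopGraph

namespace TopGraph

open CategoryTheory ProperMaps

variable {V E : Type*} (G : TopGraph V E)

/-! ### Holonomy in the free group on the edges -/

/-- The covering graph whose deck group is the free group on the edges; crossing the edge `e`
multiplies the sheet by the generator `e`. -/
def cover : TopGraph (V × FreeGroup E) (E × FreeGroup E) where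
  src e := (G.src e.1, e.2)
  tgt e := (G.tgt e.1, e.2 * FreeGroup.of e.1)

/-- The projection of the covering graph. -/
def coverProj : C(G.cover.Space, G.Space) :=
  mapOf (fun v => G.vertexPt v.1) (fun e => G.edgePath e.1)

instance : MulAction (FreeGroup E) G.cover.Space where
  smul g := lift (G := G.cover) (fun v => G.cover.vertexPt (v.1, g * v.2))
    (fun e t => G.cover.edgePt (e.1, g * e.2) t) (fun e => edgePt_zero _ _)
    (fun e => (edgePt_one _ _).trans (by simp [cover, mul_assoc]))
  one_smul x := by
    rcases x with ⟨⟨v, -⟩ | ⟨e, t⟩⟩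
    · change G.cover.vertexPt (v.1, 1 * v.2) = G.cover.vertexPt v
      rw [one_mul]
    · change G.cover.edgePt (e.1, 1 * e.2) t = G.cover.edgePt e t
      rw [one_mul]
  mul_smul g h x := by
    rcases x with ⟨⟨v, -⟩ | ⟨e, t⟩⟩
    · change G.cover.vertexPt (v.1, g * h * v.2) = G.cover.vertexPt (v.1, g * (h * v.2))
      rw [mul_assoc]
    · change G.cover.edgePt (e.1, g * h * e.2) t = G.cover.edgePt (e.1, g * (h * e.2)) t
      rw [mul_assoc]

theorem smul_vertexPt (g : FreeGroup E) (v : V × FreeGroup E) :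
    g • G.cover.vertexPt v = G.cover.vertexPt (v.1, g * v.2) := rfl

theorem smul_edgePt (g : FreeGroup E) (e : E × FreeGroup E) (t : I) :
    g • G.cover.edgePt e t = G.cover.edgePt (e.1, g * e.2) t := rfl

theorem isQuotientMap_coverProj : IsQuotientMap G.coverProj := by
  refine ⟨isCoinducing_iff.2 fun U => ⟨fun h => isOpen_of_edges fun e => ?_,
    fun h => h.preimage G.coverProj.continuous⟩, fun x => ?_⟩
  · exact h.preimage (G.cover.continuous_edgePt (e, 1))
  · rcases x with ⟨⟨v, -⟩ | ⟨e, t⟩⟩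
    exacts [⟨G.cover.vertexPt (v, 1), rfl⟩, ⟨G.cover.edgePt (e, 1) t, rfl⟩]

/-- The free group acts freely on the sheets. Around a vertex the radius `1/3` keeps the
neighbourhoods of the two ends of an edge apart, so a translate that meets its original has the same
sheet. -/
theorem isQuotientCoveringMap_coverProj : IsQuotientCoveringMap G.coverProj (FreeGroup E) where
  toIsQuotientMap := G.isQuotientMap_coverProj
  continuous_const_smul g := continuous_of_edges fun e => G.cover.continuous_edgePt (e.1, g * e.2)
  apply_eq_iff_mem_orbit {x y} := by
    constructor
    · intro h
      rcases exists_pt x with ⟨v, rfl⟩ | ⟨e, t, h0, h1, rfl⟩ <;>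
        rcases exists_pt y with ⟨w, rfl⟩ | ⟨e', t', h0', h1', rfl⟩
      · obtain ⟨v, g⟩ := v
        obtain ⟨w, g'⟩ := w
        obtain rfl : v = w := G.vertexPt_injective h
        exact ⟨g * g'⁻¹, by simp [smul_vertexPt]⟩
      · exact (edgePt_ne_vertexPt h0' h1' _ h.symm).elim
      · exact (edgePt_ne_vertexPt h0 h1 _ h).elim
      · obtain ⟨e, g⟩ := e
        obtain ⟨e', g'⟩ := e'
        obtain ⟨h, rfl⟩ := edgePt_inj h0 h1 h
        obtain rfl : e = e' := h
        exact ⟨g * g'⁻¹, by simp [smul_edgePt]⟩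
    · rintro ⟨g, rfl⟩
      rcases y with ⟨⟨v, -⟩ | ⟨e, t⟩⟩ <;> rfl
  disjoint x := by
    rcases exists_pt x with ⟨v, rfl⟩ | ⟨e, s, h0, h1, rfl⟩
    · refine ⟨_, (isOpen_lt (continuous_vertexDist v) continuous_const).mem_nhds
        (show vertexDist v _ < (1 : ℝ) / 3 by rw [vertexDist_self]; norm_num), fun g hg => ?_⟩
      obtain ⟨_, ⟨y, hy, rfl⟩, hy'⟩ := hg
      change vertexDist v y < 1 / 3 at hy
      change vertexDist v (g • y) < 1 / 3 at hy'
      rcases exists_pt y with ⟨w, rfl⟩ | ⟨e, t, -, -, rfl⟩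
      · rw [smul_vertexPt] at hy'
        simp only [vertexDist, lift_vertexPt] at hy hy'
        split_ifs at hy hy' with h h'
        · rw [← h] at h'
          simpa using congrArg Prod.snd h'
        all_goals norm_num at *
      · rw [smul_edgePt] at hy'
        have key : ∀ {p : Prop} {_ : Decidable p} {a : ℝ}, (if p then a else 1) < 1 / 3 →
            p ∧ a < 1 / 3 := fun {p} _ {a} h => by
          split_ifs at h with hp
          · exact ⟨hp, h⟩
          · norm_num at h
        simp only [vertexDist, lift_edgePt, cover, min_lt_iff] at hy hy'
        rcases hy with hy | hy <;> rcases hy' with hy' | hy' <;>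
          obtain ⟨rfl, hy⟩ := key hy <;> obtain ⟨h, hy'⟩ := key hy'
        · simpa using congrArg Prod.snd h
        · linarith
        · linarith
        · simpa using congrArg Prod.snd h
    · have h0' : (0 : ℝ) < s := h0
      have h1' : (s : ℝ) < 1 := h1
      have hpos : 0 < min (s : ℝ) (1 - s) := lt_min h0' (by linarith)
      refine ⟨_, (isOpen_lt (continuous_edgeDist e s) continuous_const).mem_nhds
        (show edgeDist e s _ < min (s : ℝ) (1 - s) by rwa [edgeDist_self]), fun g hg => ?_⟩
      obtain ⟨_, ⟨y, hy, rfl⟩, hy'⟩ := hg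
      obtain ⟨t, rfl, ht⟩ := edgeDist_lt le_rfl hy
      obtain ⟨t', h, -⟩ := edgeDist_lt le_rfl hy'
      rw [abs_lt, lt_min_iff] at ht
      have hl := min_le_left (s : ℝ) (1 - s)
      have hr := min_le_right (s : ℝ) (1 - s)
      have ht0 : 0 < t := by
        change (0 : ℝ) < t
        linarith
      have ht1 : t < 1 := by
        change (t : ℝ) < 1
        linarith
      have := (edgePt_inj ht0 ht1 h).1
      simpa using congrArg Prod.snd this

open Classical in
/-- The change of the sheet along the edge `e` from its source to the parameter `t`. -/
noncomputable def jump (e : E) (t : I) : FreeGroup E := if t < 1 then 1 else FreeGroup.of e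

@[simp] theorem jump_zero (e : E) : jump e 0 = 1 := if_pos zero_lt_one

@[simp] theorem jump_one (e : E) : jump e 1 = FreeGroup.of e := if_neg (lt_irrefl _)

/-- The sheet of a point of the covering graph. -/
noncomputable def sheet : G.cover.Space → FreeGroup E :=
  lift (G := G.cover) (fun v => v.2) (fun e t => e.2 * jump e.1 t) (fun e => by simp [cover])
    (fun e => by simp [cover])

theorem sheet_smul (g : FreeGroup E) (x : G.cover.Space) : G.sheet (g • x) = g * G.sheet x := by
  rcases x with ⟨⟨v, -⟩ | ⟨e, t⟩⟩
  · rfl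
  · exact mul_assoc _ _ _

/-- Each fibre is an orbit of the deck group and `sheet` is equivariant, so it identifies the fibre
with the group. It is not continuous: its jumps at the targets of edges are what the holonomy
records. -/
theorem exists_unique_sheet_one (x : G.Space) :
    ∃! y : G.coverProj ⁻¹' {x}, G.sheet y.1 = 1 := by
  have hq := G.isQuotientCoveringMap_coverProj
  obtain ⟨y, rfl⟩ := hq.surjective x
  refine ⟨⟨(G.sheet y)⁻¹ • y, hq.apply_eq_iff_mem_orbit.2 ⟨_, rfl⟩⟩, by simp [sheet_smul], ?_⟩
  rintro ⟨z, hz⟩ h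
  obtain ⟨g, rfl⟩ := hq.apply_eq_iff_mem_orbit.1 hz
  rw [sheet_smul, mul_eq_one_iff_eq_inv] at h
  exact Subtype.ext (congrArg (· • y) h)

/-- The point over `x` in the sheet `1`. -/
noncomputable def basePt (x : G.Space) : G.coverProj ⁻¹' {x} :=
  (G.exists_unique_sheet_one x).choose

theorem sheet_basePt (x : G.Space) : G.sheet (G.basePt x).1 = 1 :=
  (G.exists_unique_sheet_one x).choose_spec.1

theorem eq_smul_basePt {x : G.Space} (y : G.coverProj ⁻¹' {x}) :
    y = G.isQuotientCoveringMap_coverProj.toPermFiber x (G.sheet y.1) (G.basePt x) := by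
  have hq := G.isQuotientCoveringMap_coverProj
  obtain ⟨g, rfl⟩ := hq.exists_toPermFiber_eq (G.basePt x) y
  have : G.sheet (hq.toPermFiber x g (G.basePt x)).1 = g := by
    change G.sheet (g • (G.basePt x).1) = g
    rw [sheet_smul, sheet_basePt, mul_one]
  rw [this]

variable {G}

/-- The holonomy of a class of paths: the product of the edges that are crossed. -/
noncomputable def hol {x y : G.Space}
    (κ : FundamentalGroupoid.mk x ⟶ FundamentalGroupoid.mk y) : FreeGroup E :=
  G.sheet (G.isQuotientCoveringMap_coverProj.isCoveringMap.monodromy κ (G.basePt x)).1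

/-- Monodromy commutes with deck translations, so the second factor may be started from the
translate of its base point that the first one reaches. -/
theorem hol_comp {x y z : G.Space} (κ : FundamentalGroupoid.mk x ⟶ FundamentalGroupoid.mk y)
    (κ' : FundamentalGroupoid.mk y ⟶ FundamentalGroupoid.mk z) :
    hol (κ ≫ κ') = hol κ * hol κ' := by
  have hq := G.isQuotientCoveringMap_coverProj
  have h1 : hq.isCoveringMap.monodromy (κ ≫ κ') (G.basePt x) =
      hq.isCoveringMap.monodromy κ' (hq.isCoveringMap.monodromy κ (G.basePt x)) :=
    hq.isCoveringMap.monodromy_trans_apply _ _ _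
  rw [hol, h1, G.eq_smul_basePt (hq.isCoveringMap.monodromy κ (G.basePt x)),
    hq.monodromy_toPermFiber]
  exact G.sheet_smul _ _

theorem hol_id (x : G.Space) : hol (𝟙 (FundamentalGroupoid.mk x)) = 1 := by
  have := hol_comp (𝟙 (FundamentalGroupoid.mk x)) (𝟙 (FundamentalGroupoid.mk x))
  rwa [Category.comp_id, left_eq_mul] at this

theorem hol_inv {x y : G.Space} (κ : FundamentalGroupoid.mk x ⟶ FundamentalGroupoid.mk y) :
    hol (inv κ) = (hol κ)⁻¹ := by
  rw [eq_inv_iff_mul_eq_one, ← hol_comp, IsIso.inv_hom_id, hol_id]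

theorem hol_seg (e : E) (s t : I) : hol (G.seg e s t) = (jump e s)⁻¹ * jump e t := by
  have hq := G.isQuotientCoveringMap_coverProj
  -- The lift of the edge is shifted by the inverse of the jump at `s`, so that its point over
  -- `edgePt e s` lies in the sheet `1`, also when `s = 1`.
  have hb : G.basePt (G.edgePt e s) = ⟨G.cover.edgePt (e, (jump e s)⁻¹) s, rfl⟩ :=
    (G.exists_unique_sheet_one _).unique (G.sheet_basePt _) (by
      change (jump e s)⁻¹ * jump e s = 1
      simp)
  rw [hol, hb]
  have := hq.isCoveringMap.monodromy_map (G.cover.seg (e, (jump e s)⁻¹) s t)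
  exact congrArg (fun y => G.sheet y.1) this

theorem EdgeGen.hol_mem {S : Set E} {x y : G.Space}
    {κ : FundamentalGroupoid.mk x ⟶ FundamentalGroupoid.mk y} (h : EdgeGen S κ) :
    hol κ ∈ Subgroup.closure (FreeGroup.of '' S) := by
  induction h with
  | id x => rw [hol_id]; exact one_mem _
  | @seg e he s t =>
    have : ∀ u, jump e u ∈ Subgroup.closure (FreeGroup.of '' S) := fun u => by
      unfold jump
      split_ifs
      exacts [one_mem _, Subgroup.subset_closure ⟨e, he, rfl⟩]
    rw [hol_seg]
    exact mul_mem (inv_mem (this s)) (this t)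
  | comp _ _ h h' => rw [hol_comp]; exact mul_mem h h'

/-- A generation principle: a multiplicative assignment on classes of paths, normalized by a
function of the points, is determined by its values on the edges. -/
theorem EdgeGen.hol_transform {M : Type*} [Group M] {S : Set E}
    (T : ∀ {x y : G.Space}, (FundamentalGroupoid.mk x ⟶ FundamentalGroupoid.mk y) → M)
    (hT : ∀ {x y z : G.Space} (κ : FundamentalGroupoid.mk x ⟶ FundamentalGroupoid.mk y)
      (κ' : FundamentalGroupoid.mk y ⟶ FundamentalGroupoid.mk z), T (κ ≫ κ') = T κ * T κ')
    (θ : FreeGroup E →* M) (hseg : ∀ e ∈ S, ∀ t, T (G.seg e 0 t) = θ (jump e t))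
    {x y : G.Space} {κ : FundamentalGroupoid.mk x ⟶ FundamentalGroupoid.mk y}
    (h : EdgeGen S κ) : T κ = θ (hol κ) := by
  have hid : ∀ x : G.Space, T (𝟙 (FundamentalGroupoid.mk x)) = 1 := fun x => by
    have := hT (𝟙 (FundamentalGroupoid.mk x)) (𝟙 (FundamentalGroupoid.mk x))
    rwa [Category.comp_id, left_eq_mul] at this
  induction h with
  | id x => rw [hid, hol_id, map_one]
  | @seg e he s t =>
    have : T (G.seg e 0 s) * T (G.seg e s t) = T (G.seg e 0 t) := by rw [← hT, seg_comp]
    rw [hol_seg, map_mul, map_inv, ← hseg e he, ← hseg e he, ← this, inv_mul_cancel_left]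
  | comp _ _ h h' => rw [hT, hol_comp, map_mul, h, h']

end TopGraph

namespace TopGraph

open CategoryTheory ProperMaps

variable {V E : Type*} {G : TopGraph V E}

theorem NoIsolated.edgeGen (h : G.NoIsolated) {x y : G.Space}
    (κ : FundamentalGroupoid.mk x ⟶ FundamentalGroupoid.mk y) : EdgeGen univ κ := by
  obtain ⟨p, rfl⟩ := exists_arrow κ
  exact edgeGen_of_range_subset p fun x _ => h.carrier_univ x

/-! ### Frames -/

/-- Classes of paths from a base point to the vertices extend along the edges. -/
theorem exists_frame {x₀ : G.Space}
    (τ' : ∀ x : G.Space, FundamentalGroupoid.mk x₀ ⟶ FundamentalGroupoid.mk x) :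
    ∃ τ : ∀ x : G.Space, FundamentalGroupoid.mk x₀ ⟶ FundamentalGroupoid.mk x,
      (∀ v, τ (G.vertexPt v) = τ' (G.vertexPt v)) ∧
      ∀ e t, t < 1 → τ (G.edgePt e t) = τ (G.edgePt e 0) ≫ G.seg e 0 t := by
  have key : ∀ x : G.Space, ∃ κ : FundamentalGroupoid.mk x₀ ⟶ FundamentalGroupoid.mk x,
      (∀ v, G.vertexPt v = x → κ = τ' x) ∧ ∀ e t, t < 1 → ∀ h : G.edgePt e t = x,
        κ = h ▸ (τ' (G.edgePt e 0) ≫ G.seg e 0 t) := by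
    intro x
    rcases exists_pt x with ⟨v, rfl⟩ | ⟨e, t, h0, h1, rfl⟩
    · refine ⟨τ' (G.vertexPt v), fun _ _ => rfl, fun e t ht h => ?_⟩
      obtain rfl : t = 0 := by
        by_contra h0
        exact edgePt_ne_vertexPt (unitInterval.pos_iff_ne_zero.2 h0) ht v h
      revert h
      generalize G.vertexPt v = x
      rintro rfl
      rw [seg_self, Category.comp_id]
    · refine ⟨τ' (G.edgePt e 0) ≫ G.seg e 0 t,
        fun v h => (edgePt_ne_vertexPt h0 h1 v h.symm).elim, fun e' t' _ h => ?_⟩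
      obtain ⟨rfl, rfl⟩ := edgePt_inj h0 h1 h.symm
      rfl
  choose τ hv he using key
  refine ⟨τ, fun v => hv _ v rfl, fun e t ht => ?_⟩
  rw [he _ e t ht rfl, hv (G.edgePt e 0) (G.src e) (G.edgePt_zero e).symm]

/-- The loop at the base point obtained from a class of paths by means of a frame. -/
noncomputable def toLoop {x₀ : G.Space} (τ : ∀ x : G.Space, FundamentalGroupoid.mk x₀ ⟶ FundamentalGroupoid.mk x)
    {x y : G.Space} (κ : FundamentalGroupoid.mk x ⟶ FundamentalGroupoid.mk y) :
    (FundamentalGroup G.Space x₀)ᵐᵒᵖ := .op (τ x ≫ κ ≫ inv (τ y))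

/-- The product `a * b` in the fundamental group is `b ≫ a`; passing to the opposite group makes the
assignment multiplicative in the order of paths. -/
theorem toLoop_comp {x₀ : G.Space}
    (τ : ∀ x : G.Space, FundamentalGroupoid.mk x₀ ⟶ FundamentalGroupoid.mk x)
    {x y z : G.Space} (κ : FundamentalGroupoid.mk x ⟶ FundamentalGroupoid.mk y)
    (κ' : FundamentalGroupoid.mk y ⟶ FundamentalGroupoid.mk z) :
    toLoop τ (κ ≫ κ') = toLoop τ κ * toLoop τ κ' := by
  refine congrArg MulOpposite.op ?_
  change _ = (τ x ≫ κ ≫ inv (τ y)) ≫ (τ y ≫ κ' ≫ inv (τ z))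
  simp

/-- The frame condition makes the loops of proper initial segments of edges trivial, so
`EdgeGen.hol_transform` applies: the loop depends on the path only through its holonomy. -/
theorem toLoop_eq {x₀ : G.Space}
    {τ : ∀ x : G.Space, FundamentalGroupoid.mk x₀ ⟶ FundamentalGroupoid.mk x}
    (hτ : ∀ e t, t < 1 → τ (G.edgePt e t) = τ (G.edgePt e 0) ≫ G.seg e 0 t) {x y : G.Space}
    {κ : FundamentalGroupoid.mk x ⟶ FundamentalGroupoid.mk y} (h : EdgeGen univ κ) :
    toLoop τ κ = FreeGroup.lift (fun e => toLoop τ (G.seg e 0 1)) (hol κ) := by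
  refine h.hol_transform (toLoop τ) (toLoop_comp τ) _ fun e _ t => ?_
  by_cases ht : t < 1
  · rw [jump, if_pos ht, map_one, toLoop, ← Category.assoc, ← hτ e t ht, IsIso.hom_inv_id]
    rfl
  · obtain rfl : t = 1 := le_antisymm unitInterval.le_one' (not_lt.1 ht)
    rw [jump_one, FreeGroup.lift_apply_of]

/-- Faithfulness of the holonomy: equal holonomies give equal loops for any frame, and the frame
cancels since the ends agree. -/
theorem EdgeGen.eq_of_hol_eq [PathConnectedSpace G.Space] {x y : G.Space}
    {κ κ' : FundamentalGroupoid.mk x ⟶ FundamentalGroupoid.mk y} (h : EdgeGen univ κ)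
    (h' : EdgeGen univ κ') (hh : hol κ = hol κ') : κ = κ' := by
  obtain ⟨τ, -, hτ⟩ := exists_frame (G := G) (x₀ := x)
    fun y => arrow (PathConnectedSpace.somePath x y)
  have := (toLoop_eq hτ h).trans ((congrArg _ hh).trans (toLoop_eq hτ h').symm)
  exact (cancel_mono (CategoryTheory.inv (τ y))).1
    ((cancel_epi (τ x)).1 (MulOpposite.op_injective this))

/-- The loops of the edges generate the fundamental group, and those outside `A` contribute nothing,
so finitely many generators suffice. -/
theorem genus_ne_top {x₀ : G.Space} (hG : G.NoIsolated)
    {τ : ∀ x : G.Space, FundamentalGroupoid.mk x₀ ⟶ FundamentalGroupoid.mk x}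
    (hτ : ∀ e t, t < 1 → τ (G.edgePt e t) = τ (G.edgePt e 0) ≫ G.seg e 0 t) {A : Set E}
    (hA : A.Finite) (h : ∀ e ∉ A, toLoop τ (G.seg e 0 1) = 1) : genus x₀ ≠ ⊤ := by
  let s : E → FundamentalGroup G.Space x₀ := fun e => (toLoop τ (G.seg e 0 1)).unop
  have hs : ∀ g : FreeGroup E, (FreeGroup.lift (fun e => toLoop τ (G.seg e 0 1)) g).unop ∈
      Subgroup.closure (s '' A) := by
    intro g
    induction g using FreeGroup.induction_on with
    | C1 => rw [map_one]; exact one_mem _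
    | of e =>
      rw [FreeGroup.lift_apply_of]
      by_cases he : e ∈ A
      · exact Subgroup.subset_closure ⟨e, he, rfl⟩
      · rw [h e he]; exact one_mem _
    | inv_of e h => rw [map_inv]; exact inv_mem h
    | mul x y hx hy => rw [map_mul]; exact mul_mem hy hx
  have htop : Subgroup.closure (s '' A) = ⊤ := by
    refine (Subgroup.eq_top_iff' _).2 fun δ => ?_
    let γ : FundamentalGroupoid.mk x₀ ⟶ FundamentalGroupoid.mk x₀ := inv (τ x₀) ≫ δ ≫ τ x₀
    have : (toLoop τ γ).unop = δ := by simp [toLoop, γ]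
    rw [← this, toLoop_eq hτ (hG.edgeGen γ)]
    exact hs _
  have : genus x₀ ≤ (s '' A).encard := iInf_le_of_le ⟨_, htop⟩ le_rfl
  exact (this.trans_lt (hA.image s).encard_lt_top).ne

/-! ### Holonomy and maps -/

theorem hol_congr {x y x' y' : G.Space} {p : Path x y} {q : Path x' y'} (h : ∀ t, p t = q t) :
    hol (arrow p) = hol (arrow q) := by
  obtain rfl : x = x' := by simpa using h 0
  obtain rfl : y = y' := by simpa using h 1
  rw [Path.ext (funext h)]

/-- The holonomy of the image of the initial part of an edge. -/
noncomputable def turn (F : C(G.Space, G.Space)) : G.Space → FreeGroup E :=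
  lift (fun _ => 1) (fun e t => open Classical in
    if t < 1 then hol (mapArrow F (G.seg e 0 t)) else 1)
    (fun e => by rw [if_pos zero_lt_one, seg_self, mapArrow_id, hol_id])
    (fun e => if_neg (lt_irrefl _))

/-- The endomorphism of the free group on the edges that is induced by a map. -/
noncomputable def edgeHom (F : C(G.Space, G.Space)) : FreeGroup E →* FreeGroup E :=
  FreeGroup.lift fun e => hol (mapArrow F (G.seg e 0 1))

theorem turn_vertexPt (F : C(G.Space, G.Space)) (v : V) : turn F (G.vertexPt v) = 1 := rfl

/-- A map need not send interior points of edges to points in the same gauge; conjugating by `turn`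
corrects this, and then the effect on holonomies is a homomorphism. -/
theorem EdgeGen.hol_mapArrow (F : C(G.Space, G.Space)) {x y : G.Space}
    {κ : FundamentalGroupoid.mk x ⟶ FundamentalGroupoid.mk y} (h : EdgeGen univ κ) :
    turn F x * hol (mapArrow F κ) * (turn F y)⁻¹ = edgeHom F (hol κ) := by
  refine h.hol_transform (fun {x y} κ => turn F x * hol (mapArrow F κ) * (turn F y)⁻¹)
    (fun κ κ' => ?_) _ fun e _ t => ?_
  · rw [mapArrow_comp, hol_comp]
    group
  · have h0 : turn F (G.edgePt e 0) = 1 := by rw [edgePt_zero, turn_vertexPt]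
    by_cases ht : t < 1
    · rw [h0, jump, if_pos ht, map_one, turn, lift_edgePt, if_pos ht]
      group
    · obtain rfl : t = 1 := le_antisymm unitInterval.le_one' (not_lt.1 ht)
      have h1 : turn F (G.edgePt e 1) = 1 := by rw [edgePt_one, turn_vertexPt]
      rw [h0, h1, jump_one, edgeHom, FreeGroup.lift_apply_of]
      group

theorem hol_mapArrow_seg {F : C(G.Space, G.Space)} {e : E}
    (h : ∀ t, F (G.edgePt e t) = G.edgePt e t) (s t : I) :
    hol (mapArrow F (G.seg e s t)) = hol (G.seg e s t) :=
  hol_congr (p := (G.segment e s t).map F.continuous) fun _ => h _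

theorem turn_eq_one {F : C(G.Space, G.Space)} {e : E} (h : ∀ t, F (G.edgePt e t) = G.edgePt e t)
    (t : I) : turn F (G.edgePt e t) = 1 := by
  rw [turn, lift_edgePt]
  split_ifs with ht
  · rw [hol_mapArrow_seg h, hol_seg, jump_zero, jump, if_pos ht, inv_one, one_mul]
  · rfl

theorem edgeHom_of {F : C(G.Space, G.Space)} {e : E} (h : ∀ t, F (G.edgePt e t) = G.edgePt e t) :
    edgeHom F (FreeGroup.of e) = FreeGroup.of e := by
  rw [edgeHom, FreeGroup.lift_apply_of, hol_mapArrow_seg h, hol_seg, jump_zero, jump_one, inv_one,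
    one_mul]

/-! ### Retractions onto connected subgraphs -/

/-- Vertices off the subgraph go to a base point `b`; every remaining edge then has its ends in the
path connected carrier and is sent to a path there. -/
theorem exists_retraction {S : Set E} (hS : IsPathConnected (G.carrier S)) :
    ∃ r : C(G.Space, G.Space), (∀ x, r x ∈ G.carrier S) ∧ ∀ x ∈ G.carrier S, r x = x := by
  classical
  obtain ⟨b, hb, -⟩ := id hS
  let φ : V → G.Space := fun v => if G.vertexPt v ∈ G.carrier S then G.vertexPt v else b
  have hφ : ∀ v, φ v ∈ G.carrier S := fun v => by
    simp only [φ]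
    split_ifs with h
    exacts [h, hb]
  have hφ' : ∀ v, G.vertexPt v ∈ G.carrier S → φ v = G.vertexPt v := fun v h => if_pos h
  have key : ∀ e, ∃ p : Path (φ (G.src e)) (φ (G.tgt e)), (∀ t, p t ∈ G.carrier S) ∧
      (e ∈ S → ∀ t, p t = G.edgePt e t) := by
    intro e
    by_cases he : e ∈ S
    · exact ⟨(G.edgePath e).cast (hφ' _ (src_mem_carrier he)) (hφ' _ (tgt_mem_carrier he)),
        fun t => edgePt_mem_carrier he t, fun _ t => rfl⟩
    · obtain ⟨p, hp⟩ := hS.joinedIn _ (hφ (G.src e)) _ (hφ (G.tgt e))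
      exact ⟨p, hp, fun h => (he h).elim⟩
  choose P hP hP' using key
  refine ⟨mapOf φ P, fun x => ?_, ?_⟩
  · rcases x with ⟨⟨v, -⟩ | ⟨e, t⟩⟩
    exacts [hφ v, hP e t]
  · rintro _ ⟨e, he, t, rfl⟩
    exact hP' e he t

/-- Push a representing path into the subgraph by the retraction. The retraction fixes the edges of
`S`, hence every word in them, so the pushed path has the same holonomy and represents the same
class. -/
theorem exists_path_of_hol_mem [PathConnectedSpace G.Space] (hG : G.NoIsolated) {S : Set E}
    (hS : IsPathConnected (G.carrier S)) {x y : G.Space} (hx : x ∈ G.carrier S)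
    (hy : y ∈ G.carrier S) (κ : FundamentalGroupoid.mk x ⟶ FundamentalGroupoid.mk y)
    (hκ : hol κ ∈ Subgroup.closure (FreeGroup.of '' S)) :
    ∃ p : Path x y, arrow p = κ ∧ range p ⊆ G.carrier S := by
  obtain ⟨r, hr, hr'⟩ := exists_retraction hS
  obtain ⟨p, rfl⟩ := exists_arrow κ
  have hturn : ∀ z ∈ G.carrier S, turn r z = 1 := by
    rintro _ ⟨e, he, t, rfl⟩
    exact turn_eq_one (fun t => hr' _ (edgePt_mem_carrier he t)) t
  refine ⟨(p.map r.continuous).cast (hr' x hx).symm (hr' y hy).symm, ?_, ?_⟩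
  · refine (hG.edgeGen _).eq_of_hol_eq (hG.edgeGen _) ?_
    have h1 := (hG.edgeGen (arrow p)).hol_mapArrow r
    rw [hturn x hx, hturn y hy, one_mul, inv_one, mul_one] at h1
    have h2 : edgeHom r (hol (arrow p)) = hol (arrow p) := by
      have : Subgroup.closure (FreeGroup.of '' S) ≤
          (edgeHom r).eqLocus (MonoidHom.id (FreeGroup E)) := by
        rw [Subgroup.closure_le]
        rintro _ ⟨e, he, rfl⟩
        exact edgeHom_of fun t => hr' _ (edgePt_mem_carrier he t)
      exact this hκ
    refine Eq.trans (hol_congr (q := p.map r.continuous) fun _ => ?_) (h1.trans h2)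
    rfl
  · rintro _ ⟨t, rfl⟩
    exact hr _

/-! ### Components of subgraphs -/

/-- The edges in `S` that can be joined to `x` inside `S`. -/
def comp (G : TopGraph V E) (S : Set E) (x : G.Space) : Set E :=
  {e ∈ S | JoinedIn (G.carrier S) x (G.vertexPt (G.src e))}

theorem comp_subset (S : Set E) (x : G.Space) : G.comp S x ⊆ S := fun _ h => h.1

theorem joinedIn_carrier_edgePt {S : Set E} {e : E} (he : e ∈ S) (s t : I) :
    JoinedIn (G.carrier S) (G.edgePt e s) (G.edgePt e t) :=
  ⟨G.segment e s t, fun _ => edgePt_mem_carrier he _⟩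

theorem mem_carrier_comp {S : Set E} {x y : G.Space} (h : JoinedIn (G.carrier S) x y) :
    y ∈ G.carrier (G.comp S x) := by
  obtain ⟨e, he, t, rfl⟩ := h.target_mem
  refine edgePt_mem_carrier (S := G.comp S x) ⟨he, ?_⟩ t
  rw [← edgePt_zero]
  exact h.trans (joinedIn_carrier_edgePt he t 0)

theorem range_subset_carrier_comp {S : Set E} {x y : G.Space} (p : Path x y)
    (hp : range p ⊆ G.carrier S) : range p ⊆ G.carrier (G.comp S x) := by
  rintro _ ⟨t, rfl⟩
  refine mem_carrier_comp ⟨(p.subpath 0 t).cast p.source.symm rfl, fun s => ?_⟩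
  exact hp (mem_range_self _)

theorem isPathConnected_carrier_comp {S : Set E} {x : G.Space} (hx : x ∈ G.carrier S) :
    IsPathConnected (G.carrier (G.comp S x)) := by
  refine ⟨x, mem_carrier_comp (JoinedIn.refl hx), ?_⟩
  rintro _ ⟨e, ⟨he, hj⟩, t, rfl⟩
  rw [← edgePt_zero] at hj
  obtain ⟨p, hp⟩ := hj.trans (joinedIn_carrier_edgePt he 0 t)
  refine ⟨p, fun t => range_subset_carrier_comp p ?_ ⟨t, rfl⟩⟩
  rintro _ ⟨t, rfl⟩
  exact hp t

theorem comp_eq_of_mem {S : Set E} {x y : G.Space} {e : E} (hx : e ∈ G.comp S x)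
    (hy : e ∈ G.comp S y) : G.comp S x = G.comp S y := by
  have h : JoinedIn (G.carrier S) x y := hx.2.trans hy.2.symm
  ext f
  exact and_congr_right fun _ => ⟨fun hf => h.symm.trans hf, fun hf => h.trans hf⟩

end TopGraph

/-! ### Free factors of free groups are malnormal -/

namespace FreeGroup

variable {α : Type*}

/-- By Nielsen–Schreier the subgroup generated by `a` and `b` is free. It is commutative, while two
distinct free generators never commute, so its rank is at most one. -/
theorem Commute.exists_zpow {a b : FreeGroup α} (h : Commute a b) :
    ∃ (z : FreeGroup α) (m n : ℤ), a = z ^ m ∧ b = z ^ n := by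
  let H : Subgroup (FreeGroup α) := Subgroup.closure {a, b}
  have hcomm : ∀ x y : H, x * y = y * x := by
    have := Subgroup.isMulCommutative_closure (k := {a, b}) (by
      rintro x (rfl | rfl) y (rfl | rfl)
      exacts [rfl, h, h.symm, rfl])
    exact fun x y => mul_comm' x y
  let φ := IsFreeGroup.toFreeGroup H
  have hsub : Subsingleton (IsFreeGroup.Generators H) := by
    refine ⟨fun x y => ?_⟩
    by_contra hxy
    have hc : of x * of y = of y * of x := by
      apply φ.symm.injective
      rw [_root_.map_mul, _root_.map_mul, hcomm]
    classical
    have := congrArg toWord hc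
    simp [toWord_mul, reduce.cons, hxy] at this
  have key : ∃ z : H, ∀ x : H, ∃ n : ℤ, x = z ^ n := by
    have hcl := closure_range_of (IsFreeGroup.Generators H)
    rcases isEmpty_or_nonempty (IsFreeGroup.Generators H) with he | ⟨⟨i⟩⟩
    · refine ⟨1, fun x => ⟨0, φ.injective ?_⟩⟩
      exact Subsingleton.elim _ _
    · have : range (of : IsFreeGroup.Generators H → _) = {of i} := by
        ext y
        simp only [mem_range, mem_singleton_iff]
        exact ⟨fun ⟨j, hj⟩ => by rw [← hj, Subsingleton.elim j i], fun h => ⟨i, h.symm⟩⟩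
      rw [this] at hcl
      refine ⟨φ.symm (of i), fun x => ?_⟩
      obtain ⟨n, hn⟩ := Subgroup.mem_closure_singleton.1 (hcl ▸ Subgroup.mem_top (φ x))
      exact ⟨n, φ.injective (by rw [map_zpow, φ.apply_symm_apply, hn])⟩
  obtain ⟨z, hz⟩ := key
  obtain ⟨m, hm⟩ := hz ⟨a, Subgroup.subset_closure (by simp)⟩
  obtain ⟨n, hn⟩ := hz ⟨b, Subgroup.subset_closure (by simp)⟩
  exact ⟨z, m, n, congrArg Subtype.val hm, congrArg Subtype.val hn⟩

open Classical in
/-- The retraction of a free group onto the subgroup generated by some of the generators. -/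
noncomputable def retract (A : Set α) : FreeGroup α →* FreeGroup α :=
  lift fun e => if e ∈ A then of e else 1

theorem retract_mem (A : Set α) (g : FreeGroup α) :
    retract A g ∈ Subgroup.closure (of '' A) := by
  induction g using FreeGroup.induction_on with
  | C1 => rw [_root_.map_one]; exact one_mem _
  | of e =>
    rw [retract, lift_apply_of]
    split_ifs with h
    exacts [Subgroup.subset_closure ⟨e, h, rfl⟩, one_mem _]
  | inv_of e h => rw [_root_.map_inv]; exact inv_mem h
  | mul x y hx hy => rw [_root_.map_mul]; exact mul_mem hx hy

theorem retract_eq_self {A : Set α} {g : FreeGroup α} (h : g ∈ Subgroup.closure (of '' A)) :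
    retract A g = g := by
  have : Subgroup.closure (of '' A) ≤ (retract A).eqLocus (MonoidHom.id _) := by
    rw [Subgroup.closure_le]
    rintro _ ⟨e, he, rfl⟩
    exact (lift_apply_of).trans (if_pos he)
  exact this h

theorem retract_eq_one {A B : Set α} (hAB : Disjoint A B) {g : FreeGroup α}
    (h : g ∈ Subgroup.closure (of '' B)) : retract A g = 1 := by
  have : Subgroup.closure (of '' B) ≤ (retract A).ker := by
    rw [Subgroup.closure_le]
    rintro _ ⟨e, he, rfl⟩
    exact (lift_apply_of).trans (if_neg fun h => disjoint_left.1 hAB h he)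
  exact this h

/-- If `A` and `B` were disjoint, the retraction onto the factor `A` would kill the conjugate but
send it to a conjugate of `a`. -/
theorem not_disjoint_of_conj_mem {A B : Set α} {g a : FreeGroup α}
    (ha : a ∈ Subgroup.closure (of '' A)) (ha1 : a ≠ 1)
    (h : g * a * g⁻¹ ∈ Subgroup.closure (of '' B)) : ¬ Disjoint A B := by
  intro hAB
  have := retract_eq_one hAB h
  rw [_root_.map_mul, _root_.map_mul, _root_.map_inv, retract_eq_self ha, conj_eq_one_iff] at this
  exact ha1 this

/-- Malnormality of free factors. Applying the retraction `r` shows that `r(g)⁻¹ g` commutes with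
`a`, so both are powers of one element `z`. Since `r` kills `r(g)⁻¹ g = z ^ n`, torsion-freeness
gives `n = 0` or `r(z) = 1`; the latter would force `a = 1`. -/
theorem mem_of_conj_mem {A : Set α} {g a : FreeGroup α}
    (ha : a ∈ Subgroup.closure (of '' A)) (ha1 : a ≠ 1)
    (h : g * a * g⁻¹ ∈ Subgroup.closure (of '' A)) : g ∈ Subgroup.closure (of '' A) := by
  have h1 := retract_eq_self h
  rw [_root_.map_mul, _root_.map_mul, _root_.map_inv, retract_eq_self ha] at h1
  have hc : Commute a ((retract A g)⁻¹ * g) := by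
    change a * ((retract A g)⁻¹ * g) = (retract A g)⁻¹ * g * a
    have : a = (retract A g)⁻¹ * (g * a * g⁻¹) * retract A g := by rw [← h1]; group
    nth_rewrite 1 [this]
    group
  obtain ⟨z, m, n, hm, hn⟩ := Commute.exists_zpow hc
  have h2 : (retract A z) ^ n = 1 := by
    rw [← map_zpow, ← hn, _root_.map_mul, _root_.map_inv, retract_eq_self (retract_mem A g), inv_mul_cancel]
  have h3 : n = 0 := by
    by_contra hn0
    have hz : retract A z = 1 := by
      exact (IsMulTorsionFree.zpow_eq_one_iff_left hn0).1 h2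
    have h4 := retract_eq_self ha
    rw [hm, map_zpow, hz, one_zpow] at h4
    exact ha1 (hm.trans h4.symm)
  rw [h3, zpow_zero, inv_mul_eq_one] at hn
  rw [← hn]
  exact retract_mem A g

end FreeGroup

namespace ProperMaps

open CategoryTheory
open TopologicalSpace (Compacts)

variable {X Y : Type*} [TopologicalSpace X] [TopologicalSpace Y]

/-! ### The inclusion into the end compactification -/

theorem IsComplComponent.isOpen [T2Space X] [LocallyPathConnectedSpace X] {K : Compacts X} {U : Set X} (h : IsComplComponent K U) :
    IsOpen U := by
  obtain ⟨x, -, rfl⟩ := h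
  exact K.isCompact.isClosed.isOpen_compl.connectedComponentIn

theorem isOpen_image_pt {U : Set X} (h : IsOpen U) : IsOpen (EndCompactification.pt '' U) :=
  TopologicalSpace.isOpen_generateFrom_of_mem (.inl ⟨U, h, rfl⟩)

theorem isOpen_hatSet {K : Compacts X} {U : Set X} (h : IsComplComponent K U) :
    IsOpen (hatSet K U) :=
  TopologicalSpace.isOpen_generateFrom_of_mem (.inr ⟨K, U, h, rfl⟩)

theorem pt_injective : Function.Injective (EndCompactification.pt : X → EndCompactification X) :=
  fun _ _ h => EndCompactification.pt.inj h

theorem continuous_pt [T2Space X] [LocallyPathConnectedSpace X] :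
     Continuous (EndCompactification.pt : X → EndCompactification X) := by
  refine continuous_generateFrom_iff.2 ?_
  rintro _ (⟨U, hU, rfl⟩ | ⟨K, U, hU, rfl⟩)
  · rwa [preimage_image_eq _ pt_injective]
  · convert hU.isOpen
    ext x
    simp [hatSet]

theorem isInducing_pt [T2Space X] [LocallyPathConnectedSpace X] :
     IsInducing (EndCompactification.pt : X → EndCompactification X) := by
  refine ⟨le_antisymm continuous_pt.le_induced fun U hU => ?_⟩
  exact ⟨_, isOpen_image_pt hU, preimage_image_eq _ pt_injective⟩

/-- The restriction to `X` of the first member of a pair. -/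
noncomputable def PH.restrict (p : PH X) : C(X, X) := p.2.choose

theorem PH.restrict_spec (p : PH X) (x : X) : p.1.1 (.pt x) = .pt (p.restrict x) :=
  p.2.choose_spec.choose_spec.2.1 x

theorem PH.isProperHomotopyEquiv_restrict (p : PH X) : IsProperHomotopyEquiv p.restrict :=
  ⟨_, p.2.choose_spec.choose_spec.1⟩

theorem PH.toMaps_eq (p : PH X) :
    p.toMaps = Maps.mk p.restrict p.isProperHomotopyEquiv_restrict := rfl

/-- As `X` carries the topology induced from the compactification, continuity may be tested after
composing with the inclusion, where restricting becomes precomposition. -/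
theorem PH.continuous_restrict [T2Space X] [LocallyPathConnectedSpace X] :
     Continuous (PH.restrict : PH X → C(X, X)) := by
  let ι : C(X, EndCompactification X) := ⟨_, continuous_pt⟩
  have hι : IsInducing ι := isInducing_pt
  refine (ContinuousMap.isInducing_postcomp ι hι).continuous_iff.2 ?_
  have : (fun p : PH X => ι.comp p.restrict) = fun p : PH X => p.1.1.comp ι := by
    funext p
    ext x
    exact (p.restrict_spec x).symm
  change Continuous fun p : PH X => ι.comp p.restrict
  rw [this]
  exact (ContinuousMap.continuous_precomp ι).comp (continuous_fst.comp continuous_subtype_val)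

/-! ### Maps that are close to each other -/

/-- Maps close to `f₀` act on the class `κ` as `f₀` does, up to short paths at the ends. -/
def NearbyAgree (f₀ : C(X, Y)) {x y : X}
    (κ : FundamentalGroupoid.mk x ⟶ FundamentalGroupoid.mk y) : Prop :=
  ∃ W ∈ 𝓝 (f₀ x), ∃ W' ∈ 𝓝 (f₀ y), ∀ᶠ f in 𝓝 f₀, ∀ (δ : Path (f₀ x) (f x))
    (δ' : Path (f₀ y) (f y)), range δ ⊆ W → range δ' ⊆ W' →
      arrow δ ≫ mapArrow f κ = mapArrow f₀ κ ≫ arrow δ'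

theorem exists_nhds_path [LocallyPathConnectedSpace Y] {y : Y} {W : Set Y} (hW : W ∈ 𝓝 y) :
    ∀ᶠ z in 𝓝 y, ∃ δ : Path y z, range δ ⊆ W := by
  obtain ⟨U, ⟨hU, hUc⟩, hUW⟩ := (path_connected_basis y).mem_iff.1 hW
  filter_upwards [hU] with z hz
  obtain ⟨δ, hδ⟩ := hUc.joinedIn y (mem_of_mem_nhds hU) z hz
  exact ⟨δ, range_subset_iff.2 fun t => hUW (hδ t)⟩

theorem nearbyAgree [LocallyPathConnectedSpace Y] (hY : ∀ y : Y, ∃ N ∈ 𝓝 y, Slim N)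
    (f₀ : C(X, Y)) {x y : X} (κ : FundamentalGroupoid.mk x ⟶ FundamentalGroupoid.mk y) :
    NearbyAgree f₀ κ := by
  obtain ⟨p, rfl⟩ := exists_arrow κ
  refine arrow_induction (P := fun κ => NearbyAgree f₀ κ) ?_ ?_ p fun s => ?_
  · rintro x y κ ⟨W, hW, W', hW', h⟩
    refine ⟨W', hW', W, hW, ?_⟩
    filter_upwards [h] with f hf δ δ' hδ hδ'
    have := hf δ' δ hδ' hδ
    rw [mapArrow_inv, mapArrow_inv, IsIso.comp_inv_eq, Category.assoc, IsIso.eq_inv_comp, this]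
  · rintro x y z κ κ' ⟨W, hW, W', hW', h⟩ ⟨U, hU, U', hU', h'⟩
    refine ⟨W, hW, U', hU', ?_⟩
    -- Two naturality squares are pasted along a short path at the middle point, which must be short
    -- for both pieces.
    have hev : ∀ᶠ f : C(X, Y) in 𝓝 f₀, ∃ δ : Path (f₀ y) (f y), range δ ⊆ W' ∩ U :=
      ((continuous_eval_const y).tendsto f₀).eventually
        (exists_nhds_path (Filter.inter_mem hW' hU))
    filter_upwards [h, h', hev] with f hf hf' ⟨δ₁, hδ₁⟩ δ δ' hδ hδ'
    rw [mapArrow_comp, mapArrow_comp, ← Category.assoc,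
      hf δ δ₁ hδ (hδ₁.trans inter_subset_left), Category.assoc,
      hf' δ₁ δ' (hδ₁.trans inter_subset_right) hδ', Category.assoc]
  -- A short piece and its images under nearby maps stay in one slim set, so the two ways around the
  -- square are homotopic.
  · obtain ⟨N, hN, hslim⟩ := hY (f₀ (p s))
    have hev : ∀ᶠ t in 𝓝 s, uIcc s t ⊆ p ⁻¹' (f₀ ⁻¹' interior N) := by
      have hmem : p ⁻¹' (f₀ ⁻¹' interior N) ∈ 𝓝 s :=
        (f₀.continuous.comp p.continuous).continuousAt (interior_mem_nhds.2 hN)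
      exact (Filter.Tendsto.uIcc tendsto_const_nhds Filter.tendsto_id).eventually
        (Filter.eventually_smallSets_subset.2 hmem)
    filter_upwards [hev] with t ht
    have hNt : N ∈ 𝓝 (f₀ (p t)) := mem_interior_iff_mem_nhds.1 (ht right_mem_uIcc)
    refine ⟨N, hN, N, hNt, ?_⟩
    have hmaps : MapsTo f₀ (range (p.subpath s t)) (interior N) := by
      rw [Path.range_subpath]
      rintro _ ⟨u, hu, rfl⟩
      exact ht hu
    filter_upwards [ContinuousMap.eventually_mapsTo (isCompact_range (p.subpath s t).continuous)
      isOpen_interior hmaps] with f hf δ δ' hδ hδ'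
    rw [mapArrow_arrow, mapArrow_arrow, ← arrow_trans, ← arrow_trans]
    have hr : ∀ g : C(X, Y), MapsTo g (range (p.subpath s t)) (interior N) →
        range ((p.subpath s t).map g.continuous) ⊆ N := by
      rintro g hg _ ⟨u, rfl⟩
      exact interior_subset (hg ⟨u, rfl⟩)
    refine hslim _ _ ?_ ?_ <;> rw [Path.trans_range]
    exacts [union_subset hδ (hr f hf), union_subset (hr f₀ hmaps) hδ']

/-! ### Continuity of `Ψ` -/

theorem exists_finite_of_isOpen {Γ : Type*} [Group Γ] {W : Set (MulAut Γ)} {φ₀ : MulAut Γ}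
    (hW : IsOpen[autTopology Γ] W) (h : φ₀ ∈ W) :
    ∃ S : Set Γ, S.Finite ∧ ∀ φ : MulAut Γ, (∀ γ ∈ S, φ γ = φ₀ γ) → φ ∈ W := by
  let _ : TopologicalSpace Γ := ⊥
  have : DiscreteTopology Γ := ⟨rfl⟩
  obtain ⟨T, hT, rfl⟩ := isOpen_induced_iff.1 hW
  obtain ⟨S, u, hu, hS⟩ := isOpen_pi_iff.1 hT _ h
  refine ⟨S, S.finite_toSet, fun φ hφ => hS fun γ hγ => ?_⟩
  change φ γ ∈ u γ
  rw [hφ γ hγ]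
  exact (hu γ hγ).2

theorem inducedHom_eq {x₀ : X} (f : C(X, X)) (p : Path (f x₀) x₀) (γ : FundamentalGroup X x₀) :
    inducedHom f p γ = inv (arrow p) ≫ mapArrow f γ ≫ arrow p := by
  rw [inducedHom_apply, Groupoid.inv_eq_inv]
  rfl

variable [PathConnectedSpace X]

theorem Psi_mk (x₀ : X) (f : C(X, X)) (hf : IsProperHomotopyEquiv f) (p : Path (f x₀) x₀) :
    Psi x₀ (Maps.mk f hf) = Out.mk (inducedAut ⟨f, hf⟩ p) :=
  outerClass_eq ⟨f, hf⟩ p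

/-- Both topologies are coinduced, so it suffices to find, near a pair `p`, representing
automorphisms that agree on a prescribed finite set of loops. -/
theorem continuous_Psi [T2Space X] [LocallyPathConnectedSpace X]
    (hX : ∀ x : X, ∃ N ∈ 𝓝 x, Slim N) (x₀ : X) : Continuous (Psi x₀) := by
  refine continuous_coinduced_dom.2 (continuous_def.2 fun U hU => isOpen_iff_mem_nhds.2 ?_)
  intro p hp
  let q : Path (p.restrict x₀) x₀ := PathConnectedSpace.somePath _ _
  change Psi x₀ p.toMaps ∈ U at hp
  rw [p.toMaps_eq, Psi_mk x₀ _ _ q] at hp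
  obtain ⟨S, hS, hSU⟩ := exists_finite_of_isOpen (isOpen_coinduced.1 hU) hp
  have hnear := fun γ : FundamentalGroup X x₀ => nearbyAgree hX p.restrict γ
  choose W hW W' hW' h using hnear
  -- One short path at the base point has to serve all loops in the finite set `S`.
  have hC : (⋂ γ ∈ S, W γ ∩ W' γ) ∈ 𝓝 (p.restrict x₀) :=
    (Filter.biInter_mem hS).2 fun γ _ => Filter.inter_mem (hW γ) (hW' γ)
  have hev : ∀ᶠ f in 𝓝 p.restrict, ∃ δ : Path (p.restrict x₀) (f x₀),
      range δ ⊆ ⋂ γ ∈ S, W γ ∩ W' γ :=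
    ((continuous_eval_const x₀).tendsto p.restrict).eventually (exists_nhds_path hC)
  have hall : ∀ᶠ f in 𝓝 p.restrict, ∃ δ : Path (p.restrict x₀) (f x₀), ∀ γ ∈ S,
      arrow δ ≫ mapArrow f (γ : FundamentalGroup X x₀) = mapArrow p.restrict γ ≫ arrow δ := by
    filter_upwards [hev, (Filter.eventually_all_finite hS).2 fun γ _ => h γ] with f ⟨δ, hδ⟩ hf
    refine ⟨δ, fun γ hγ => hf γ hγ δ δ ?_ ?_⟩
    · exact hδ.trans ((biInter_subset_of_mem hγ).trans inter_subset_left)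
    · exact hδ.trans ((biInter_subset_of_mem hγ).trans inter_subset_right)
  filter_upwards [PH.continuous_restrict.continuousAt.eventually hall] with p' ⟨δ, hδ⟩
  change Psi x₀ p'.toMaps ∈ U
  -- Returning to the base point through `δ` backwards makes the two automorphisms agree on `S`
  -- exactly, not only up to conjugation.
  rw [p'.toMaps_eq, Psi_mk x₀ _ _ (δ.symm.trans q)]
  refine hSU _ fun γ hγ => ?_
  change inducedHom p'.restrict _ γ = inducedHom p.restrict _ γ
  rw [inducedHom_eq, inducedHom_eq, arrow_trans, arrow_symm, IsIso.inv_comp, IsIso.inv_inv]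
  simp only [Category.assoc]
  rw [reassoc_of% (hδ γ hγ), IsIso.hom_inv_id_assoc]

end ProperMaps

namespace TopGraph

open CategoryTheory ProperMaps
open TopologicalSpace (Compacts)

variable {V E : Type*} {G : TopGraph V E}

/-! ### Connected graphs -/

/-- The quotient map to the set of classes, with the discrete topology, extends continuously over
the edges, so connectedness of the space makes it constant. -/
theorem setoid_of_connected [ConnectedSpace G.Space] (r : Setoid V)
    (h : ∀ e, r (G.src e) (G.tgt e)) (v w : V) : r v w := by
  let _ : TopologicalSpace (Quotient r) := ⊥
  have : DiscreteTopology (Quotient r) := ⟨rfl⟩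
  let q : G.Space → Quotient r := lift (fun v => ⟦v⟧) (fun e _ => ⟦G.src e⟧) (fun _ => rfl)
    (fun e => Quotient.sound (h e))
  have hq : Continuous q := continuous_of_edges fun e =>
    (continuous_const : Continuous fun _ : I => (⟦G.src e⟧ : Quotient r))
  exact Quotient.exact (PreconnectedSpace.constant inferInstance hq
    (x := G.vertexPt v) (y := G.vertexPt w))

/-- In a connected graph an isolated vertex is the whole graph, and a point has trivial fundamental
group. -/
theorem noIsolated_of_genus [ConnectedSpace G.Space] {x₀ : G.Space} (h : genus x₀ = ⊤) :
    G.NoIsolated := by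
  by_contra hG
  simp only [NoIsolated, not_forall, not_exists, not_or] at hG
  obtain ⟨v, hv⟩ := hG
  have hV : ∀ w, w = v := fun w => by
    have := setoid_of_connected (G := G) (Setoid.ker fun u => u = v)
      (fun e => by simp [(hv e).1, (hv e).2]) w v
    simpa [Setoid.ker, Function.onFun] using this
  have hX : Subsingleton G.Space := by
    refine ⟨fun x y => ?_⟩
    have : ∀ x : G.Space, x = G.vertexPt v := by
      rintro ⟨⟨w, -⟩ | ⟨e, t⟩⟩
      · exact congrArg G.vertexPt (hV w)
      · exact ((hv e).1 (hV _)).elim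
    rw [this x, this y]
  have hπ : Subsingleton (FundamentalGroup G.Space x₀) := by
    refine ⟨fun a b => ?_⟩
    obtain ⟨p, rfl⟩ := exists_arrow a
    obtain ⟨q, rfl⟩ := exists_arrow b
    rw [show p = q from Path.ext (funext fun t => Subsingleton.elim _ _)]
  have : genus x₀ ≤ (∅ : Set (FundamentalGroup G.Space x₀)).encard :=
    iInf_le_of_le ⟨∅, Subsingleton.elim _ _⟩ le_rfl
  simp [h] at this

theorem mem_of_exhaustion [ConnectedSpace G.Space] {A : ℕ → Set E}
    (h0 : (A 0).Nonempty) (hA : ∀ i, G.touching (A i) ⊆ A (i + 1)) (e : E) : ∃ i, e ∈ A i := by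
  have hmono : Monotone A := monotone_nat_of_le_succ fun i => (subset_touching _).trans (hA i)
  obtain ⟨e₀, he₀⟩ := h0
  have key : ∀ f i, f ∈ G.touching (A i) →
      ∃ j, G.vertexPt (G.src f) ∈ G.carrier (A j) ∧ G.vertexPt (G.tgt f) ∈ G.carrier (A j) :=
    fun f i hf => ⟨i + 1, src_mem_carrier (hA i hf), tgt_mem_carrier (hA i hf)⟩
  have := setoid_of_connected (G := G) (Setoid.ker fun u => ∃ i, G.vertexPt u ∈ G.carrier (A i))
    (fun f => by
      refine propext ⟨?_, ?_⟩
      · rintro ⟨i, hi⟩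
        obtain ⟨j, hj⟩ := key f i (.inl hi)
        exact ⟨j, hj.2⟩
      · rintro ⟨i, hi⟩
        obtain ⟨j, hj⟩ := key f i (.inr hi)
        exact ⟨j, hj.1⟩) (G.src e₀) (G.src e)
  obtain ⟨i, hi⟩ := (cast (show _ = _ from this) ⟨0, src_mem_carrier he₀⟩ :
    ∃ i, G.vertexPt (G.src e) ∈ G.carrier (A i))
  exact ⟨i + 1, hA i (.inl hi)⟩

theorem exists_subset_of_exhaustion {A : ℕ → Set E} (hA : Monotone A) (h : ∀ e, ∃ i, e ∈ A i)
    {S : Set E} (hS : S.Finite) : ∃ i, S ⊆ A i := by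
  induction S, hS using Set.Finite.induction_on with
  | empty => exact ⟨0, empty_subset _⟩
  | @insert e S _ _ ih =>
    obtain ⟨i, hi⟩ := ih
    obtain ⟨j, hj⟩ := h e
    exact ⟨max i j, insert_subset (hA (le_max_right i j) hj) (hi.trans (hA (le_max_left i j)))⟩

/-! ### Detours -/

/-- A potential for the edges of a finite set of bridges. -/
theorem exists_potential {F : Set E} (hF : ∀ f ∈ F, ∀ κ : FundamentalGroupoid.mk
      (G.vertexPt (G.src f)) ⟶ FundamentalGroupoid.mk (G.vertexPt (G.tgt f)), ¬ EdgeGen (F \ {f}) κ)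
    {T : Set E} (hT : T.Finite) (hTF : T ⊆ F) :
    ∃ g : V → FreeGroup E, ∀ e ∈ T, g (G.tgt e) = g (G.src e) * FreeGroup.of e := by
  classical
  induction T, hT using Set.Finite.induction_on with
  | empty => exact ⟨fun _ => 1, by simp⟩
  | @insert f T hf _ ih =>
    obtain ⟨g, hg⟩ := ih ((subset_insert _ _).trans hTF)
    -- `D` is the side of the target of the new edge `f`. As `f` is a bridge, its source lies on the
    -- other side.
    let D : Set V := {v | ∃ κ : FundamentalGroupoid.mk (G.vertexPt v) ⟶
      FundamentalGroupoid.mk (G.vertexPt (G.tgt f)), EdgeGen T κ}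
    have hsrc : G.src f ∉ D := by
      rintro ⟨κ, hκ⟩
      exact hF f (hTF (mem_insert f T)) κ (hκ.mono
        (subset_sdiff_singleton ((subset_insert f T).trans hTF) hf))
    have htgt : G.tgt f ∈ D := ⟨𝟙 _, .id _⟩
    have hD : ∀ e ∈ T, G.src e ∈ D ↔ G.tgt e ∈ D := by
      intro e he
      have h : EdgeGen T (arrow (G.edgePath e)) :=
        edgeGen_of_range_subset _ (by rintro _ ⟨t, rfl⟩; exact edgePt_mem_carrier he t)
      constructor
      · rintro ⟨κ, hκ⟩
        exact ⟨_, h.inv.comp hκ⟩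
      · rintro ⟨κ, hκ⟩
        exact ⟨_, h.comp hκ⟩
    -- Left multiplication by a constant on `D` preserves the relations for the edges of `T`, none
    -- of which leaves `D`; the constant is chosen so that the relation for `f` holds.
    refine ⟨fun v => if v ∈ D then g (G.src f) * FreeGroup.of f * (g (G.tgt f))⁻¹ * g v else g v,
      fun e he => ?_⟩
    rcases mem_insert_iff.1 he with rfl | he
    · simp only [if_pos htgt, if_neg hsrc]
      group
    · by_cases h : G.src e ∈ D
      · simp only [if_pos h, if_pos ((hD e he).1 h), hg e he, mul_assoc]
      · simp only [if_neg h, if_neg (fun h' => h ((hD e he).2 h')), hg e he]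

/-- A potential exhibits the holonomy as a coboundary, so it vanishes on closed paths. -/
theorem hol_eq_one_of_potential {T : Set E} {g : V → FreeGroup E}
    (hg : ∀ e ∈ T, g (G.tgt e) = g (G.src e) * FreeGroup.of e) {x : G.Space}
    {κ : FundamentalGroupoid.mk x ⟶ FundamentalGroupoid.mk x} (h : EdgeGen T κ) : hol κ = 1 := by
  classical
  let u : G.Space → FreeGroup E := lift g (fun e t => if t < 1 then g (G.src e) else g (G.tgt e))
    (fun e => if_pos zero_lt_one) (fun e => if_neg (lt_irrefl _))
  have := h.hol_transform (fun {x y} _ => (u x)⁻¹ * u y) (fun _ _ => by group)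
    (MonoidHom.id (FreeGroup E)) fun e he t => by
      simp only [u, lift_edgePt, jump, MonoidHom.id_apply, if_pos zero_lt_one]
      split_ifs
      · group
      · rw [hg e he]
        group
  rw [MonoidHom.id_apply] at this
  rw [← this, inv_mul_cancel]

variable [ConnectedSpace G.Space]

/-- Outside a finite set of edges of a graph of infinite genus, there is an edge with a detour. -/
theorem exists_detour {x₀ : G.Space} (h : genus x₀ = ⊤) {A : Set E} (hA : A.Finite) :
    ∃ b ∉ A, ∃ S : Set E, S.Finite ∧ Disjoint S (insert b A) ∧
      ∃ κ : FundamentalGroupoid.mk (G.vertexPt (G.src b)) ⟶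
        FundamentalGroupoid.mk (G.vertexPt (G.tgt b)), EdgeGen S κ := by
  have hG := noIsolated_of_genus h
  by_contra hcon
  -- Without a detour every edge outside `A` is a bridge of the subgraph outside `A`.
  have hF : ∀ f ∈ Aᶜ, ∀ κ : FundamentalGroupoid.mk (G.vertexPt (G.src f)) ⟶
      FundamentalGroupoid.mk (G.vertexPt (G.tgt f)), ¬ EdgeGen (Aᶜ \ {f}) κ := by
    intro f hf κ hκ
    obtain ⟨S, hS, hSfin, hκ⟩ := hκ.exists_finite
    refine hcon ⟨f, hf, S, hSfin, disjoint_left.2 fun e he he' => ?_, κ, hκ⟩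
    rcases mem_insert_iff.1 he' with rfl | he'
    exacts [(hS he).2 rfl, (hS he).1 he']
  -- A graph of bridges is a forest: path classes inside it are unique because its loops have
  -- trivial holonomy.
  have huniq : ∀ {x y : G.Space} (κ κ' : FundamentalGroupoid.mk x ⟶ FundamentalGroupoid.mk y),
      EdgeGen Aᶜ κ → EdgeGen Aᶜ κ' → κ = κ' := by
    intro x y κ κ' hκ hκ'
    refine (hG.edgeGen κ).eq_of_hol_eq (hG.edgeGen κ') ?_
    obtain ⟨T, hT, hTfin, hκT⟩ := (hκ.comp hκ'.inv).exists_finite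
    obtain ⟨g, hg⟩ := exists_potential hF hTfin hT
    have := hol_eq_one_of_potential hg hκT
    rwa [hol_comp, hol_inv, mul_inv_eq_one] at this
  -- A frame that reaches each component of the forest at one chosen point and continues inside it
  -- gives trivial loops for all edges outside `A`, which makes the genus finite.
  let r : Setoid G.Space := 
    { r := fun x y => ∃ κ : FundamentalGroupoid.mk x ⟶ FundamentalGroupoid.mk y, EdgeGen Aᶜ κ
      iseqv := ⟨fun x => ⟨_, .id x⟩, fun ⟨_, h⟩ => ⟨_, h.inv⟩, fun ⟨_, h⟩ ⟨_, h'⟩ => ⟨_, h.comp h'⟩⟩ }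
  have hr : ∀ x : G.Space, r (Quotient.mk r x).out x := fun x => Quotient.exact (Quotient.out_eq _)
  choose κ hκ using hr
  have hτ' : ∀ {x y : G.Space} (δ : FundamentalGroupoid.mk x ⟶ FundamentalGroupoid.mk y),
      EdgeGen Aᶜ δ → (arrow (PathConnectedSpace.somePath x₀ (Quotient.mk r x).out) ≫ κ x) ≫ δ =
        arrow (PathConnectedSpace.somePath x₀ (Quotient.mk r y).out) ≫ κ y := by
    intro x y δ hδ
    have e : Quotient.mk r x = Quotient.mk r y := Quotient.sound ⟨δ, hδ⟩
    have hx := hκ x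
    have hy := hκ y
    revert hx hy
    generalize κ x = κx
    generalize κ y = κy
    revert κx κy
    rw [e]
    intro κx κy hx hy
    rw [Category.assoc, huniq (κx ≫ δ) κy (hx.comp hδ) hy]
  obtain ⟨τ, hv, hτ⟩ := exists_frame fun x =>
    arrow (PathConnectedSpace.somePath x₀ (Quotient.mk r x).out) ≫ κ x
  have hv' : ∀ x : G.Space, (∃ v, G.vertexPt v = x) →
      τ x = arrow (PathConnectedSpace.somePath x₀ (Quotient.mk r x).out) ≫ κ x := by
    rintro _ ⟨v, rfl⟩
    exact hv v
  refine genus_ne_top hG hτ hA (fun e he => congrArg MulOpposite.op ?_) h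
  rw [hv' _ ⟨_, (G.edgePt_zero e).symm⟩, ← Category.assoc, hτ' _ (.seg he 0 1),
    ← hv' _ ⟨_, (G.edgePt_one e).symm⟩, IsIso.hom_inv_id]
  rfl

/-- Removing edges that have detours does not disconnect the vertices. -/
theorem exists_edgeGen_of_detours {B : Set E}
    (h : ∀ b ∈ B, ∃ κ : FundamentalGroupoid.mk (G.vertexPt (G.src b)) ⟶
      FundamentalGroupoid.mk (G.vertexPt (G.tgt b)), EdgeGen Bᶜ κ) (v w : V) :
    ∃ κ : FundamentalGroupoid.mk (G.vertexPt v) ⟶ FundamentalGroupoid.mk (G.vertexPt w),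
      EdgeGen Bᶜ κ := by
  refine setoid_of_connected (G := G)
    { r := fun v w => ∃ κ : FundamentalGroupoid.mk (G.vertexPt v) ⟶
        FundamentalGroupoid.mk (G.vertexPt w), EdgeGen Bᶜ κ
      iseqv := ⟨fun x => ⟨_, .id _⟩, fun ⟨_, h⟩ => ⟨_, h.inv⟩,
        fun ⟨_, h⟩ ⟨_, h'⟩ => ⟨_, h.comp h'⟩⟩ } (fun e => ?_) v w
  by_cases he : e ∈ B
  · exact h e he
  · exact ⟨arrow (G.edgePath e), edgeGen_of_range_subset _ (by
      rintro _ ⟨t, rfl⟩; exact edgePt_mem_carrier he t)⟩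

/-! ### The components of the complement of a finite subgraph -/

/-- A component without such a midpoint would contain every edge that it meets. It would then be
open and closed, hence everything, although it misses `A`. -/
theorem exists_midpoint_mem {A : Set E} (hA : A.Nonempty) {x : G.Space} (hx : x ∉ G.carrier A) :
    ∃ e ∈ G.touching A, ∃ t : I, (t : ℝ) = 1 / 2 ∧
      G.edgePt e t ∈ connectedComponentIn (G.carrier A)ᶜ x := by
  by_contra hcon
  push Not at hcon
  let U := connectedComponentIn (G.carrier A)ᶜ x
  let m : I := ⟨1 / 2, by norm_num, by norm_num⟩
  have hUo : IsOpen U := (G.isClosed_carrier A).isOpen_compl.connectedComponentIn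
  have hsub : U ⊆ (G.carrier A)ᶜ := connectedComponentIn_subset _ _
  have hjoin : ∀ e s t, G.edgePt e s ∈ U → G.edgePt e '' uIcc s t ⊆ (G.carrier A)ᶜ →
      G.edgePt e t ∈ U := by
    intro e s t hs h
    have hc : IsPreconnected (G.edgePt e '' uIcc s t) :=
      isPreconnected_uIcc.image _ (G.continuous_edgePt e).continuousOn
    have := hc.subset_connectedComponentIn (mem_image_of_mem _ left_mem_uIcc) h
    rw [← connectedComponentIn_eq hs] at this
    exact this (mem_image_of_mem _ right_mem_uIcc)
  have hedge : ∀ e s t, G.edgePt e s ∈ U → G.edgePt e t ∈ U := by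
    intro e s t hs
    have he : e ∉ A := fun he => hsub hs (edgePt_mem_carrier he s)
    by_cases het : e ∈ G.touching A
    · refine (hcon e het m rfl (hjoin e s m hs ?_)).elim
      rintro _ ⟨u, hu, rfl⟩ huA
      rcases eq_or_ne u s with rfl | hus
      · exact hsub hs huA
      refine he (mem_of_edgePt_mem_carrier ?_ ?_ huA)
      · refine unitInterval.pos_iff_ne_zero.2 ?_
        rintro rfl
        rcases mem_uIcc.1 hu with h | h
        · exact hus (le_antisymm unitInterval.nonneg' h.1)
        · have : (m : ℝ) ≤ 0 := h.1
          norm_num [m] at this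
      · refine unitInterval.lt_one_iff_ne_one.2 ?_
        rintro rfl
        rcases mem_uIcc.1 hu with h | h
        · have : 1 ≤ (m : ℝ) := h.2
          norm_num [m] at this
        · exact hus (le_antisymm h.2 unitInterval.le_one')
    · refine hjoin e s t hs ?_
      rintro _ ⟨u, -, rfl⟩ huA
      exact disjoint_left.1 (disjoint_carrier_compl_touching A) huA (edgePt_mem_carrier het u)
  have hUc : IsClosed U := by
    refine isClosed_of_edges fun e => ?_
    by_cases h : ∃ s, G.edgePt e s ∈ U
    · obtain ⟨s, hs⟩ := h
      convert isClosed_univ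
      exact eq_univ_of_forall fun t => hedge e s t hs
    · convert isClosed_empty
      exact eq_empty_of_forall_notMem fun t ht => h ⟨t, ht⟩
  have hU : U = univ := IsClopen.eq_univ ⟨hUc, hUo⟩ ⟨x, mem_connectedComponentIn hx⟩
  obtain ⟨e, he⟩ := hA
  exact hsub (hU ▸ mem_univ (G.edgePt e 0)) (edgePt_mem_carrier he 0)

theorem finite_components (hG : G.LocallyFinite) {A : Set E} (hA : A.Nonempty) (hfin : A.Finite) :
    {U | ∃ x ∉ G.carrier A, U = connectedComponentIn (G.carrier A)ᶜ x}.Finite := by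
  let m : I := ⟨1 / 2, by norm_num, by norm_num⟩
  refine ((hG.finite_touching hfin).image
    fun e => connectedComponentIn (G.carrier A)ᶜ (G.edgePt e m)).subset ?_
  rintro _ ⟨x, hx, rfl⟩
  obtain ⟨e, he, t, ht, h⟩ := exists_midpoint_mem hA hx
  obtain rfl : t = m := Subtype.ext ht
  exact ⟨e, he, (connectedComponentIn_eq h).symm⟩

/-- A sequence of connected sets that leaves every compact set accumulates at an end. -/
theorem exists_end (hG : G.LocallyFinite) (hG' : G.NoIsolated) (C : ℕ → Set G.Space)
    (hC : ∀ k, IsConnected (C k))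
    (hlim : ∀ K : Compacts G.Space, ∀ᶠ k in Filter.atTop, C k ⊆ (K : Set G.Space)ᶜ) :
    ∃ ε : Ends G.Space, ∀ K, ∃ᶠ k in Filter.atTop, C k ⊆ ε.1 K := by
  -- The ultrafilter selects for every `K` one of finitely many components, the one containing
  -- `u`-almost all sets of the sequence. Selections for different `K` are compatible since they
  -- contain a common `C k`.
  let u : Ultrafilter ℕ := Filter.hyperfilter ℕ
  have hu : (u : Filter ℕ) ≤ Filter.atTop := Nat.hyperfilter_le_atTop
  have key : ∀ K : Compacts G.Space, ∃ U, IsComplComponent K U ∧ ∀ᶠ k in u, C k ⊆ U := by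
    intro K
    obtain ⟨v⟩ : Nonempty V := by
      obtain ⟨x⟩ := (inferInstance : Nonempty G.Space)
      rcases exists_pt x with ⟨v, -⟩ | ⟨e, -⟩
      exacts [⟨v⟩, ⟨G.src e⟩]
    obtain ⟨e₀, -⟩ := hG' v
    obtain ⟨A, hA, hKA⟩ := exists_finite_carrier hG hG' K.isCompact
    have hA' : (insert e₀ A).Finite := hA.insert e₀
    have hK' : (K : Set G.Space) ⊆ G.carrier (insert e₀ A) :=
      hKA.trans (carrier_mono (subset_insert _ _))
    have hfin := finite_components hG (insert_nonempty e₀ A) hA'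
    have hev : ∀ᶠ k in u, ∃ U ∈ {U | ∃ x ∉ G.carrier (insert e₀ A),
        U = connectedComponentIn (G.carrier (insert e₀ A))ᶜ x}, C k ⊆ U := by
      filter_upwards [hu (hlim ⟨_, isCompact_carrier hA'⟩)] with k hk
      obtain ⟨x, hx⟩ := (hC k).nonempty
      exact ⟨_, ⟨x, hk hx, rfl⟩, (hC k).isPreconnected.subset_connectedComponentIn hx hk⟩
    obtain ⟨U, ⟨x, hx, rfl⟩, hU⟩ := (Ultrafilter.eventually_exists_mem_iff hfin).1 hev
    refine ⟨connectedComponentIn (K : Set G.Space)ᶜ x, ⟨x, fun h => hx (hK' h), rfl⟩, ?_⟩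
    filter_upwards [hU] with k hk
    exact hk.trans (connectedComponentIn_mono x (compl_subset_compl.2 hK'))
  choose U hU hUC using key
  refine ⟨⟨U, hU, fun K L hKL => ?_⟩, fun K => (hUC K).frequently.filter_mono hu⟩
  obtain ⟨k, hk, hk'⟩ := ((hUC K).and (hUC L)).exists
  obtain ⟨y, hy⟩ := (hC k).nonempty
  obtain ⟨x, -, hx⟩ := hU K
  obtain ⟨x', -, hx'⟩ := hU L
  have h1 : U K = connectedComponentIn (K : Set G.Space)ᶜ y := by
    rw [hx]
    exact connectedComponentIn_eq (hx ▸ hk hy)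
  have h2 : U L = connectedComponentIn (L : Set G.Space)ᶜ y := by
    rw [hx']
    exact connectedComponentIn_eq (hx' ▸ hk' hy)
  rw [h1, h2]
  exact connectedComponentIn_mono y (compl_subset_compl.2 hKL)

/-! ### A sequence of circuits that converges to an end -/

theorem exists_circuits (hG : G.LocallyFinite) {x₀ : G.Space} (h : genus x₀ = ⊤) :
    ∃ (b : ℕ → E) (d : ∀ k, Path (G.vertexPt (G.src (b k))) (G.vertexPt (G.tgt (b k))))
      (ε : Ends G.Space), Function.Injective b ∧ (∀ k, EdgeGen (range b)ᶜ (arrow (d k))) ∧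
      x₀ ∈ G.carrier (range b)ᶜ ∧ ∀ K : Compacts G.Space, ∀ᶠ k in Filter.atTop,
        range ((G.edgePath (b k)).trans (d k).symm) ⊆ ε.1 K := by
  have hG' := noIsolated_of_genus h
  obtain ⟨e₀, -, t₀, ht₀⟩ := hG'.carrier_univ x₀
  choose b hbA S hS hSA κ hκ using fun A : {A : Set E // A.Finite} => exists_detour h A.2
  -- Each stage absorbs the touching edges, so the stages exhaust the graph, and also the edge and
  -- detour found outside them, so all circuits use distinct edges. Starting from `e₀` keeps the
  -- edge under the base point out of the sequence `b`.
  let A : ℕ → {A : Set E // A.Finite} := fun n => Nat.rec ⟨{e₀}, finite_singleton e₀⟩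
    (fun _ A => ⟨G.touching A.1 ∪ insert (b ⟨_, hG.finite_touching A.2⟩)
      (S ⟨_, hG.finite_touching A.2⟩), (hG.finite_touching A.2).union ((hS _).insert _)⟩) n
  let A' : ℕ → {A : Set E // A.Finite} := fun n => ⟨_, hG.finite_touching (A n).2⟩
  have hA : ∀ n, (A (n + 1)).1 = (A' n).1 ∪ insert (b (A' n)) (S (A' n)) := fun n => rfl
  have hAA' : ∀ n, (A' n).1 ⊆ (A (n + 1)).1 := fun n => hA n ▸ subset_union_left
  have hmono : Monotone fun n => (A n).1 :=
    monotone_nat_of_le_succ fun n => (subset_touching _).trans (hAA' n)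
  have hex := mem_of_exhaustion (G := G) (A := fun n => (A n).1) ⟨e₀, mem_singleton e₀⟩ hAA'
  have hT : ∀ n, insert (b (A' n)) (S (A' n)) ⊆ (A (n + 1)).1 := fun n => hA n ▸ subset_union_right
  have hTd : ∀ n, insert (b (A' n)) (S (A' n)) ⊆ (A' n).1ᶜ := fun n => insert_subset (hbA _)
    fun e he he' => disjoint_left.1 (hSA _) he (mem_insert_of_mem _ he')
  have hne : ∀ m n, m < n → ∀ e ∈ insert (b (A' m)) (S (A' m)),
      ∀ e' ∈ insert (b (A' n)) (S (A' n)), e ≠ e' := by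
    rintro m n hmn e he e' he' rfl
    exact hTd n he' (subset_touching _ (hmono (Nat.succ_le_of_lt hmn) (hT m he)))
  choose d hdκ hd using fun n => (hκ (A' n)).exists_path
  have hrange : ∀ n, range ((G.edgePath (b (A' n))).trans (d n).symm) ⊆
      G.carrier (insert (b (A' n)) (S (A' n))) := by
    intro n
    rw [Path.trans_range, Path.symm_range]
    refine union_subset ?_ ((hd n).trans (insert_subset (src_mem_carrier (mem_insert _ _))
      (carrier_mono (subset_insert _ _))))
    rintro _ ⟨t, rfl⟩
    exact edgePt_mem_carrier (mem_insert _ _) t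
  have hlim : ∀ K : Compacts G.Space, ∃ i, (K : Set G.Space) ⊆ G.carrier (A i).1 := by
    intro K
    obtain ⟨T, hT, hKT⟩ := exists_finite_carrier hG hG' K.isCompact
    obtain ⟨i, hi⟩ := exists_subset_of_exhaustion hmono hex hT
    exact ⟨i, hKT.trans (carrier_mono hi)⟩
  obtain ⟨ε, hε⟩ := exists_end hG hG' (fun n => range ((G.edgePath (b (A' n))).trans (d n).symm))
    (fun n => isConnected_range (Path.continuous _)) fun K => by
      obtain ⟨i, hi⟩ := hlim K
      filter_upwards [Filter.eventually_ge_atTop i] with n hn x hx hxK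
      refine disjoint_left.1 (disjoint_carrier_compl_touching _)
        (carrier_mono (hmono hn) (hi hxK)) (carrier_mono (hTd n) (hrange n hx))
  -- Accumulation at `ε` becomes convergence on a subsequence, as the stages are cofinal among
  -- compact sets.
  obtain ⟨φ, hφ, hφε⟩ := Filter.extraction_forall_of_frequently
    fun i => hε ⟨_, isCompact_carrier (A i).2⟩
  refine ⟨fun k => b (A' (φ k)), fun k => d (φ k), ε, ?_, fun k => ?_, ?_, fun K => ?_⟩
  · refine fun m n hmn => hφ.injective ?_
    by_contra hne'
    rcases lt_or_gt_of_ne hne' with hlt | hlt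
    · exact hne _ _ hlt _ (mem_insert _ _) _ (mem_insert _ _) hmn
    · exact hne _ _ hlt _ (mem_insert _ _) _ (mem_insert _ _) hmn.symm
  · rw [hdκ]
    refine (hκ _).mono ?_
    rintro e he ⟨n, rfl⟩
    rcases lt_trichotomy (φ k) (φ n) with hlt | heq | hlt
    · exact hne _ _ hlt _ (mem_insert_of_mem _ he) _ (mem_insert _ _) rfl
    · refine disjoint_left.1 (hSA _) he (heq ▸ mem_insert _ _)
    · exact hne _ _ hlt _ (mem_insert _ _) _ (mem_insert_of_mem _ he) rfl
  · rw [ht₀]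
    refine edgePt_mem_carrier ?_ t₀
    rintro ⟨n, hn⟩
    replace hn : b (A' (φ n)) = e₀ := hn
    exact hbA (A' (φ n)) (hn ▸ subset_touching _ (hmono (Nat.zero_le _) (mem_singleton e₀)))
  · obtain ⟨i, hi⟩ := hlim K
    filter_upwards [Filter.eventually_ge_atTop i] with n hn
    exact (hφε n).trans (ε.2.2 K _ (hi.trans (carrier_mono (hmono hn))))

end TopGraph

/-! ### Maps that are the identity outside a compact set -/

namespace ProperMaps

open CategoryTheory

section

variable {X Y : Type*} [TopologicalSpace X] [TopologicalSpace Y] [T2Space X]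
  [WeaklyLocallyCompactSpace X]

/-- The preimage of `C` lies in the preimage of `K ∪ C` under the proper map `π`. With `π` the
projection of the cylinder this also covers homotopies. -/
theorem isProperMap_of_eq {F π : Y → X} (hF : Continuous F) (hπ : IsProperMap π) {K : Set X}
    (hK : IsCompact K) (h : ∀ y, π y ∉ K → F y = π y) : IsProperMap F := by
  refine isProperMap_iff_isCompact_preimage.2 ⟨hF, fun C hC => ?_⟩
  refine (hπ.isCompact_preimage (hK.union hC)).of_isClosed_subset (hC.isClosed.preimage hF)
    fun y hy => ?_
  by_cases hyK : π y ∈ K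
  · exact .inl hyK
  · exact .inr (h y hyK ▸ hy)

theorem areProperInverse_of_eq {f g : C(X, X)} {K : Set X} (hK : IsCompact K)
    (hf : ∀ x ∉ K, f x = x) (hg : ∀ x ∉ K, g x = x)
    (H : ∃ H : ContinuousMap.Homotopy (f.comp g) (ContinuousMap.id X), ∀ t, ∀ x ∉ K, H (t, x) = x)
    (H' : ∃ H : ContinuousMap.Homotopy (g.comp f) (ContinuousMap.id X), ∀ t, ∀ x ∉ K,
      H (t, x) = x) : AreProperInverse f g := by
  obtain ⟨H, hH⟩ := H
  obtain ⟨H', hH'⟩ := H'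
  exact ⟨isProperMap_of_eq f.continuous isProperMap_id hK hf,
    isProperMap_of_eq g.continuous isProperMap_id hK hg,
    ⟨H, isProperMap_of_eq H.continuous isProperMap_snd_of_compactSpace hK fun p => hH p.1 p.2⟩,
    ⟨H', isProperMap_of_eq H'.continuous isProperMap_snd_of_compactSpace hK
      fun p => hH' p.1 p.2⟩⟩

end

section

variable {X : Type*} [TopologicalSpace X] {x₀ : X}

/-- Properness is dropped because a twist along infinitely many edges need not be proper, yet still
induces an automorphism. -/
theorem inducedHom_bijective_of_homotopy [PathConnectedSpace X] {f g : C(X, X)}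
    (H : ContinuousMap.Homotopy (f.comp g) (ContinuousMap.id X))
    (K : ContinuousMap.Homotopy (g.comp f) (ContinuousMap.id X)) (p : Path (f x₀) x₀) :
    Function.Bijective (inducedHom f p) := by
  let q : Path (g x₀) x₀ := PathConnectedSpace.somePath _ _
  obtain ⟨c, hc⟩ := inducedHom_comp_conj p q H
  obtain ⟨d, hd⟩ := inducedHom_comp_conj q p K
  constructor
  · intro a b hab
    have h := hd a
    rw [hab, hd b] at h
    exact (mul_left_cancel (mul_right_cancel h)).symm
  · intro b
    refine ⟨inducedHom g q (c⁻¹ * b * c), ?_⟩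
    rw [hc]
    group

theorem inducedHom_of_fixed {f : C(X, X)} (h : f x₀ = x₀) (p : Path x₀ x₀) :
    inducedHom f ((Path.refl x₀).cast h rfl) (arrow p) =
      arrow ((p.map f.continuous).cast h.symm h.symm) := by
  rw [inducedHom_eq]
  have key : ∀ {y : X} (h : y = x₀) (q : Path y y),
      inv (arrow ((Path.refl x₀).cast h rfl)) ≫ arrow q ≫ arrow ((Path.refl x₀).cast h rfl) =
        arrow (q.cast h.symm h.symm) := by
    rintro _ rfl q
    change inv (arrow (Path.refl _)) ≫ arrow q ≫ arrow (Path.refl _) = arrow q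
    rw [arrow_refl, IsIso.inv_id, Category.id_comp, Category.comp_id]
  exact key h (p.map f.continuous)

theorem inducedHom_congr {f g : C(X, X)} (hf : f x₀ = x₀) (hg : g x₀ = x₀) (p : Path x₀ x₀)
    (h : ∀ t, f (p t) = g (p t)) :
    inducedHom f ((Path.refl x₀).cast hf rfl) (arrow p) =
      inducedHom g ((Path.refl x₀).cast hg rfl) (arrow p) := by
  rw [inducedHom_of_fixed, inducedHom_of_fixed]
  congr 1
  exact Path.ext (funext h)

end

end ProperMaps

namespace TopGraph

open CategoryTheory ProperMaps

variable {V E : Type*} {G : TopGraph V E}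

/-! ### Twists -/

open Classical in
/-- The path along the edge `e`, followed by the loop `ℓ e` if `e` belongs to `J`. -/
noncomputable def twistPath (J : Set E)
    (ℓ : ∀ e, Path (G.vertexPt (G.tgt e)) (G.vertexPt (G.tgt e))) (e : E) :
    Path (G.vertexPt (G.src e)) (G.vertexPt (G.tgt e)) :=
  if e ∈ J then (G.edgePath e).trans (ℓ e) else G.edgePath e

/-- The map that appends the loop `ℓ e` to each edge `e` in `J`. -/
noncomputable def twist (J : Set E)
    (ℓ : ∀ e, Path (G.vertexPt (G.tgt e)) (G.vertexPt (G.tgt e))) : C(G.Space, G.Space) :=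
  mapOf G.vertexPt (twistPath J ℓ)

variable {J : Set E} {ℓ : ∀ e, Path (G.vertexPt (G.tgt e)) (G.vertexPt (G.tgt e))}

theorem twistPath_of_mem {e : E} (he : e ∈ J) :
    twistPath J ℓ e = (G.edgePath e).trans (ℓ e) := if_pos he

theorem twistPath_of_notMem {e : E} (he : e ∉ J) : twistPath J ℓ e = G.edgePath e := if_neg he

theorem twist_edgePt (e : E) (t : I) : twist J ℓ (G.edgePt e t) = twistPath J ℓ e t := rfl

theorem twist_eq_of_notMem {e : E} (he : e ∉ J) (t : I) :
    twist J ℓ (G.edgePt e t) = G.edgePt e t := by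
  rw [twist_edgePt, twistPath_of_notMem he]
  rfl

theorem twist_eq {x : G.Space} (hx : x ∈ range G.vertexPt ∪ G.carrier Jᶜ) :
    twist J ℓ x = x := by
  rcases hx with ⟨v, rfl⟩ | ⟨e, he, t, rfl⟩
  · rfl
  · exact twist_eq_of_notMem he t

theorem mem_of_notMem_carrier {x : G.Space} (hx : x ∉ G.carrier J) :
    x ∈ range G.vertexPt ∪ G.carrier Jᶜ := by
  rcases exists_pt x with ⟨v, rfl⟩ | ⟨e, t, -, -, rfl⟩
  · exact .inl ⟨v, rfl⟩
  · exact .inr (edgePt_mem_carrier (mem_compl fun he => hx (edgePt_mem_carrier he t)) t)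

theorem twist_congr {J' : Set E} {e : E} (h : e ∈ J ↔ e ∈ J') (t : I) :
    twist J ℓ (G.edgePt e t) = twist J' ℓ (G.edgePt e t) := by
  rw [twist_edgePt, twist_edgePt]
  by_cases he : e ∈ J
  · rw [twistPath_of_mem he, twistPath_of_mem (h.1 he)]
  · rw [twistPath_of_notMem he, twistPath_of_notMem fun h' => he (h.2 h')]

/-- The loops run through vertices and untwisted edges, so the twist fixes them; the composite sends
a twisted edge to the edge followed by its loop and the reversed loop, which cancel. On other edges
the homotopy is constant. -/
theorem exists_twist_homotopy
    (hℓ : ∀ e ∈ J, ∀ t, ℓ e t ∈ range G.vertexPt ∪ G.carrier Jᶜ) :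
    ∃ H : ContinuousMap.Homotopy ((twist J ℓ).comp (twist J fun e => (ℓ e).symm))
      (ContinuousMap.id G.Space), ∀ t, ∀ x ∉ G.carrier J, H (t, x) = x := by
  have key : ∀ e, ∃ Q : Path (G.vertexPt (G.src e)) (G.vertexPt (G.tgt e)),
      (∀ s, Q s = twist J ℓ (twistPath J (fun e => (ℓ e).symm) e s)) ∧
      ∃ H : Q.Homotopy (G.edgePath e), e ∉ J → ∀ t s, H (t, s) = G.edgePt e s := by
    intro e
    by_cases he : e ∈ J
    · refine ⟨((G.edgePath e).trans (ℓ e)).trans (ℓ e).symm, fun s => ?_, ?_⟩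
      · rw [twistPath_of_mem he, Path.trans_apply, Path.trans_apply]
        split_ifs with hs
        · exact (congrArg (fun p : Path _ _ => p _) (twistPath_of_mem (ℓ := ℓ) he)).symm
        · exact (twist_eq (hℓ e he _)).symm
      · have h : arrow (((G.edgePath e).trans (ℓ e)).trans (ℓ e).symm) = arrow (G.edgePath e) := by
          rw [arrow_trans, arrow_trans, arrow_symm, Category.assoc, IsIso.hom_inv_id,
            Category.comp_id]
        exact ⟨(arrow_eq_iff.1 h).some, fun h => (h he).elim⟩
    · refine ⟨G.edgePath e, fun s => ?_, Path.Homotopy.refl _, fun _ t s => rfl⟩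
      rw [twistPath_of_notMem he]
      exact (twist_eq_of_notMem he s).symm
  choose Q hQ H hH using key
  refine ⟨homotopyOfSquares (fun v => Path.refl (G.vertexPt v))
    (fun e => (H e).toHomotopy.toContinuousMap)
    (fun e s => ((H e).map_zero_left s).trans (hQ e s))
    (fun e s => (H e).map_one_left s) (fun e t => (H e).source t) (fun e t => (H e).target t),
    fun t x hx => ?_⟩
  rcases mem_of_notMem_carrier hx with ⟨v, rfl⟩ | ⟨e, he, s, rfl⟩
  · rfl
  · exact hH e he t s

theorem exists_twist_homotopy'
    (hℓ : ∀ e ∈ J, ∀ t, ℓ e t ∈ range G.vertexPt ∪ G.carrier Jᶜ) :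
    ∃ H : ContinuousMap.Homotopy ((twist J fun e => (ℓ e).symm).comp (twist J ℓ))
      (ContinuousMap.id G.Space), ∀ t, ∀ x ∉ G.carrier J, H (t, x) = x := by
  have := exists_twist_homotopy (J := J) (ℓ := fun e => (ℓ e).symm) fun e he t => hℓ e he _
  have hs : (fun e => (ℓ e).symm.symm) = ℓ := funext fun e => Path.symm_symm _
  rwa [hs] at this

theorem isProperHomotopyEquiv_twist (hG : G.LocallyFinite) (hG' : G.NoIsolated) (hJ : J.Finite)
    (hℓ : ∀ e ∈ J, ∀ t, ℓ e t ∈ range G.vertexPt ∪ G.carrier Jᶜ) :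
    IsProperHomotopyEquiv (twist J ℓ) := by
  have := weaklyLocallyCompactSpace hG hG'
  exact ⟨_, areProperInverse_of_eq (isCompact_carrier hJ)
    (fun x hx => twist_eq (mem_of_notMem_carrier hx))
    (fun x hx => twist_eq (mem_of_notMem_carrier hx)) (exists_twist_homotopy hℓ)
    (exists_twist_homotopy' hℓ)⟩

/-! ### The number of times that a path crosses an edge -/

open Classical in
/-- The exponent sum of a generator. -/
noncomputable def count (e : E) : FreeGroup E →* Multiplicative ℤ :=
  FreeGroup.lift fun e' => if e' = e then .ofAdd 1 else 1

theorem count_of_self (e : E) : count e (FreeGroup.of e) = .ofAdd 1 :=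
  FreeGroup.lift_apply_of.trans (if_pos rfl)

theorem count_of_ne {e e' : E} (h : e' ≠ e) : count e (FreeGroup.of e') = 1 :=
  FreeGroup.lift_apply_of.trans (if_neg h)

theorem count_eq_one {e : E} {S : Set E} (he : e ∉ S) {g : FreeGroup E}
    (hg : g ∈ Subgroup.closure (FreeGroup.of '' S)) : count e g = 1 := by
  have : Subgroup.closure (FreeGroup.of '' S) ≤ (count e).ker := by
    rw [Subgroup.closure_le]
    rintro _ ⟨e', he', rfl⟩
    exact count_of_ne fun h => he (h ▸ he')
  exact this hg

/-- The algebraic number of times that a class of paths crosses the edge `e`. -/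
noncomputable def crossing (e : E) {x y : G.Space}
    (κ : FundamentalGroupoid.mk x ⟶ FundamentalGroupoid.mk y) : Multiplicative ℤ :=
  count e (hol κ)

theorem crossing_comp (e : E) {x y z : G.Space}
    (κ : FundamentalGroupoid.mk x ⟶ FundamentalGroupoid.mk y)
    (κ' : FundamentalGroupoid.mk y ⟶ FundamentalGroupoid.mk z) :
    crossing e (κ ≫ κ') = crossing e κ * crossing e κ' := by
  rw [crossing, hol_comp, map_mul]
  rfl

theorem crossing_inv (e : E) {x y : G.Space}
    (κ : FundamentalGroupoid.mk x ⟶ FundamentalGroupoid.mk y) :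
    crossing e (inv κ) = (crossing e κ)⁻¹ := by
  rw [crossing, hol_inv, map_inv]
  rfl

theorem EdgeGen.crossing_eq_one {e : E} {S : Set E} (he : e ∉ S) {x y : G.Space}
    {κ : FundamentalGroupoid.mk x ⟶ FundamentalGroupoid.mk y} (h : EdgeGen S κ) :
    crossing e κ = 1 := count_eq_one he h.hol_mem

theorem hol_edgePath (e : E) : hol (arrow (G.edgePath e)) = FreeGroup.of e := by
  have := hol_seg (G := G) e 0 1
  rw [jump_zero, jump_one, inv_one, one_mul] at this
  rw [← this]
  exact hol_congr fun t => by
    simp [segment]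
    rfl

theorem crossing_edgePath_self (e : E) : crossing e (arrow (G.edgePath e)) = .ofAdd 1 := by
  rw [crossing, hol_edgePath, count_of_self]

theorem crossing_edgePath {e e' : E} (h : e' ≠ e) : crossing e (arrow (G.edgePath e')) = 1 := by
  rw [crossing, hol_edgePath, count_of_ne h]

/-- The crossing number as a homomorphism on the fundamental group. -/
noncomputable def crossingHom (e : E) (x₀ : G.Space) :
    FundamentalGroup G.Space x₀ →* Multiplicative ℤ where
  toFun γ := crossing e (x := x₀) (y := x₀) γ
  map_one' := by
    change count e (hol (𝟙 _)) = 1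
    rw [hol_id, map_one]
  map_mul' a b := (crossing_comp e (x := x₀) (y := x₀) (z := x₀) b a).trans (mul_comm _ _)

/-- Base paths and the connecting path contribute mutually inverse terms to an abelian invariant. -/
theorem crossingHom_inducedHom [PathConnectedSpace G.Space] (e : E) {x₀ y : G.Space}
    (f : C(G.Space, G.Space))
    (p : Path (f x₀) x₀) (β : FundamentalGroupoid.mk x₀ ⟶ FundamentalGroupoid.mk y)
    (κ : FundamentalGroupoid.mk y ⟶ FundamentalGroupoid.mk y) :
    crossingHom e x₀ (inducedHom f p (β ≫ κ ≫ inv β : FundamentalGroupoid.mk x₀ ⟶ _)) =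
      crossing e (mapArrow f κ) := by
  change crossing e (inducedHom f p _) = _
  rw [inducedHom_eq, crossing_comp, crossing_comp, crossing_inv, inv_mul_cancel_comm_assoc,
    mapArrow_comp, mapArrow_comp, mapArrow_inv, crossing_comp, crossing_comp, crossing_inv,
    mul_inv_cancel_comm_assoc]

/-- Automorphisms in one outer class differ by an inner one, which is invisible in an abelian
quotient. -/
theorem crossingHom_eq_of_mk_eq (e : E) {x₀ : G.Space}
    {φ ψ : MulAut (FundamentalGroup G.Space x₀)} (h : Out.mk φ = Out.mk ψ)
    (γ : FundamentalGroup G.Space x₀) : crossingHom e x₀ (φ γ) = crossingHom e x₀ (ψ γ) := by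
  obtain ⟨c, hc⟩ := QuotientGroup.eq.1 h
  have : ψ = φ * MulAut.conj c := by rw [hc]; group
  rw [this, MulAut.mul_apply, MulAut.conj_apply, map_mul, map_mul, map_inv, map_mul, map_mul,
    map_inv, mul_inv_cancel_comm]

/-- The edge `b` acquires one crossing of `b₀` from its loop, while the detour avoids both `b₀` and
the twisted edges and so contributes nothing. -/
theorem crossing_twist (hG : G.NoIsolated) {b b₀ : E} (hb : b ∈ J) (hne : b ≠ b₀)
    (hℓ : crossing b₀ (arrow (ℓ b)) = .ofAdd 1) {S : Set E} (hS : Disjoint S J) (hb₀ : b₀ ∉ S)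
    {d : Path (G.vertexPt (G.src b)) (G.vertexPt (G.tgt b))} (hd : EdgeGen S (arrow d)) :
    crossing b₀ (mapArrow (twist J ℓ) (arrow ((G.edgePath b).trans d.symm))) = .ofAdd 1 := by
  have h1 : crossing b₀ (mapArrow (twist J ℓ) (arrow (G.edgePath b))) = .ofAdd 1 := by
    have : hol (mapArrow (twist J ℓ) (arrow (G.edgePath b))) =
        hol (arrow ((G.edgePath b).trans (ℓ b))) := by
      rw [← twistPath_of_mem hb]
      exact hol_congr (p := (G.edgePath b).map (twist J ℓ).continuous) fun t => rfl
    rw [crossing, this, ← crossing, arrow_trans, crossing_comp, crossing_edgePath hne, hℓ, one_mul]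
  have h2 : crossing b₀ (mapArrow (twist J ℓ) (arrow d)) = 1 := by
    have h := (hG.edgeGen (arrow d)).hol_mapArrow (twist J ℓ)
    rw [turn_vertexPt, turn_vertexPt, one_mul, inv_one, mul_one] at h
    have hfix : edgeHom (twist J ℓ) (hol (arrow d)) = hol (arrow d) := by
      have : Subgroup.closure (FreeGroup.of '' S) ≤
          (edgeHom (twist J ℓ)).eqLocus (MonoidHom.id (FreeGroup E)) := by
        rw [Subgroup.closure_le]
        rintro _ ⟨e, he, rfl⟩
        exact edgeHom_of fun t => twist_eq_of_notMem (disjoint_left.1 hS he) t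
      exact this hd.hol_mem
    rw [crossing, h, hfix]
    exact hd.crossing_eq_one hb₀
  rw [arrow_trans, arrow_symm, mapArrow_comp, mapArrow_inv, crossing_comp, crossing_inv, h1, h2,
    inv_one, mul_one]

end TopGraph

/-! ### Twists along circuits that converge to an end; the image is not closed -/

namespace TopGraph

open CategoryTheory ProperMaps
open TopologicalSpace (Compacts)

variable {V E : Type*} {G : TopGraph V E}

/-- A sequence of edges `b k` with detours `d k` whose circuits converge to an end, and loops `ℓ e`
that cross `b 0` once and avoid the other members of the sequence. -/
structure TwistData (G : TopGraph V E) (x₀ : G.Space) where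
  b : ℕ → E
  d : ∀ k, Path (G.vertexPt (G.src (b k))) (G.vertexPt (G.tgt (b k)))
  ε : Ends G.Space
  ℓ : ∀ e, Path (G.vertexPt (G.tgt e)) (G.vertexPt (G.tgt e))
  injective : Function.Injective b
  detour : ∀ k, EdgeGen (range b)ᶜ (arrow (d k))
  base_mem : x₀ ∈ G.carrier (range b)ᶜ
  limit : ∀ K : Compacts G.Space, ∀ᶠ k in Filter.atTop,
    range ((G.edgePath (b k)).trans (d k).symm) ⊆ ε.1 K
  loop_mem : ∀ e t, ℓ e t ∈ insert (G.vertexPt (G.tgt e)) (G.carrier (insert (b 0) (range b)ᶜ))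
  crossing_loop : ∀ e, crossing (b 0) (arrow (ℓ e)) = .ofAdd 1

theorem nonempty_twistData [ConnectedSpace G.Space] (hG : G.LocallyFinite) {x₀ : G.Space}
    (h : genus x₀ = ⊤) : Nonempty (TwistData G x₀) := by
  obtain ⟨b, d, ε, hinj, hd, hbase, hlim⟩ := exists_circuits hG h
  have hb0 : b 0 ∉ (range b)ᶜ := fun h => h ⟨0, rfl⟩
  have key : ∀ e, ∃ ℓ : Path (G.vertexPt (G.tgt e)) (G.vertexPt (G.tgt e)),
      (∀ t, ℓ t ∈ insert (G.vertexPt (G.tgt e)) (G.carrier (insert (b 0) (range b)ᶜ))) ∧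
        crossing (b 0) (arrow ℓ) = .ofAdd 1 := by
    intro e
    -- The loop goes to the circuit of `b 0` without using any `b k`, runs around it once, and
    -- returns the same way.
    obtain ⟨ρ, hρ⟩ := exists_edgeGen_of_detours (G := G) (B := range b)
      (by rintro _ ⟨k, rfl⟩; exact ⟨_, hd k⟩) (G.tgt e) (G.src (b 0))
    have hc : EdgeGen (insert (b 0) (range b)ᶜ) (arrow (G.edgePath (b 0))) :=
      edgeGen_of_range_subset _
        (by rintro _ ⟨t, rfl⟩; exact edgePt_mem_carrier (mem_insert _ _) t)
    have hsub : (range b)ᶜ ⊆ insert (b 0) (range b)ᶜ := subset_insert _ _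
    obtain ⟨ℓ, hℓ, hr⟩ := ((hρ.mono hsub).comp
      ((hc.comp ((hd 0).inv.mono hsub)).comp (hρ.inv.mono hsub))).exists_path
    refine ⟨ℓ, fun t => hr ⟨t, rfl⟩, ?_⟩
    rw [hℓ, crossing_comp, crossing_comp, crossing_comp, crossing_edgePath_self,
      hρ.crossing_eq_one hb0, hρ.inv.crossing_eq_one hb0, (hd 0).inv.crossing_eq_one hb0,
      one_mul, mul_one, mul_one]
  choose ℓ hℓ hℓ' using key
  exact ⟨⟨b, d, ε, ℓ, hinj, hd, hbase, hlim, hℓ, hℓ'⟩⟩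

theorem crossing_eq_one_of_disjoint (hG : G.NoIsolated) {e : E} {x y : G.Space} (p : Path x y)
    (h : Disjoint (range p) (G.carrier {e})) : crossing e (arrow p) = 1 :=
  (edgeGen_of_range_subset (S := {e}ᶜ) p fun _ hx =>
    hG.mem_carrier_compl (disjoint_left.1 h hx)).crossing_eq_one (notMem_compl_iff.2 (mem_singleton e))

theorem _root_.ProperMaps.Ends.subset_compl {X : Type*} [TopologicalSpace X] (ε : Ends X)
    (K : Compacts X) : ε.1 K ⊆ (K : Set X)ᶜ := by
  obtain ⟨x, -, h⟩ := ε.2.1 K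
  rw [h]
  exact connectedComponentIn_subset _ _

namespace TwistData

variable {x₀ : G.Space} (D : TwistData G x₀)

/-- The circuit formed by `b k` and its detour. -/
noncomputable def circuit (k : ℕ) : Path (G.vertexPt (G.src (D.b k))) (G.vertexPt (G.src (D.b k))) :=
  (G.edgePath (D.b k)).trans (D.d k).symm

variable {J : Set E}

/-- Twisting only along indices `k > 0` matters: the loops use `b 0` but no other member of the
sequence, so they avoid all twisted edges. -/
theorem loop_mem' (hJ : J ⊆ D.b '' Ioi 0) (e : E) (t : I) :
    D.ℓ e t ∈ range G.vertexPt ∪ G.carrier Jᶜ := by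
  rcases D.loop_mem e t with h | h
  · exact .inl ⟨_, h.symm⟩
  · refine .inr (carrier_mono (insert_subset ?_ (compl_subset_compl.2 ?_)) h)
    · intro h
      obtain ⟨k, hk, hk'⟩ := hJ h
      exact (mem_Ioi.1 hk).ne' (D.injective hk')
    · exact hJ.trans (image_subset_range _ _)

theorem twist_base (hJ : J ⊆ D.b '' Ioi 0) : twist J D.ℓ x₀ = x₀ :=
  twist_eq (.inr (carrier_mono (compl_subset_compl.2 (hJ.trans (image_subset_range _ _)))
    D.base_mem))

/-- The obstruction to properness: the preimage of the edge `b 0` is compact, so the circuits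
eventually lie in a component of its complement. -/
theorem eventually_disjoint (hG : G.NoIsolated) {h : C(G.Space, G.Space)} (hh : IsProperMap h) :
    ∀ᶠ k in Filter.atTop, crossing (D.b 0) (mapArrow h (arrow (D.circuit k))) = 1 := by
  have hK : IsCompact (h ⁻¹' G.carrier {D.b 0}) :=
    hh.isCompact_preimage (isCompact_carrier (finite_singleton _))
  filter_upwards [D.limit ⟨_, hK⟩] with k hk
  refine crossing_eq_one_of_disjoint hG ((D.circuit k).map h.continuous) (disjoint_left.2 ?_)
  rintro _ ⟨t, rfl⟩ ht
  exact D.ε.subset_compl _ (hk ⟨t, rfl⟩) ht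

variable [ConnectedSpace G.Space]

/-- The automorphism induced by a twist. -/
noncomputable def aut (hJ : J ⊆ D.b '' Ioi 0) : MulAut (FundamentalGroup G.Space x₀) :=
  MulEquiv.ofBijective (inducedHom (twist J D.ℓ) ((Path.refl x₀).cast (D.twist_base hJ) rfl))
    (inducedHom_bijective_of_homotopy
      (exists_twist_homotopy fun e _ t => D.loop_mem' hJ e t).choose
      (exists_twist_homotopy' fun e _ t => D.loop_mem' hJ e t).choose _)

theorem aut_apply (hJ : J ⊆ D.b '' Ioi 0) (γ : FundamentalGroup G.Space x₀) : D.aut hJ γ =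
    inducedHom (twist J D.ℓ) ((Path.refl x₀).cast (D.twist_base hJ) rfl) γ := rfl

theorem aut_empty : D.aut (empty_subset _) = 1 := by
  ext γ
  have h : twist ∅ D.ℓ = ContinuousMap.id G.Space := by
    ext x
    exact twist_eq (mem_of_notMem_carrier fun ⟨e, he, _⟩ => he)
  obtain ⟨p, rfl⟩ := exists_arrow (x := x₀) (y := x₀) γ
  rw [aut_apply, inducedHom_of_fixed]
  refine congrArg arrow (Path.ext (funext fun t => ?_))
  exact congrArg (fun f : C(G.Space, G.Space) => f (p t)) h

/-- A loop class involves finitely many edges, and only the twists along these affect it. Hence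
twists depend continuously on `J`. -/
theorem exists_finite_aut_eq (hG : G.NoIsolated) (γ : FundamentalGroup G.Space x₀) :
    ∃ S : Set E, S.Finite ∧ ∀ J J' (hJ : J ⊆ D.b '' Ioi 0) (hJ' : J' ⊆ D.b '' Ioi 0),
      (∀ e ∈ S, e ∈ J ↔ e ∈ J') → D.aut hJ γ = D.aut hJ' γ := by
  obtain ⟨S, -, hS, hγ⟩ := (hG.edgeGen (x := x₀) (y := x₀) γ).exists_finite
  obtain ⟨p, rfl, hp⟩ := hγ.exists_path
  refine ⟨S, hS, fun J J' hJ hJ' h => inducedHom_congr _ _ p fun t => ?_⟩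
  rcases hp ⟨t, rfl⟩ with ht | ⟨e, he, s, ht⟩
  · rw [ht, D.twist_base hJ, D.twist_base hJ']
  · rw [ht, twist_congr (h e he)]

theorem exists_finite_aut_eq' (hG : G.NoIsolated) {T : Set (FundamentalGroup G.Space x₀)}
    (hT : T.Finite) : ∃ n, ∀ J J' (hJ : J ⊆ D.b '' Ioi 0) (hJ' : J' ⊆ D.b '' Ioi 0),
      (∀ k < n, D.b k ∈ J ↔ D.b k ∈ J') → ∀ γ ∈ T, D.aut hJ γ = D.aut hJ' γ := by
  choose S hS h using D.exists_finite_aut_eq hG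
  have hfin : (D.b ⁻¹' ⋃ γ ∈ T, S γ).Finite :=
    (hT.biUnion fun γ _ => hS γ).preimage D.injective.injOn
  obtain ⟨n, hn⟩ := hfin.bddAbove
  refine ⟨n + 1, fun J J' hJ hJ' hJJ γ hγ => h γ J J' hJ hJ' fun e he => ?_⟩
  by_cases hb : ∃ k, D.b k = e
  · obtain ⟨k, rfl⟩ := hb
    exact hJJ k (Nat.lt_succ_of_le (hn (mem_biUnion hγ he)))
  · exact iff_of_false (fun h => hb ((hJ.trans (image_subset_range _ _)) h))
      fun h => hb ((hJ'.trans (image_subset_range _ _)) h)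

/-- The element of the fundamental group represented by a circuit. -/
noncomputable def element (k : ℕ) : FundamentalGroup G.Space x₀ :=
  (arrow (PathConnectedSpace.somePath x₀ (G.vertexPt (G.src (D.b k)))) ≫ arrow (D.circuit k) ≫
    inv (arrow (PathConnectedSpace.somePath x₀ (G.vertexPt (G.src (D.b k))))) :
    FundamentalGroupoid.mk x₀ ⟶ _)

theorem crossingHom_element (f : C(G.Space, G.Space)) (p : Path (f x₀) x₀) (k : ℕ) :
    crossingHom (D.b 0) x₀ (inducedHom f p (D.element k)) =
      crossing (D.b 0) (mapArrow f (arrow (D.circuit k))) :=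
  crossingHom_inducedHom _ _ _ _ _

theorem crossingHom_aut (hG : G.NoIsolated) (hJ : J ⊆ D.b '' Ioi 0) {k : ℕ} (hk : D.b k ∈ J) :
    crossingHom (D.b 0) x₀ (D.aut hJ (D.element k)) = .ofAdd 1 := by
  rw [aut_apply, crossingHom_element]
  refine crossing_twist hG hk (fun h => ?_) (D.crossing_loop _) (S := (range D.b)ᶜ) ?_ ?_
    (D.detour k)
  · obtain ⟨j, hj, hj'⟩ := hJ (h ▸ hk)
    exact (mem_Ioi.1 hj).ne' (D.injective hj')
  · exact disjoint_left.2 fun e he heJ => he ((hJ.trans (image_subset_range _ _)) heJ)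
  · exact fun h => h ⟨0, rfl⟩

/-- The class of a twist along finitely many edges. -/
noncomputable def twistClass (hG : G.LocallyFinite) (hG' : G.NoIsolated) (hJ : J ⊆ D.b '' Ioi 0)
    (hfin : J.Finite) : Maps G.Space :=
  Maps.mk (twist J D.ℓ) (isProperHomotopyEquiv_twist hG hG' hfin fun e _ t => D.loop_mem' hJ e t)

theorem Psi_twistClass (hG : G.LocallyFinite) (hG' : G.NoIsolated) (hJ : J ⊆ D.b '' Ioi 0)
    (hfin : J.Finite) : Psi x₀ (D.twistClass hG hG' hJ hfin) = Out.mk (D.aut hJ) :=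
  Psi_mk x₀ _ _ ((Path.refl x₀).cast (D.twist_base hJ) rfl)

theorem not_isClosed_range (D : TwistData G x₀) (hG : G.LocallyFinite) (hG' : G.NoIsolated) :
    ¬ IsClosed ((Psi x₀).range : Set (Out (FundamentalGroup G.Space x₀))) := by
  intro hcl
  -- The twist along all `b k`, `k > 0`, has crossing number one on each such circuit, whereas a
  -- proper map has trivial crossing number on almost all circuits.
  have hmem : Out.mk (D.aut Subset.rfl) ∉ ((Psi x₀).range : Set (Out (FundamentalGroup G.Space x₀))) := by
    rintro ⟨m, hm⟩
    obtain ⟨⟨h, hh⟩, rfl⟩ := Quotient.exists_rep m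
    let p : Path (h x₀) x₀ := PathConnectedSpace.somePath _ _
    replace hm : Out.mk (inducedAut ⟨h, hh⟩ p) = Out.mk (D.aut Subset.rfl) :=
      (Psi_mk x₀ h hh p).symm.trans hm
    obtain ⟨k, hk, hk0⟩ := ((D.eventually_disjoint hG' hh.choose_spec.1).and
      (Filter.eventually_gt_atTop 0)).exists
    have h1 := crossingHom_eq_of_mk_eq (D.b 0) hm (D.element k)
    have h2 : crossingHom (D.b 0) x₀ (inducedHom h p (D.element k)) = .ofAdd 1 :=
      h1.trans (D.crossingHom_aut hG' Subset.rfl (mem_image_of_mem _ hk0))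
    rw [D.crossingHom_element, hk] at h2
    exact absurd (congrArg Multiplicative.toAdd h2) (by decide)
  -- A neighbourhood tests only finitely many loops, which do not distinguish the full twist from
  -- the one along the `b k` with `0 < k < n`; the latter is realized by a proper homotopy
  -- equivalence.
  obtain ⟨T, hT, hTU⟩ := exists_finite_of_isOpen (isOpen_coinduced.1 hcl.isOpen_compl) hmem
  obtain ⟨n, hn⟩ := D.exists_finite_aut_eq' hG' hT
  have hJ : D.b '' Ioo 0 n ⊆ D.b '' Ioi 0 := image_mono fun k hk => hk.1
  refine hTU (D.aut hJ) (hn _ _ _ _ fun k hk => ?_)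
    ⟨D.twistClass hG hG' hJ ((finite_Ioo 0 n).image _), D.Psi_twistClass ..⟩
  rw [D.injective.mem_set_image, D.injective.mem_set_image]
  exact ⟨fun h => h.1, fun h => ⟨h, hk⟩⟩

end TwistData

end TopGraph

/-! ### Compact sets in the end compactification -/

namespace ProperMaps

open TopologicalSpace (Compacts)

theorem isOpen_compl_image_pt {X : Type*} [TopologicalSpace X] [T2Space X]
    [LocallyPathConnectedSpace X] {K : Set X} (hK : IsCompact K) :
    IsOpen (EndCompactification.pt '' K)ᶜ := by
  refine isOpen_iff_forall_mem_open.2 ?_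
  rintro (x | ε) hx
  · refine ⟨_, fun y hy hy' => ?_, isOpen_image_pt hK.isClosed.isOpen_compl,
      mem_image_of_mem _ (fun h => hx (mem_image_of_mem _ h))⟩
    obtain ⟨z, hz, rfl⟩ := hy
    exact hz (pt_injective.mem_set_image.1 hy')
  · refine ⟨hatSet ⟨K, hK⟩ (ε.1 ⟨K, hK⟩), ?_, isOpen_hatSet (ε.2.1 _), .inr ⟨ε, rfl, rfl⟩⟩
    rintro _ (⟨z, hz, rfl⟩ | ⟨ε', -, rfl⟩) ⟨w, hw, hw'⟩
    · exact ε.subset_compl _ hz (pt_injective hw' ▸ hw)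
    · cases hw'

/-- An ultrafilter on the set either converges to `y` or omits a neighbourhood of `y`; in the second
case it lives on finitely many of the compact sets. -/
theorem isCompact_insert_iUnion {Y : Type*} [TopologicalSpace Y] {y : Y} {C : ℕ → Set Y}
    (hC : ∀ k, IsCompact (C k)) (h : Filter.Tendsto C Filter.atTop (𝓝 y).smallSets) :
    IsCompact (insert y (⋃ k, C k)) := by
  refine isCompact_iff_ultrafilter_le_nhds.2 fun f hf => ?_
  by_cases hy : (f : Filter Y) ≤ 𝓝 y
  · exact ⟨y, mem_insert _ _, hy⟩
  obtain ⟨W, hW, hWf⟩ := Filter.not_le.1 hy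
  obtain ⟨n, hn⟩ := Filter.eventually_atTop.1 (Filter.tendsto_smallSets_iff.1 h W hW)
  have hc : IsCompact (⋃ k ∈ Iio n, C k) := (finite_Iio n).isCompact_biUnion fun k _ => hC k
  have hmem : (⋃ k ∈ Iio n, C k) ∈ f := by
    filter_upwards [Filter.le_principal_iff.1 hf, Ultrafilter.compl_mem_iff_notMem.2 hWf]
      with z hz hzW
    rcases hz with rfl | hz
    · exact (hzW (mem_of_mem_nhds hW)).elim
    · obtain ⟨k, hk⟩ := mem_iUnion.1 hz
      refine mem_biUnion (show k ∈ Iio n from ?_) hk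
      by_contra hkn
      exact hzW (hn k (not_lt.1 hkn) hk)
  obtain ⟨a, ha, hfa⟩ := isCompact_iff_ultrafilter_le_nhds.1 hc f (Filter.le_principal_iff.2 hmem)
  refine ⟨a, .inr ?_, hfa⟩
  exact iUnion₂_subset (fun k _ => subset_iUnion C k) ha

end ProperMaps

/-! ### The homomorphism is not an embedding -/

namespace TopGraph.TwistData

open CategoryTheory ProperMaps
open TopologicalSpace (Compacts)

variable {V E : Type*} {G : TopGraph V E} {x₀ : G.Space} (D : TwistData G x₀)

/-- It suffices to check the generators of the topology, and among these only the sets `hatSet K (ε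
K)` contain the end `ε`. -/
theorem tendsto_circuit :
    Filter.Tendsto (fun k => EndCompactification.pt '' range (D.circuit k)) Filter.atTop
      (𝓝 (EndCompactification.ofEnd D.ε)).smallSets := by
  refine Filter.tendsto_smallSets_iff.2 fun W hW => ?_
  obtain ⟨U, hUW, hU, hmem⟩ := mem_nhds_iff.1 hW
  suffices ∀ᶠ k in Filter.atTop, EndCompactification.pt '' range (D.circuit k) ⊆ U from
    this.mono fun k hk => hk.trans hUW
  clear hUW hW
  induction hU with
  | basic S hS =>
    rcases hS with ⟨U, hU, rfl⟩ | ⟨K, U, hU, rfl⟩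
    · obtain ⟨x, -, hx⟩ := hmem
      cases hx
    · rcases hmem with ⟨x, -, hx⟩ | ⟨ε, hε, hx⟩
      · cases hx
      · cases hx
        filter_upwards [D.limit K] with k hk
        exact subset_union_of_subset_left (image_mono (hk.trans_eq hε)) _
  | univ => exact Filter.Eventually.of_forall fun k => subset_univ _
  | inter s t _ _ hs ht =>
    filter_upwards [hs hmem.1, ht hmem.2] with k h h' using subset_inter h h'
  | sUnion S _ h =>
    obtain ⟨s, hs, hmem⟩ := hmem
    filter_upwards [h s hs hmem] with k hk using hk.trans (subset_sUnion_of_mem hs)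

theorem crossing_circuit {k : ℕ} (hk : 0 < k) :
    crossing (D.b 0) (arrow (D.circuit k)) = 1 := by
  rw [circuit, arrow_trans, arrow_symm, crossing_comp, crossing_inv,
    crossing_edgePath (fun h => hk.ne' (D.injective h)),
    (D.detour k).crossing_eq_one (notMem_compl_iff.2 (mem_range_self 0)), inv_one, one_mul]

/-- If the end went to a point of `X`, far circuits would map into a compact neighbourhood of it,
although properness keeps them out of its preimage. -/
theorem map_end_ne (hG : G.LocallyFinite) (hG' : G.NoIsolated) (p : PH G.Space) (y : G.Space) :
    p.1.1 (.ofEnd D.ε) ≠ .pt y := by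
  intro h
  have := weaklyLocallyCompactSpace hG hG'
  obtain ⟨N, hN, hNy⟩ := exists_compact_mem_nhds y
  have hN' : EndCompactification.pt '' N ∈ 𝓝 (p.1.1 (.ofEnd D.ε)) := by
    rw [h]
    exact Filter.mem_of_superset ((isOpen_image_pt isOpen_interior).mem_nhds
      (mem_image_of_mem _ (mem_interior_iff_mem_nhds.2 hNy))) (image_mono interior_subset)
  have hK : IsCompact (p.restrict ⁻¹' N) :=
    p.isProperHomotopyEquiv_restrict.choose_spec.1.isCompact_preimage hN
  obtain ⟨k, hk, hk'⟩ := ((Filter.tendsto_smallSets_iff.1 D.tendsto_circuit _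
    (p.1.1.continuous.continuousAt hN')).and (D.limit ⟨_, hK⟩)).exists
  have h0 : D.circuit k 0 ∈ range (D.circuit k) := mem_range_self 0
  have h1 : p.1.1 (.pt (D.circuit k 0)) ∈ EndCompactification.pt '' N :=
    hk (mem_image_of_mem _ h0)
  rw [p.restrict_spec, pt_injective.mem_set_image] at h1
  exact D.ε.subset_compl _ (hk' h0) h1

/-- Infinitely many conditions define an open set: finitely many are locally constant by
`nearbyAgree`, and the tail together with its limit end is a compact set that nearby maps keep off
the edge `b 0`. -/
theorem isOpen_crossing (hG : G.LocallyFinite) (hG' : G.NoIsolated) : IsOpen {p : PH G.Space |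
    ∀ k > 0, crossing (D.b 0) (mapArrow p.restrict (arrow (D.circuit k))) = 1} := by
  refine isOpen_iff_mem_nhds.2 fun p hp => ?_
  have hK : IsCompact (G.carrier {D.b 0}) := isCompact_carrier (finite_singleton _)
  have hopen := isOpen_compl_image_pt hK
  have hend : p.1.1 (.ofEnd D.ε) ∈ (EndCompactification.pt '' G.carrier {D.b 0})ᶜ := by
    rintro ⟨y, -, hy⟩
    exact D.map_end_ne hG hG' p y hy.symm
  obtain ⟨N, hN⟩ := Filter.eventually_atTop.1 (Filter.tendsto_smallSets_iff.1 D.tendsto_circuit _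
    (p.1.1.continuous.continuousAt (hopen.mem_nhds hend)))
  have hQ := isCompact_insert_iUnion
    (C := fun k => EndCompactification.pt '' range (D.circuit (k + N)))
    (fun k => (isCompact_range (D.circuit (k + N)).continuous).image continuous_pt)
    (D.tendsto_circuit.comp (Filter.tendsto_add_atTop_nat N))
  have hmaps : MapsTo p.1.1 (insert (.ofEnd D.ε)
      (⋃ k, EndCompactification.pt '' range (D.circuit (k + N))))
      (EndCompactification.pt '' G.carrier {D.b 0})ᶜ := by
    rintro x (rfl | hx)
    · exact hend
    · obtain ⟨k, hk⟩ := mem_iUnion.1 hx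
      exact hN (k + N) (Nat.le_add_left _ _) hk
  have hev1 : ∀ᶠ q : PH G.Space in 𝓝 p, MapsTo q.1.1 (insert (.ofEnd D.ε)
      (⋃ k, EndCompactification.pt '' range (D.circuit (k + N))))
      (EndCompactification.pt '' G.carrier {D.b 0})ᶜ :=
    ((continuous_fst.comp continuous_subtype_val).continuousAt (x := p)).eventually
      (ContinuousMap.eventually_mapsTo hQ hopen hmaps)
  have hev2 : ∀ᶠ q : PH G.Space in 𝓝 p, ∀ k ∈ Ioo 0 N,
      crossing (D.b 0) (mapArrow q.restrict (arrow (D.circuit k))) = 1 := by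
    refine (Filter.eventually_all_finite (finite_Ioo 0 N)).2 fun k hk => ?_
    obtain ⟨W, hW, W', hW', h⟩ := nearbyAgree exists_slim p.restrict (arrow (D.circuit k))
    have hev : ∀ᶠ f in 𝓝 p.restrict, ∃ δ : Path (p.restrict (G.vertexPt (G.src (D.b k))))
        (f (G.vertexPt (G.src (D.b k)))), range δ ⊆ W ∩ W' :=
      ((continuous_eval_const _).tendsto p.restrict).eventually
        (exists_nhds_path (Filter.inter_mem hW hW'))
    filter_upwards [PH.continuous_restrict.continuousAt.eventually (hev.and h)]
      with q ⟨⟨δ, hδ⟩, hq⟩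
    -- The short path at the ends of the closed circuit cancels because crossing numbers commute.
    have := congrArg (crossing (D.b 0)) (hq δ δ (hδ.trans inter_subset_left)
      (hδ.trans inter_subset_right))
    rw [crossing_comp, crossing_comp, hp k hk.1, one_mul] at this
    exact mul_eq_left.1 this
  filter_upwards [hev1, hev2] with q hq1 hq2 k hk
  rcases lt_or_ge k N with hkN | hkN
  · exact hq2 k ⟨hk, hkN⟩
  · refine crossing_eq_one_of_disjoint hG' ((D.circuit k).map q.restrict.continuous)
      (disjoint_left.2 ?_)
    rintro _ ⟨t, rfl⟩ ht
    refine hq1 (.inr (mem_iUnion.2 ⟨k - N, mem_image_of_mem _ (x := D.circuit k t) ?_⟩)) ?_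
    · rw [Nat.sub_add_cancel hkN]
      exact mem_range_self t
    · rw [q.restrict_spec]
      exact mem_image_of_mem _ ht

theorem not_isEmbedding [ConnectedSpace G.Space] (D : TwistData G x₀) (hG : G.LocallyFinite) (hG' : G.NoIsolated) :
    ¬ IsEmbedding (Psi x₀) := by
  intro hemb
  -- The condition is imposed on some representing automorphism; by conjugation invariance the
  -- choice is immaterial, which identifies the preimage of `O` with the open set of
  -- `isOpen_crossing`.
  let O : Set (Maps G.Space) := {m | ∃ φ : MulAut (FundamentalGroup G.Space x₀),
    Out.mk φ = Psi x₀ m ∧ ∀ k > 0, crossingHom (D.b 0) x₀ (φ (D.element k)) = 1}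
  have hO : IsOpen O := by
    refine isOpen_coinduced.2 ?_
    convert D.isOpen_crossing hG hG' using 1
    ext p
    let q : Path (p.restrict x₀) x₀ := PathConnectedSpace.somePath _ _
    have hq : ∀ k, crossingHom (D.b 0) x₀
        (inducedAut ⟨p.restrict, p.isProperHomotopyEquiv_restrict⟩ q (D.element k)) =
          crossing (D.b 0) (mapArrow p.restrict (arrow (D.circuit k))) :=
      fun k => D.crossingHom_element p.restrict q k
    constructor
    · rintro ⟨φ, hφ, h⟩ k hk
      rw [p.toMaps_eq, Psi_mk x₀ _ _ q] at hφ
      rw [← hq, ← crossingHom_eq_of_mk_eq _ hφ]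
      exact h k hk
    · intro h
      refine ⟨_, (Psi_mk x₀ _ p.isProperHomotopyEquiv_restrict q).symm, fun k hk => ?_⟩
      rw [hq]
      exact h k hk
  obtain ⟨W, hW, hWO⟩ := hemb.isInducing.isOpen_iff.1 hO
  have h1 : (1 : Maps G.Space) ∈ O := by
    refine ⟨1, (map_one (Psi x₀)).symm, fun k hk => ?_⟩
    have h := D.crossingHom_element (ContinuousMap.id G.Space) (Path.refl x₀) k
    rw [inducedHom_id] at h
    exact h.trans (D.crossing_circuit hk)
  rw [← hWO] at h1
  have h1' : Out.mk (1 : MulAut (FundamentalGroup G.Space x₀)) ∈ W := by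
    have : Psi x₀ 1 ∈ W := h1
    rwa [map_one] at this
  -- On the finite test set `T` the single twist along `b (n + 1)` acts like the empty twist, so its
  -- class lies in `O`; but it adds a crossing of `b 0` to the circuit of index `n + 1`.
  obtain ⟨T, hT, hTW⟩ := exists_finite_of_isOpen (isOpen_coinduced.1 hW) h1'
  obtain ⟨n, hn⟩ := D.exists_finite_aut_eq' hG' hT
  have hJ : {D.b (n + 1)} ⊆ D.b '' Ioi 0 :=
    singleton_subset_iff.2 (mem_image_of_mem _ (Nat.succ_pos n))
  have hmem : D.twistClass hG hG' hJ (finite_singleton _) ∈ O := by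
    rw [← hWO]
    change Psi x₀ _ ∈ W
    rw [Psi_twistClass]
    refine hTW _ fun γ hγ => ?_
    rw [← D.aut_empty]
    refine hn _ _ _ _ (fun k hk => iff_of_false (fun h => ?_) (notMem_empty _)) γ hγ
    have := D.injective (mem_singleton_iff.1 h)
    omega
  obtain ⟨φ, hφ, h⟩ := hmem
  rw [Psi_twistClass] at hφ
  have h2 := crossingHom_eq_of_mk_eq (D.b 0) hφ (D.element (n + 1))
  rw [h _ (Nat.succ_pos n), D.crossingHom_aut hG' hJ (mem_singleton _)] at h2
  exact absurd (congrArg Multiplicative.toAdd h2) (by decide)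

end TopGraph.TwistData

namespace TopGraph

open CategoryTheory ProperMaps

variable {V E : Type*} {G : TopGraph V E}

/-! ### Height functions on core graphs -/

/-- The initial vertex of an oriented edge. -/
def ini (G : TopGraph V E) (a : E × Bool) : V := if a.2 then G.src a.1 else G.tgt a.1

/-- The terminal vertex of an oriented edge. -/
def ter (G : TopGraph V E) (a : E × Bool) : V := if a.2 then G.tgt a.1 else G.src a.1

/-- The point with parameter `s` on an oriented edge. -/
def orientedPt (G : TopGraph V E) (a : E × Bool) (s : I) : G.Space :=
  G.edgePt a.1 (if a.2 then s else σ s)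

theorem orientedPt_zero (a : E × Bool) : G.orientedPt a 0 = G.vertexPt (G.ini a) := by
  obtain ⟨e, _ | _⟩ := a
  · simpa [orientedPt, ini] using G.edgePt_one e
  · simpa [orientedPt, ini] using G.edgePt_zero e

theorem exists_orientedPt {v : V} {x : G.Space} (h : vertexDist v x < 1) :
    ∃ (a : Option (E × Bool)) (s : I), a.elim (x = G.vertexPt v)
      fun a => G.ini a = v ∧ x = G.orientedPt a s := by
  rcases vertexDist_lt le_rfl h with rfl | ⟨e, t, rfl, ⟨h, -⟩ | ⟨h, -⟩⟩
  · exact ⟨none, 0, rfl⟩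
  · exact ⟨some (e, true), t, h, rfl⟩
  · exact ⟨some (e, false), σ t, h, by simp [orientedPt]⟩

/-- The extension of a function on the vertices that is linear on the edges. -/
noncomputable def linearExt (δ : V → ℕ) : G.Space → ℝ :=
  lift (fun v => δ v) (fun e t => (1 - t) * δ (G.src e) + t * δ (G.tgt e)) (fun e => by simp)
    (fun e => by simp)

theorem continuous_linearExt (δ : V → ℕ) : Continuous (linearExt (G := G) δ) :=
  continuous_of_edges fun e => by
    simp only [linearExt, lift_edgePt]
    fun_prop

theorem linearExt_orientedPt (δ : V → ℕ) (a : E × Bool) (s : I) :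
    linearExt δ (G.orientedPt a s) = (1 - s) * δ (G.ini a) + s * δ (G.ter a) := by
  obtain ⟨e, _ | _⟩ := a
  · simp [orientedPt, linearExt, ini, ter]
    ring
  · simp [orientedPt, linearExt, ini, ter]

/-- A function on the vertices that changes by one along the edges on which it does not vanish,
and such that each vertex of positive height has at most one descending edge. -/
structure IsHeight (G : TopGraph V E) (δ : V → ℕ) : Prop where
  step : ∀ a, δ (G.ini a) = 0 ∧ δ (G.ter a) = 0 ∨ δ (G.ini a) = δ (G.ter a) + 1 ∨
    δ (G.ter a) = δ (G.ini a) + 1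
  unique : ∀ a a', G.ini a = G.ini a' → δ (G.ter a) < δ (G.ini a) → δ (G.ter a') < δ (G.ini a') →
    a = a'

variable {δ : V → ℕ}

/-- At positive height there is locally only one way down and the height has slope `±1` on edges, so
points not higher than `y` are told apart by their heights. -/
theorem IsHeight.exists_nhds_injOn (hδ : G.IsHeight δ) {y : G.Space} (hy : 0 < linearExt δ y) :
    ∃ N ∈ 𝓝 y, InjOn (linearExt δ) (N ∩ {x | linearExt δ x ≤ linearExt δ y}) := by
  rcases exists_pt y with ⟨v, rfl⟩ | ⟨e, t, h0, h1, rfl⟩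
  · have hv : linearExt δ (G.vertexPt v) = δ v := rfl
    rw [hv] at hy ⊢
    refine ⟨_, (isOpen_lt (continuous_vertexDist v) continuous_const).mem_nhds
      (show vertexDist v _ < (1 : ℝ) by rw [vertexDist_self]; norm_num), ?_⟩
    have key : ∀ x : G.Space, vertexDist v x < 1 → linearExt δ x ≤ δ v → x = G.vertexPt v ∨
        ∃ a s, G.ini a = v ∧ δ (G.ter a) < δ (G.ini a) ∧ x = G.orientedPt a s ∧
          linearExt δ x = δ v - s ∧ 0 < (s : ℝ) := by
      intro x hx hle
      obtain ⟨_ | a, s, h⟩ := exists_orientedPt hx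
      · exact .inl h
      obtain ⟨ha, rfl⟩ := h
      rcases eq_or_ne s 0 with rfl | hs
      · exact .inl (ha ▸ orientedPt_zero a)
      have hs0 : 0 < (s : ℝ) := unitInterval.pos_iff_ne_zero.2 hs
      rw [linearExt_orientedPt, ha] at hle
      rcases hδ.step a with h | h | h <;> rw [ha] at h
      · rw [h.1] at hy
        simp at hy
      · refine .inr ⟨a, s, ha, by rw [ha]; omega, rfl, ?_, hs0⟩
        rw [linearExt_orientedPt, ha, h]
        push_cast
        ring
      · rw [h] at hle
        push_cast at hle
        nlinarith
    rintro x ⟨hx, hxy⟩ x' ⟨hx', hxy'⟩ hxx'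
    rcases key x hx hxy with rfl | ⟨a, s, ha, hlt, rfl, hs, hs0⟩ <;>
      rcases key x' hx' hxy' with rfl | ⟨a', s', ha', hlt', rfl, hs', hs0'⟩
    · rfl
    · rw [hv, hs'] at hxx'
      linarith
    · rw [hv, hs] at hxx'
      linarith
    · obtain rfl := hδ.unique a a' (ha.trans ha'.symm) hlt hlt'
      rw [hs, hs'] at hxx'
      rw [show s = s' from Subtype.ext (by linarith)]
  · have h0' : (0 : ℝ) < t := h0
    have h1' : (t : ℝ) < 1 := h1
    refine ⟨_, (isOpen_lt (continuous_edgeDist e t) continuous_const).mem_nhds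
      (show edgeDist e t _ < min (t : ℝ) (1 - t) by
        rw [edgeDist_self]; exact lt_min h0' (by linarith)), ?_⟩
    rintro x ⟨hx, -⟩ x' ⟨hx', -⟩ hxx'
    obtain ⟨s, rfl, -⟩ := edgeDist_lt le_rfl hx
    obtain ⟨s', rfl, -⟩ := edgeDist_lt le_rfl hx'
    simp only [linearExt, lift_edgePt] at hxx' hy
    rcases hδ.step (e, true) with h | h | h <;> simp only [ini, ter, if_true] at h
    · rw [h.1, h.2] at hy
      simp at hy
    · rw [h] at hxx'
      push_cast at hxx'
      rw [show s = s' from Subtype.ext (by linarith)]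
    · rw [h] at hxx'
      push_cast at hxx'
      rw [show s = s' from Subtype.ext (by linarith)]

/-- An injective continuous function on an interval is strictly monotone, so it has no maximum at an
interior point. -/
theorem _root_.Circle.false_of_local_max {f : Circle → ℝ} (hf : Continuous f) {z : Circle}
    (hmax : ∀ w, f w ≤ f z) {U : Set Circle} (hU : U ∈ 𝓝 z) (hinj : InjOn f U) : False := by
  obtain ⟨θ, rfl⟩ := Circle.exp_surjective z
  have hc : Continuous fun s : ℝ => Circle.exp s := Circle.exp.continuous
  obtain ⟨r, hr, hrU⟩ := Metric.mem_nhds_iff.1 (hc.continuousAt hU)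
  -- The bound `r / 2` keeps the arc inside `U`, and the bound `1` keeps its length below `2π`, so
  -- that the exponential is injective on it.
  have hr' : 0 < min (r / 2) 1 := lt_min (by linarith) one_pos
  set q := min (r / 2) 1
  have hqr : q ≤ r / 2 := min_le_left _ _
  have hq1 : q ≤ 1 := min_le_right _ _
  have hexp : InjOn (fun s : ℝ => Circle.exp s) (Icc (θ - q) (θ + q)) := by
    intro s hs s' hs' h
    obtain ⟨m, hm⟩ := Circle.exp_eq_exp.1 h
    have hpi := Real.pi_gt_three
    have hm0 : m = 0 := by
      have h1 : (m : ℝ) * (2 * Real.pi) < 1 * (2 * Real.pi) := by linarith [hs.2, hs'.1]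
      have h2 : (-1) * (2 * Real.pi) < (m : ℝ) * (2 * Real.pi) := by linarith [hs.1, hs'.2]
      have h3 : (m : ℝ) < 1 := lt_of_mul_lt_mul_right h1 (by positivity)
      have h4 : (-1 : ℝ) < m := lt_of_mul_lt_mul_right h2 (by positivity)
      have h5 : m < 1 := by exact_mod_cast h3
      have h6 : -1 < m := by exact_mod_cast h4
      omega
    rw [hm0] at hm
    simpa using hm
  have hg : InjOn (fun s : ℝ => f (Circle.exp s)) (Icc (θ - q) (θ + q)) := by
    intro s hs s' hs' h
    have hmem : ∀ s ∈ Icc (θ - q) (θ + q), Circle.exp s ∈ U := fun s hs => hrU (by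
      rw [Metric.mem_ball, Real.dist_eq, abs_lt]
      constructor <;> linarith [hs.1, hs.2])
    exact hexp hs hs' (hinj (hmem s hs) (hmem s' hs') h)
  rcases (hf.comp hc).continuousOn.strictMonoOn_of_injOn_Icc' (by linarith) hg with h | h
  · have := h (a := θ) (b := θ + q) ⟨by linarith, by linarith⟩ ⟨by linarith, by linarith⟩
      (by linarith)
    exact absurd (hmax _) this.not_ge
  · have := h (a := θ - q) (b := θ) ⟨by linarith, by linarith⟩ ⟨by linarith, by linarith⟩
      (by linarith)
    exact absurd (hmax _) this.not_ge

theorem linearExt_nonneg (x : G.Space) : 0 ≤ linearExt δ x := by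
  rcases exists_pt x with ⟨v, rfl⟩ | ⟨e, t, -, -, rfl⟩
  · exact Nat.cast_nonneg _
  · have h0 := t.2.1
    have h1 : 0 ≤ 1 - (t : ℝ) := sub_nonneg.2 t.2.2
    simp only [linearExt, lift_edgePt]
    positivity

/-- At a positive maximum of the height, local injectivity of the loop and of the height below that
level would make the height along the loop locally injective. -/
theorem IsHeight.eq_zero_of_isImmersedLoop (hδ : G.IsHeight δ) {γ : C(Circle, G.Space)}
    (hγ : G.IsImmersedLoop γ) (w : Circle) : linearExt δ (γ w) = 0 := by
  have hc : Continuous fun z => linearExt δ (γ z) := (continuous_linearExt δ).comp γ.continuous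
  obtain ⟨z, -, hz⟩ := isCompact_univ.exists_isMaxOn (univ_nonempty (α := Circle)) hc.continuousOn
  have hmax : ∀ w, linearExt δ (γ w) ≤ linearExt δ (γ z) := fun w => hz (mem_univ w)
  rcases (linearExt_nonneg (δ := δ) (γ z)).eq_or_lt with h | h
  · exact le_antisymm ((hmax w).trans_eq h.symm) (linearExt_nonneg _)
  obtain ⟨N, hN, hinj⟩ := hδ.exists_nhds_injOn h
  obtain ⟨U, hU, hUinj⟩ := hγ z
  refine (Circle.false_of_local_max hc hmax
    (Filter.inter_mem hU (γ.continuous.continuousAt hN)) ?_).elim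
  intro s hs s' hs' hss'
  exact hUinj hs.1 hs'.1 (hinj ⟨hs.2, hmax s⟩ ⟨hs'.2, hmax s'⟩ hss')

/-- The zero set of the height spans a subgraph that contains all immersed loops, so in a core graph
it is everything. -/
theorem IsHeight.eq_zero (hδ : G.IsHeight δ) (hcore : G.IsCoreGraph) (v : V) : δ v = 0 := by
  let V' : Set V := {v | δ v = 0}
  let E' : Set E := {e | δ (G.src e) = 0 ∧ δ (G.tgt e) = 0}
  let S : Set G.Space := G.vertexPt '' V' ∪ {x | ∃ e ∈ E', ∃ t : I, x = G.edgePt e t}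
  have hS : G.core ⊆ S := by
    refine sInter_subset_of_mem ⟨⟨V', E', fun e he => he, rfl⟩, ?_⟩
    rintro γ hγ _ ⟨w, rfl⟩
    have h := hδ.eq_zero_of_isImmersedLoop hγ w
    rcases exists_pt (γ w) with ⟨v, hv⟩ | ⟨e, t, h0, h1, he⟩
    · rw [hv] at h ⊢
      have h' : (δ v : ℝ) = 0 := h
      exact .inl (mem_image_of_mem _ (show δ v = 0 by exact_mod_cast h'))
    · rw [he] at h ⊢
      have h0' : (0 : ℝ) < t := h0
      have h1' : 0 < 1 - (t : ℝ) := sub_pos.2 h1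
      simp only [linearExt, lift_edgePt] at h
      have ha : (0 : ℝ) ≤ δ (G.src e) := Nat.cast_nonneg _
      have hb : (0 : ℝ) ≤ δ (G.tgt e) := Nat.cast_nonneg _
      have h2 := (add_eq_zero_iff_of_nonneg (by positivity) (by positivity)).1 h
      refine .inr ⟨e, ⟨?_, ?_⟩, t, rfl⟩
      · exact_mod_cast (mul_eq_zero.1 h2.1).resolve_left h1'.ne'
      · exact_mod_cast (mul_eq_zero.1 h2.2).resolve_left h0'.ne'
  rw [hcore] at hS
  rcases hS (mem_univ (G.vertexPt v)) with ⟨w, hw, hwv⟩ | ⟨e, he, t, h⟩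
  · exact G.vertexPt_injective hwv ▸ hw
  · rcases eq_or_ne t 0 with rfl | h0
    · rw [edgePt_zero] at h
      exact G.vertexPt_injective h ▸ he.1
    rcases eq_or_ne t 1 with rfl | h1
    · rw [edgePt_one] at h
      exact G.vertexPt_injective h ▸ he.2
    exact (edgePt_ne_vertexPt (unitInterval.pos_iff_ne_zero.2 h0)
      (unitInterval.lt_one_iff_ne_one.2 h1) _ h.symm).elim

end TopGraph

/-! ### Reduced words of paths in tree-like parts -/

theorem FreeGroup.toWord_of_eq_mk_mul {α : Type*} [DecidableEq α] {a : α × Bool}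
    {x y : FreeGroup α} (h : x = FreeGroup.mk [a] * y) :
    x.toWord = a :: y.toWord ∨ y.toWord = (a.1, !a.2) :: x.toWord := by
  have h1 : x.toWord = FreeGroup.reduce (a :: y.toWord) := by
    rw [h, FreeGroup.toWord_mul, FreeGroup.toWord_mk]
    rfl
  rw [FreeGroup.reduce.cons, FreeGroup.reduce_toWord] at h1
  rcases hy : y.toWord with _ | ⟨b, L⟩
  · rw [hy] at h1
    exact .inl h1
  · rw [hy] at h1
    simp only at h1
    split_ifs at h1 with hab
    · refine .inr ?_
      rw [h1, hab.1, hab.2, Bool.not_not]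
    · exact .inl h1

namespace TopGraph

open CategoryTheory ProperMaps

variable {V E : Type*} {G : TopGraph V E}

theorem EdgeGen.iff_of_edges {S : Set E} {P : V → Prop}
    (h : ∀ e ∈ S, P (G.src e) ↔ P (G.tgt e)) {v w : V}
    {κ : FundamentalGroupoid.mk (G.vertexPt v) ⟶ FundamentalGroupoid.mk (G.vertexPt w)}
    (hκ : EdgeGen S κ) : P v ↔ P w := by
  classical
  let q : G.Space → Prop := lift P (fun e t => if t < 1 then P (G.src e) else P (G.tgt e))
    (fun e => if_pos zero_lt_one) (fun e => if_neg (lt_irrefl _))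
  have key : ∀ {x y : G.Space} {κ : FundamentalGroupoid.mk x ⟶ FundamentalGroupoid.mk y},
      EdgeGen S κ → q x = q y := by
    intro x y κ hκ
    induction hκ with
    | id x => rfl
    | @seg e he s t =>
      have : ∀ u, q (G.edgePt e u) = P (G.src e) := fun u => by
        simp only [q, lift_edgePt]
        split_ifs
        exacts [rfl, (propext (h e he)).symm]
      rw [this, this]
    | comp _ _ h h' => exact h.trans h'
  exact iff_of_eq (key hκ)

/-! ### Vertices without essential loops -/

theorem ini_rev (a : E × Bool) : G.ini (a.1, !a.2) = G.ter a := by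
  obtain ⟨e, _ | _⟩ := a <;> rfl

theorem ter_rev (a : E × Bool) : G.ter (a.1, !a.2) = G.ini a := by
  obtain ⟨e, _ | _⟩ := a <;> rfl

theorem exists_edgeGen_oriented {S : Set E} {a : E × Bool} (ha : a.1 ∈ S) :
    ∃ κ : FundamentalGroupoid.mk (G.vertexPt (G.ini a)) ⟶
      FundamentalGroupoid.mk (G.vertexPt (G.ter a)), EdgeGen S κ ∧ hol κ = FreeGroup.mk [a] := by
  have h : EdgeGen S (arrow (G.edgePath a.1)) :=
    edgeGen_of_range_subset _ (by rintro _ ⟨t, rfl⟩; exact edgePt_mem_carrier ha t)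
  obtain ⟨e, _ | _⟩ := a
  · exact ⟨inv (arrow (G.edgePath e)), h.inv,
      (hol_inv (arrow (G.edgePath e))).trans (congrArg (·⁻¹) (hol_edgePath e))⟩
  · exact ⟨arrow (G.edgePath e), h, hol_edgePath e⟩

/-- The vertices that can be joined to `u` by at most `m` edges in `S`. -/
def ball (G : TopGraph V E) (S : Set E) (u : V) : ℕ → Set V
  | 0 => {u}
  | m + 1 => ball G S u m ∪ {w | ∃ a : E × Bool, a.1 ∈ S ∧ G.ini a ∈ ball G S u m ∧ G.ter a = w}

theorem LocallyFinite.finite_ball (hG : G.LocallyFinite) (S : Set E) (u : V) (m : ℕ) :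
    (G.ball S u m).Finite := by
  induction m with
  | zero => exact finite_singleton u
  | succ m ih =>
    refine ih.union (((hG.finite_edges ih).prod (finite_univ (α := Bool))).image G.ter |>.subset ?_)
    rintro _ ⟨⟨e, _ | _⟩, -, ha, rfl⟩
    · exact mem_image_of_mem _ ⟨.inr ha, mem_univ _⟩
    · exact mem_image_of_mem _ ⟨.inl ha, mem_univ _⟩

theorem monotone_ball (S : Set E) (u : V) : Monotone (G.ball S u) :=
  monotone_nat_of_le_succ fun _ => subset_union_left

/-- No loop at `v` in the edges of `S` is essential. -/
def Inessential (G : TopGraph V E) (S : Set E) (v : V) : Prop :=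
  ∀ κ : FundamentalGroupoid.mk (G.vertexPt v) ⟶ FundamentalGroupoid.mk (G.vertexPt v),
    EdgeGen S κ → κ = 𝟙 _

/-- The vertices that can be joined to `u` in the edges of `S`. -/
def cluster (G : TopGraph V E) (S : Set E) (u : V) : Set V :=
  {w | ∃ κ : FundamentalGroupoid.mk (G.vertexPt w) ⟶ FundamentalGroupoid.mk (G.vertexPt u),
    EdgeGen S κ}

theorem ter_mem_cluster {S : Set E} {u : V} {a : E × Bool} (ha : a.1 ∈ S)
    (h : G.ini a ∈ G.cluster S u) : G.ter a ∈ G.cluster S u := by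
  obtain ⟨κ, hκ⟩ := h
  obtain ⟨κ', hκ', -⟩ := exists_edgeGen_oriented (G := G) ha
  exact ⟨_, hκ'.inv.comp hκ⟩

/-- The words of the paths to `u`. -/
theorem Inessential.exists_words {S : Set E} {u : V} (hu : G.Inessential S u) :
    ∃ g : V → FreeGroup E, g u = 1 ∧ ∀ a : E × Bool, a.1 ∈ S → G.ini a ∈ G.cluster S u →
      g (G.ini a) = FreeGroup.mk [a] * g (G.ter a) := by
  classical
  have huniq : ∀ {w : V} (κ κ' : FundamentalGroupoid.mk (G.vertexPt w) ⟶
      FundamentalGroupoid.mk (G.vertexPt u)), EdgeGen S κ → EdgeGen S κ' → κ = κ' := by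
    intro w κ κ' h h'
    have := hu _ (h.inv.comp h')
    rw [IsIso.inv_comp_eq, Category.comp_id] at this
    exact this.symm
  let g : V → FreeGroup E := fun w => if h : w ∈ G.cluster S u then hol h.choose else 1
  have hg : ∀ {w : V} (κ : FundamentalGroupoid.mk (G.vertexPt w) ⟶
      FundamentalGroupoid.mk (G.vertexPt u)), EdgeGen S κ → g w = hol κ := by
    intro w κ hκ
    have hw : w ∈ G.cluster S u := ⟨κ, hκ⟩
    simp only [g, dif_pos hw]
    rw [huniq hw.choose κ hw.choose_spec hκ]
  refine ⟨g, (hg _ (.id _)).trans (hol_id _), fun a ha hmem => ?_⟩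
  obtain ⟨κ, hκ⟩ := ter_mem_cluster ha hmem
  obtain ⟨κ', hκ', hh⟩ := exists_edgeGen_oriented (G := G) ha
  rw [hg _ (hκ'.comp hκ), hg _ hκ, hol_comp, hh]

/-- Word length bounds the distance to `u`. Crossing an edge adds or cancels the first letter, so
the bound propagates along edges from `u`, where the word is empty. -/
theorem mem_ball_of_words [DecidableEq E] {S : Set E} {u : V} {g : V → FreeGroup E}
    (hg1 : g u = 1) (hg : ∀ a : E × Bool, a.1 ∈ S → G.ini a ∈ G.cluster S u →
      g (G.ini a) = FreeGroup.mk [a] * g (G.ter a)) {w : V} (hw : w ∈ G.cluster S u) :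
    w ∈ G.ball S u (g w).toWord.length := by
  have hball : ∀ m w, w ∈ G.ball S u m → w ∈ G.cluster S u ∧ (g w).toWord.length ≤ m := by
    intro m
    induction m with
    | zero =>
      rintro w rfl
      exact ⟨⟨_, .id _⟩, by rw [hg1]; simp⟩
    | succ m ih =>
      rintro w (hw | ⟨a, ha, hini, rfl⟩)
      · exact ⟨(ih w hw).1, (ih w hw).2.trans (Nat.le_succ m)⟩
      · obtain ⟨h1, h2⟩ := ih _ hini
        refine ⟨ter_mem_cluster ha h1, ?_⟩
        rcases FreeGroup.toWord_of_eq_mk_mul (hg a ha h1) with h | h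
        · rw [h, List.length_cons] at h2
          omega
        · rw [h, List.length_cons]
          omega
  have key : ∀ a : E × Bool, a.1 ∈ S →
      (G.ini a ∈ G.cluster S u ∧ G.ini a ∈ G.ball S u (g (G.ini a)).toWord.length) →
      G.ter a ∈ G.cluster S u ∧ G.ter a ∈ G.ball S u (g (G.ter a)).toWord.length := by
    rintro a ha ⟨hc, hb⟩
    refine ⟨ter_mem_cluster ha hc, ?_⟩
    rcases FreeGroup.toWord_of_eq_mk_mul (hg a ha hc) with h | h
    · rw [h, List.length_cons] at hb
      -- When the word shortens, the ball containing the initial vertex was entered by an edge `a'`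
      -- whose reverse must be the first letter `a`; so `a` leads back into the smaller ball.
      rcases hb with hb | ⟨a', ha', hb, hter⟩
      · have := (hball _ _ hb).2
        rw [h, List.length_cons] at this
        omega
      · obtain ⟨h1, h2⟩ := hball _ _ hb
        have h3 := hg (a'.1, !a'.2) ha' (by
          rw [ini_rev]
          exact ter_mem_cluster ha' h1)
        rw [ini_rev, ter_rev, hter] at h3
        rcases FreeGroup.toWord_of_eq_mk_mul h3 with h4 | h4
        · rw [h] at h4
          have h5 := (List.cons.inj h4).1
          have h6 : G.ter a = G.ini a' := by rw [h5, ter_rev]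
          rw [h6] at hb ⊢
          exact hb
        · have h5 := congrArg List.length h4
          have h6 := congrArg List.length h
          simp only [List.length_cons] at h5 h6
          omega
    · rw [h, List.length_cons]
      exact .inr ⟨a, ha, hb, rfl⟩
  obtain ⟨κ, hκ⟩ := hw
  refine ((hκ.iff_of_edges (P := fun w => w ∈ G.cluster S u ∧
    w ∈ G.ball S u (g w).toWord.length) fun e he =>
      ⟨key (e, true) he, key (e, false) he⟩).2 ⟨⟨_, .id _⟩, ?_⟩).2
  rw [hg1]
  exact mem_singleton u

/-- Above a level `M` exceeding the words at all vertices of `B`, word length is a height function,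
because the first letter of a reduced word is the only way down. In a core graph it vanishes, so the
cluster lies in a ball of radius `M`. -/
theorem finite_cluster (hG : G.LocallyFinite) (hcore : G.IsCoreGraph) {B : Set E} (hB : B.Finite)
    {u : V} (hu : G.Inessential Bᶜ u) : (G.cluster Bᶜ u).Finite := by
  classical
  obtain ⟨g, hg1, hg⟩ := hu.exists_words
  obtain ⟨M, hM⟩ := ((finite_vertices (G := G) B hB).image
    fun v => (g v).toWord.length).bddAbove
  -- Truncated subtraction makes `δ` vanish at the vertices of `B`, so the edges of `B`, which may
  -- leave the cluster, cause no jump.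
  let δ : V → ℕ := fun w => if w ∈ G.cluster Bᶜ u then (g w).toWord.length - M else 0
  have hδB : ∀ w, G.vertexPt w ∈ G.carrier B → δ w = 0 := by
    intro w hw
    have := hM (mem_image_of_mem _ hw)
    simp only [δ]
    split_ifs <;> omega
  have hini : ∀ a : E × Bool, a.1 ∈ B → G.vertexPt (G.ini a) ∈ G.carrier B := by
    rintro ⟨e, _ | _⟩ ha
    exacts [tgt_mem_carrier ha, src_mem_carrier ha]
  have hmem : ∀ a : E × Bool, a.1 ∈ Bᶜ →
      (G.ini a ∈ G.cluster Bᶜ u ↔ G.ter a ∈ G.cluster Bᶜ u) := fun a ha =>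
    ⟨ter_mem_cluster ha, fun h => by
      have := ter_mem_cluster (a := (a.1, !a.2)) ha (by rwa [ini_rev])
      rwa [ter_rev] at this⟩
  have hheight : G.IsHeight δ := by
    refine ⟨fun a => ?_, fun a a' haa' h h' => ?_⟩
    · by_cases ha : a.1 ∈ B
      · refine .inl ⟨hδB _ (hini a ha), hδB _ ?_⟩
        rw [← ini_rev]
        exact hini _ ha
      · by_cases hc : G.ini a ∈ G.cluster Bᶜ u
        · have hc' := (hmem a ha).1 hc
          simp only [δ, if_pos hc, if_pos hc']
          rcases FreeGroup.toWord_of_eq_mk_mul (hg a ha hc) with h | h <;>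
            rw [h, List.length_cons] <;> omega
        · have hc' := fun h => hc ((hmem a ha).2 h)
          exact .inl ⟨if_neg hc, if_neg hc'⟩
    · have key : ∀ a, δ (G.ter a) < δ (G.ini a) →
          (g (G.ini a)).toWord = a :: (g (G.ter a)).toWord := by
        intro a h
        have ha : a.1 ∉ B := fun ha => by
          rw [hδB _ (hini a ha)] at h
          omega
        have hc : G.ini a ∈ G.cluster Bᶜ u := by
          by_contra hc
          simp only [δ, if_neg hc] at h
          omega
        have hc' := (hmem a ha).1 hc
        rcases FreeGroup.toWord_of_eq_mk_mul (hg a ha hc) with h1 | h1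
        · exact h1
        · simp only [δ, if_pos hc, if_pos hc'] at h
          rw [h1, List.length_cons] at h
          omega
      have h1 := key a h
      rw [haa', key a' h'] at h1
      exact (List.cons.inj h1).1.symm
  refine (hG.finite_ball Bᶜ u M).subset fun w hw => ?_
  refine monotone_ball _ _ ?_ (mem_ball_of_words hg1 hg hw)
  have := hheight.eq_zero hcore w
  simp only [δ, if_pos hw] at this
  omega

theorem finite_inessential [ConnectedSpace G.Space] (hG : G.LocallyFinite) (hG' : G.NoIsolated)
    (hcore : G.IsCoreGraph) {B : Set E} (hB : B.Finite) : {v | G.Inessential Bᶜ v}.Finite := by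
  rcases isEmpty_or_nonempty V with hV | ⟨⟨v₀⟩⟩
  · exact toFinite _
  -- Removing one more edge makes the removed set nonempty; by connectedness every vertex then
  -- reaches one of its finitely many vertices, so finitely many clusters suffice.
  obtain ⟨e₀, -⟩ := hG' v₀
  have hB' : (insert e₀ B).Finite := hB.insert e₀
  have hsub : (insert e₀ B)ᶜ ⊆ Bᶜ := compl_subset_compl.2 (subset_insert _ _)
  have hD := finite_vertices (G := G) _ hB'
  refine ((hD.subset (sep_subset _ (G.Inessential (insert e₀ B)ᶜ))).biUnion fun u hu =>
    finite_cluster hG hcore hB' hu.2).subset fun v hv => ?_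
  replace hv : G.Inessential (insert e₀ B)ᶜ v := fun κ hκ => hv κ (hκ.mono hsub)
  obtain ⟨u, huD, κ, hκ⟩ : ∃ u, G.vertexPt u ∈ G.carrier (insert e₀ B) ∧
      ∃ κ : FundamentalGroupoid.mk (G.vertexPt v) ⟶ FundamentalGroupoid.mk (G.vertexPt u),
        EdgeGen (insert e₀ B)ᶜ κ := by
    by_contra hcon
    push Not at hcon
    let P : V → Prop := fun w => ∃ κ : FundamentalGroupoid.mk (G.vertexPt v) ⟶
      FundamentalGroupoid.mk (G.vertexPt w), EdgeGen (insert e₀ B)ᶜ κ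
    have hP : P v = P (G.src e₀) := setoid_of_connected (G := G) (Setoid.ker P) (fun e => by
      refine propext ?_
      by_cases he : e ∈ insert e₀ B
      · exact iff_of_false (fun ⟨κ, hκ⟩ => hcon _ (src_mem_carrier he) κ hκ)
          fun ⟨κ, hκ⟩ => hcon _ (tgt_mem_carrier he) κ hκ
      · obtain ⟨κ', hκ', -⟩ := exists_edgeGen_oriented (G := G) (a := (e, true)) (mem_compl he)
        exact ⟨fun ⟨κ, hκ⟩ => ⟨_, hκ.comp hκ'⟩, fun ⟨κ, hκ⟩ => ⟨_, hκ.comp hκ'.inv⟩⟩) _ _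
    obtain ⟨κ, hκ⟩ : P (G.src e₀) := hP ▸ ⟨_, .id _⟩
    exact hcon _ (src_mem_carrier (mem_insert _ _)) κ hκ
  refine mem_biUnion (x := u) ⟨huD, fun κ' hκ' => ?_⟩ ⟨κ, hκ⟩
  have := hv _ (hκ.comp (hκ'.comp hκ.inv))
  rwa [← Category.assoc, IsIso.comp_inv_eq, Category.id_comp, ← IsIso.eq_inv_comp,
    IsIso.inv_hom_id] at this

end TopGraph

namespace ProperMaps

open CategoryTheory

variable {X : Type*} [TopologicalSpace X]

/-! ### Filling squares -/

/-- The first half of the time deforms `p` to the path `r · q · s⁻¹` with fixed ends, the second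
half shrinks this to `q`. The waiting time explains the constant paths on the sides. -/
theorem exists_square {a b c d : X} (p : Path a b) (q : Path c d) (r : Path a c) (s : Path b d)
    (h : arrow p ≫ arrow s = arrow r ≫ arrow q) :
    ∃ F : C(I × I, X), (∀ u, F (0, u) = p u) ∧ (∀ u, F (1, u) = q u) ∧
      (∀ t, F (t, 0) = (Path.refl a).trans r t) ∧ ∀ t, F (t, 1) = (Path.refl b).trans s t := by
  let W : Path a b := (r.trans q).trans s.symm
  have hW : arrow p = arrow W := by
    rw [arrow_trans, arrow_trans, arrow_symm, ← h, Category.assoc, IsIso.hom_inv_id,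
      Category.comp_id]
  obtain ⟨K⟩ := arrow_eq_iff.1 hW
  -- In `W` the pieces `r`, `q`, `s⁻¹` occupy `[0, 1/4]`, `[1/4, 1/2]`, `[1/2, 1]`; at time `t` the
  -- window `[t/4, 1 - t/2]` is traversed.
  let L : ContinuousMap.Homotopy (W : C(I, X)) (q : C(I, X)) :=
    { toFun := fun x => W.extend ((1 - x.2) * (x.1 / 4) + x.2 * (1 - x.1 / 2))
      continuous_toFun := W.continuous_extend.comp (by fun_prop)
      map_zero_left := fun u => by
        simp only [Icc.coe_zero, zero_div, mul_zero, sub_zero, mul_one, zero_add]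
        exact W.extend_apply u.2
      map_one_left := fun u => by
        have h0 := u.2.1
        have h1 := u.2.2
        simp only [Icc.coe_one]
        rw [show (1 - (u : ℝ)) * (1 / 4) + u * (1 - 1 / 2) = (u + 1) / 4 by ring,
          Path.extend_apply _ ⟨by linarith, by linarith⟩]
        simp only [W, Path.trans_apply]
        rw [dif_pos (by linarith)]
        split_ifs with hu
        · have : u = 0 := Subtype.ext (by change (u : ℝ) = 0; linarith)
          subst this
          simp only [Icc.coe_zero]
          norm_num
        · exact congrArg q (Subtype.ext (by ring)) }
  refine ⟨(K.toHomotopy.trans L).toContinuousMap, fun u => (K.toHomotopy.trans L).apply_zero u,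
    fun u => (K.toHomotopy.trans L).apply_one u, fun t => ?_, fun t => ?_⟩
  · change (K.toHomotopy.trans L) (t, 0) = _
    rw [ContinuousMap.Homotopy.trans_apply, Path.trans_apply]
    have h0 := t.2.1
    have h1 := t.2.2
    split_ifs with ht
    · exact K.source _
    · change W.extend _ = _
      simp only [Icc.coe_zero, sub_zero, one_mul, zero_mul, add_zero]
      rw [Path.extend_apply _ ⟨by linarith, by linarith⟩]
      simp only [W, Path.trans_apply]
      rw [dif_pos (by linarith), dif_pos (by linarith)]
      exact congrArg r (Subtype.ext (by ring))
  · change (K.toHomotopy.trans L) (t, 1) = _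
    rw [ContinuousMap.Homotopy.trans_apply, Path.trans_apply]
    have h0 := t.2.1
    have h1 := t.2.2
    split_ifs with ht
    · exact K.target _
    · change W.extend _ = _
      simp only [Icc.coe_one, sub_self, zero_mul, one_mul, zero_add]
      rw [Path.extend_apply _ ⟨by linarith, by linarith⟩]
      simp only [W, Path.trans_apply]
      rcases h1.eq_or_lt with ht1 | ht1
      · rw [dif_pos (by linarith), dif_neg (by linarith)]
        refine (congrArg q (show _ = (1 : I) from Subtype.ext ?_)).trans (q.target.trans
          (s.target.symm.trans (congrArg s (show (1 : I) = _ from Subtype.ext ?_))))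
        · change 2 * (2 * (1 - (2 * (t : ℝ) - 1) / 2)) - 1 = 1
          linarith
        · change 1 = 2 * (t : ℝ) - 1
          linarith
      · rw [dif_neg (by linarith)]
        exact congrArg s (Subtype.ext (by
          change 1 - (2 * (1 - (2 * (t : ℝ) - 1) / 2) - 1) = 2 * t - 1
          ring))

/-! ### Maps that act trivially on the fundamental group -/

/-- The action is inner, and absorbing the conjugating element into the connecting path makes it
commute with all loops at `x₀`. Transport along arbitrary paths extends it to all points. -/
theorem exists_natural [PathConnectedSpace X] {x₀ : X} {h : C(X, X)}
    (hh : IsProperHomotopyEquiv h) (hΨ : Psi x₀ (Maps.mk h hh) = 1) :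
    ∃ Γ : ∀ x : X, FundamentalGroupoid.mk (h x) ⟶ FundamentalGroupoid.mk x,
      ∀ {x y : X} (κ : FundamentalGroupoid.mk x ⟶ FundamentalGroupoid.mk y),
        mapArrow h κ ≫ Γ y = Γ x ≫ κ := by
  let p : Path (h x₀) x₀ := PathConnectedSpace.somePath _ _
  rw [Psi_mk x₀ h hh p] at hΨ
  obtain ⟨c, hc⟩ := (QuotientGroup.eq_one_iff _).1 hΨ
  let c' : FundamentalGroupoid.mk x₀ ⟶ FundamentalGroupoid.mk x₀ := c
  let P : FundamentalGroupoid.mk (h x₀) ⟶ FundamentalGroupoid.mk x₀ := arrow p ≫ inv c'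
  have hP : ∀ γ : FundamentalGroupoid.mk x₀ ⟶ FundamentalGroupoid.mk x₀,
      mapArrow h γ ≫ P = P ≫ γ := by
    intro γ
    let γ' : FundamentalGroup X x₀ := γ
    have h1 : inducedHom h p γ' = c * γ' * c⁻¹ := (DFunLike.congr_fun hc γ').symm
    rw [inducedHom_eq] at h1
    have h2 : inv (arrow p) ≫ mapArrow h γ ≫ arrow p = inv c' ≫ γ ≫ c' := by
      refine h1.trans ?_
      change Groupoid.inv c' ≫ γ ≫ c' = _
      rw [Groupoid.inv_eq_inv]
    rw [IsIso.inv_comp_eq] at h2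
    simp only [P]
    rw [reassoc_of% h2, IsIso.hom_inv_id, Category.comp_id, Category.assoc]
  let β : ∀ x, FundamentalGroupoid.mk x₀ ⟶ FundamentalGroupoid.mk x :=
    fun x => arrow (PathConnectedSpace.somePath x₀ x)
  refine ⟨fun x => inv (mapArrow h (β x)) ≫ P ≫ β x, fun {x y} κ => ?_⟩
  have h1 := hP (β x ≫ κ ≫ inv (β y))
  rw [mapArrow_comp, mapArrow_comp, mapArrow_inv] at h1
  simp only [Category.assoc] at h1 ⊢
  rw [IsIso.eq_inv_comp, reassoc_of% h1, IsIso.inv_hom_id, Category.comp_id]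

/-- As `P i` shrinks with `i`, a witness for the largest attained level serves all attained levels
at once. It selects tracks and squares that go as far out as possible. -/
theorem exists_best {α : Type*} (P : ℕ → α → Prop) (h0 : ∃ a, P 0 a)
    (hmono : ∀ i j a, i ≤ j → P j a → P i a) (hb : ∃ n, ∀ a, ¬ P n a) :
    ∃ a, ∀ i, (∃ a', P i a') → P i a := by
  classical
  have hb' : ∃ n, ¬ ∃ a, P n a := hb.imp fun n h => not_exists.2 h
  have hpos : Nat.find hb' ≠ 0 := fun h => Nat.find_spec hb' (h ▸ h0)
  obtain ⟨m, hm⟩ := Nat.exists_eq_succ_of_ne_zero hpos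
  obtain ⟨a, ha⟩ := not_not.1 (Nat.find_min hb' (m := m) (by omega))
  refine ⟨a, fun i ⟨a', ha'⟩ => hmono i m a ?_ ha⟩
  by_contra hlt
  exact Nat.find_spec hb' ⟨a', hmono _ i a' (by omega) ha'⟩

end ProperMaps

/-! ### Proper homotopies and injectivity for core graphs -/

namespace TopGraph

open CategoryTheory ProperMaps

variable {V E : Type*} {G : TopGraph V E}

theorem mem_touching_of_edgePt_mem {B : Set E} {e : E} {t : I} (h : G.edgePt e t ∈ G.carrier B) :
    e ∈ G.touching B := by
  by_contra he
  exact disjoint_left.1 (disjoint_carrier_compl_touching B) h (edgePt_mem_carrier he t)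

/-- A square whose boundary runs in a subgraph can be filled in the subgraph if it can be filled. -/
theorem exists_square_in_carrier {S : Set E} {a b c d : G.Space} (p : Path a b) (q : Path c d)
    (r : Path a c) (s : Path b d) (h : arrow p ≫ arrow s = arrow r ≫ arrow q)
    (hp : range p ⊆ G.carrier S) (hq : range q ⊆ G.carrier S) (hr : range r ⊆ G.carrier S)
    (hs : range s ⊆ G.carrier S) :
    ∃ F : C(I × I, G.Space), ((∀ u, F (0, u) = p u) ∧ (∀ u, F (1, u) = q u) ∧
      (∀ t, F (t, 0) = (Path.refl a).trans r t) ∧ ∀ t, F (t, 1) = (Path.refl b).trans s t) ∧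
      ∀ x, F x ∈ G.carrier S := by
  obtain ⟨F, h0, h1, h2, h3⟩ := exists_square p q r s h
  have ha : a ∈ G.carrier S := hp p.source_mem_range
  -- The boundary lies in one component of the subgraph; retracting an ambient filling onto this
  -- component leaves the boundary unchanged.
  obtain ⟨ρ, hρ, hρ'⟩ := exists_retraction (isPathConnected_carrier_comp ha)
  have hp' := range_subset_carrier_comp p hp
  have hr' := range_subset_carrier_comp r hr
  have hjb : JoinedIn (G.carrier S) a b := ⟨p, fun t => hp ⟨t, rfl⟩⟩
  have hjc : JoinedIn (G.carrier S) a c := ⟨r, fun t => hr ⟨t, rfl⟩⟩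
  have hcomp : ∀ {y z : G.Space} (w : Path y z), JoinedIn (G.carrier S) a y →
      range w ⊆ G.carrier S → range w ⊆ G.carrier (G.comp S a) := by
    rintro y z w hj hw _ ⟨t, rfl⟩
    refine mem_carrier_comp (hj.trans ⟨(w.subpath 0 t).cast w.source.symm rfl, fun s => ?_⟩)
    exact hw (mem_range_self _)
  have hs' := hcomp s hjb hs
  have hq' := hcomp q hjc hq
  have htr : ∀ {y z : G.Space} (w : Path y z), range w ⊆ G.carrier (G.comp S a) →
      ∀ t, (Path.refl y).trans w t ∈ G.carrier (G.comp S a) := by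
    intro y z w hw t
    have : range ((Path.refl y).trans w) ⊆ G.carrier (G.comp S a) := by
      rw [Path.trans_range, Path.refl_range]
      exact union_subset (singleton_subset_iff.2 (hw w.source_mem_range)) hw
    exact this ⟨t, rfl⟩
  refine ⟨ρ.comp F, ⟨fun u => ?_, fun u => ?_, fun t => ?_, fun t => ?_⟩,
    fun x => carrier_mono (comp_subset _ _) (hρ _)⟩
  · rw [ContinuousMap.comp_apply, h0, hρ' _ (hp' ⟨u, rfl⟩)]
  · rw [ContinuousMap.comp_apply, h1, hρ' _ (hq' ⟨u, rfl⟩)]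
  · rw [ContinuousMap.comp_apply, h2, hρ' _ (htr r hr' t)]
  · rw [ContinuousMap.comp_apply, h3, hρ' _ (htr s hs' t)]

variable [ConnectedSpace G.Space]

/-- Far out there is an essential loop at `v` such that it and its image under `h` avoid `A`. Their
holonomies are conjugate by that of `Γ`, so both loops lie in the same component outside `A`, and
malnormality places the holonomy of `Γ` in the free factor of that component. -/
theorem finite_not_exists_path (hG : G.LocallyFinite) (hG' : G.NoIsolated)
    (hcore : G.IsCoreGraph) {h : C(G.Space, G.Space)} (hh : IsProperMap h)
    {Γ : ∀ x : G.Space, FundamentalGroupoid.mk (h x) ⟶ FundamentalGroupoid.mk x}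
    (hΓ : ∀ {x y : G.Space} (κ : FundamentalGroupoid.mk x ⟶ FundamentalGroupoid.mk y),
      mapArrow h κ ≫ Γ y = Γ x ≫ κ) {A : Set E} (hA : A.Finite) :
    {v | ¬ ∃ p : Path (h (G.vertexPt v)) (G.vertexPt v), arrow p = Γ (G.vertexPt v) ∧
      range p ⊆ G.carrier Aᶜ}.Finite := by
  obtain ⟨B', hB', hAB'⟩ := exists_finite_carrier hG hG'
    (hh.isCompact_preimage (isCompact_carrier hA))
  -- Avoiding `B` keeps both a path and its image under `h` off `A`.
  let B := B' ∪ A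
  have hB : B.Finite := hB'.union hA
  have hAB : h ⁻¹' G.carrier A ⊆ G.carrier B := hAB'.trans (carrier_mono subset_union_left)
  refine ((finite_inessential hG hG' hcore (hG.finite_touching hB)).union
    (finite_vertices (G := G) _ (hG.finite_touching hB))).subset fun v hv => ?_
  by_contra hcon
  rw [mem_union, not_or] at hcon
  obtain ⟨hess, hvN⟩ := hcon
  have hvN' : G.vertexPt v ∈ G.carrier (G.touching B)ᶜ := hG'.mem_carrier_compl hvN
  have hNA : (G.touching B)ᶜ ⊆ Aᶜ :=
    compl_subset_compl.2 (subset_union_right.trans (subset_touching B))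
  obtain ⟨κ, hκ, hκ1⟩ : ∃ κ : FundamentalGroupoid.mk (G.vertexPt v) ⟶ _,
      EdgeGen (G.touching B)ᶜ κ ∧ κ ≠ 𝟙 _ := by
    by_contra hcon
    push Not at hcon
    exact hess hcon
  obtain ⟨p, rfl, hp⟩ := hκ.exists_path
  have hpN : range p ⊆ G.carrier (G.touching B)ᶜ := hp.trans (insert_subset hvN' Subset.rfl)
  have hpA : range p ⊆ G.carrier Aᶜ := hpN.trans (carrier_mono hNA)
  have hhA : ∀ x ∈ G.carrier (G.touching B)ᶜ, h x ∈ G.carrier Aᶜ := fun x hx =>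
    hG'.mem_carrier_compl fun hxA =>
      disjoint_left.1 (disjoint_carrier_compl_touching B) (hAB hxA) hx
  have hhp : range (p.map h.continuous) ⊆ G.carrier Aᶜ := by
    rintro _ ⟨t, rfl⟩
    exact hhA _ (hpN ⟨t, rfl⟩)
  have h1 : hol (arrow p) ∈ Subgroup.closure (FreeGroup.of '' G.comp Aᶜ (G.vertexPt v)) :=
    (edgeGen_of_range_subset p (range_subset_carrier_comp p hpA)).hol_mem
  have h2 : hol (mapArrow h (arrow p)) ∈
      Subgroup.closure (FreeGroup.of '' G.comp Aᶜ (h (G.vertexPt v))) :=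
    (edgeGen_of_range_subset (p.map h.continuous) (range_subset_carrier_comp _ hhp)).hol_mem
  have hne : hol (arrow p) ≠ 1 := fun h1 =>
    hκ1 ((hG'.edgeGen _).eq_of_hol_eq (hG'.edgeGen _) (h1.trans (hol_id _).symm))
  have hconj : hol (mapArrow h (arrow p)) =
      hol (Γ (G.vertexPt v)) * hol (arrow p) * (hol (Γ (G.vertexPt v)))⁻¹ := by
    rw [eq_mul_inv_iff_mul_eq, ← hol_comp, ← hol_comp, hΓ]
  rw [hconj] at h2
  obtain ⟨e, he, he'⟩ := not_disjoint_iff.1 (FreeGroup.not_disjoint_of_conj_mem h1 hne h2)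
  have hcomp := comp_eq_of_mem he he'
  rw [← hcomp] at h2
  have hx : h (G.vertexPt v) ∈ G.carrier (G.comp Aᶜ (G.vertexPt v)) := by
    rw [hcomp]
    exact mem_carrier_comp (JoinedIn.refl (hhA _ hvN'))
  have hy : G.vertexPt v ∈ G.carrier Aᶜ := carrier_mono hNA hvN'
  obtain ⟨q, hq, hqr⟩ := exists_path_of_hol_mem hG' (isPathConnected_carrier_comp hy) hx
    (mem_carrier_comp (JoinedIn.refl hy)) (Γ (G.vertexPt v)) (FreeGroup.mem_of_conj_mem h1 hne h2)
  exact hv ⟨q, hq, hqr.trans (carrier_mono (comp_subset _ _))⟩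

theorem exists_exhaustion (hG : G.LocallyFinite) [Nonempty E] : ∃ A : ℕ → Set E, A 0 = ∅ ∧
    (∀ i, (A i).Finite) ∧ (∀ i, G.touching (A i) ⊆ A (i + 1)) ∧ Monotone A ∧
      ∀ e, ∃ i, e ∈ A i := by
  obtain ⟨e₀⟩ := ‹Nonempty E›
  let A : ℕ → Set E := fun n => Nat.rec ∅ (fun _ A => G.touching A ∪ {e₀}) n
  have hA : ∀ i, G.touching (A i) ⊆ A (i + 1) := fun i => subset_union_left
  refine ⟨A, rfl, fun i => ?_, hA,
    monotone_nat_of_le_succ fun i => (subset_touching _).trans (hA i), fun e => ?_⟩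
  · induction i with
    | zero => exact finite_empty
    | succ i ih => exact (hG.finite_touching ih).union (finite_singleton e₀)
  · obtain ⟨i, hi⟩ := mem_of_exhaustion (G := G) (A := fun i => A (i + 1))
      ⟨e₀, .inr rfl⟩ (fun i => hA (i + 1)) e
    exact ⟨i + 1, hi⟩

theorem properHomotopic_id (hG : G.LocallyFinite) (hG' : G.NoIsolated)
    (hcore : G.IsCoreGraph) {h : C(G.Space, G.Space)} (hh : IsProperMap h)
    {Γ : ∀ x : G.Space, FundamentalGroupoid.mk (h x) ⟶ FundamentalGroupoid.mk x}
    (hΓ : ∀ {x y : G.Space} (κ : FundamentalGroupoid.mk x ⟶ FundamentalGroupoid.mk y),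
      mapArrow h κ ≫ Γ y = Γ x ≫ κ) : ProperHomotopic h (ContinuousMap.id G.Space) := by
  have hE : Nonempty E := by
    obtain ⟨x⟩ := (inferInstance : Nonempty G.Space)
    obtain ⟨e, -⟩ := hG'.carrier_univ x
    exact ⟨e⟩
  obtain ⟨A, hA0, hAfin, hAt, hAmono, hAex⟩ := exists_exhaustion hG
  have hdisj : ∀ i, Disjoint (G.carrier (A i)) (G.carrier (A (i + 1))ᶜ) := fun i =>
    (disjoint_carrier_compl_touching (A i)).mono_right
      (carrier_mono (compl_subset_compl.2 (hAt i)))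
  have hanti : ∀ i j, i ≤ j → G.carrier (A j)ᶜ ⊆ G.carrier (A i)ᶜ := fun i j hij =>
    carrier_mono (compl_subset_compl.2 (hAmono hij))
  have h0 : ∀ x, x ∈ G.carrier (A 0)ᶜ := fun x => by
    rw [hA0, compl_empty]
    exact hG'.carrier_univ x
  -- One track per vertex avoids every `A i` that some representative of `Γ` avoids; the levels are
  -- bounded because the track ends at the vertex itself.
  have hγ : ∀ v, ∃ p : Path (h (G.vertexPt v)) (G.vertexPt v), ∀ i,
      (∃ p : Path (h (G.vertexPt v)) (G.vertexPt v), arrow p = Γ (G.vertexPt v) ∧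
        range p ⊆ G.carrier (A i)ᶜ) → arrow p = Γ (G.vertexPt v) ∧ range p ⊆ G.carrier (A i)ᶜ := by
    intro v
    refine exists_best (fun i (p : Path (h (G.vertexPt v)) (G.vertexPt v)) =>
      arrow p = Γ (G.vertexPt v) ∧ range p ⊆ G.carrier (A i)ᶜ) ?_
      (fun i j p hij hp => ⟨hp.1, hp.2.trans (hanti i j hij)⟩) ?_
    · obtain ⟨p, hp⟩ := exists_arrow (Γ (G.vertexPt v))
      exact ⟨p, hp, fun x _ => h0 x⟩
    · obtain ⟨e, he⟩ := hG' v
      obtain ⟨i, hi⟩ := hAex e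
      exact ⟨i + 1, fun p hp => disjoint_left.1 (hdisj i) (vertexPt_mem_carrier.2 ⟨e, hi, he⟩)
        (hp.2 p.target_mem_range)⟩
  choose γ hγ using hγ
  have hγΓ : ∀ v, arrow (γ v) = Γ (G.vertexPt v) := fun v => by
    obtain ⟨p, hp⟩ := exists_arrow (Γ (G.vertexPt v))
    exact (hγ v 0 ⟨p, hp, fun x _ => h0 x⟩).1
  let IsSquare : E → C(I × I, G.Space) → Prop := fun e F =>
    (∀ u, F (0, u) = (G.edgePath e).map h.continuous u) ∧ (∀ u, F (1, u) = G.edgePath e u) ∧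
      (∀ t, F (t, 0) = (Path.refl _).trans (γ (G.src e)) t) ∧
      ∀ t, F (t, 1) = (Path.refl _).trans (γ (G.tgt e)) t
  have hsq : ∀ e, arrow ((G.edgePath e).map h.continuous) ≫ arrow (γ (G.tgt e)) =
      arrow (γ (G.src e)) ≫ arrow (G.edgePath e) := fun e => by
    rw [hγΓ, hγΓ]
    exact hΓ (arrow (G.edgePath e))
  have hF : ∀ e, ∃ F : C(I × I, G.Space), ∀ i, (∃ F, IsSquare e F ∧
      ∀ x, F x ∈ G.carrier (A i)ᶜ) → IsSquare e F ∧ ∀ x, F x ∈ G.carrier (A i)ᶜ := by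
    intro e
    refine exists_best (fun i (F : C(I × I, G.Space)) => IsSquare e F ∧
      ∀ x, F x ∈ G.carrier (A i)ᶜ) ?_ (fun i j F hij hF => ⟨hF.1, fun x => hanti i j hij (hF.2 x)⟩)
      ?_
    · obtain ⟨F, hF⟩ := exists_square _ _ _ _ (hsq e)
      exact ⟨F, hF, fun x => h0 _⟩
    · obtain ⟨i, hi⟩ := hAex e
      refine ⟨i + 1, fun F hF => disjoint_left.1 (hdisj i) (edgePt_mem_carrier hi 0) ?_⟩
      have := hF.2 (1, 0)
      rwa [hF.1.2.1] at this
  choose F hF using hF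
  have hFsq : ∀ e, IsSquare e (F e) := fun e => by
    obtain ⟨F', hF'⟩ := exists_square _ _ _ _ (hsq e)
    exact (hF e 0 ⟨F', hF', fun x => h0 _⟩).1
  -- For all but finitely many edges the four sides of the square avoid `A i`, so a filling there
  -- exists and the chosen one has this property.
  have hfin : ∀ i, {e | ¬ ∀ x, F e x ∈ G.carrier (A i)ᶜ}.Finite := by
    intro i
    obtain ⟨B, hB, hAB⟩ := exists_finite_carrier hG hG'
      (hh.isCompact_preimage (isCompact_carrier (hAfin i)))
    refine (((hG.finite_edges (finite_not_exists_path hG hG' hcore hh hΓ (hAfin i))).union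
      (hG.finite_touching hB)).union (hAfin i)).subset fun e he => ?_
    by_contra hcon
    simp only [mem_union, not_or] at hcon
    obtain ⟨⟨h1, h2⟩, h3⟩ := hcon
    replace h1 := not_or.1 h1
    have hs := hγ (G.src e) i (not_not.1 h1.1)
    have ht := hγ (G.tgt e) i (not_not.1 h1.2)
    refine he (hF e i (exists_square_in_carrier _ _ _ _ (hsq e) ?_ ?_ hs.2 ht.2)).2
    · rintro _ ⟨t, rfl⟩
      exact hG'.mem_carrier_compl fun h => h2 (mem_touching_of_edgePt_mem (t := t) (hAB h))
    · rintro _ ⟨t, rfl⟩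
      exact edgePt_mem_carrier h3 t
  let H : ContinuousMap.Homotopy h (ContinuousMap.id G.Space) :=
    homotopyOfSquares (fun v => (Path.refl _).trans (γ v)) F (fun e s => (hFsq e).1 s)
      (fun e s => (hFsq e).2.1 s) (fun e t => (hFsq e).2.2.1 t) (fun e t => (hFsq e).2.2.2 t)
  have := weaklyLocallyCompactSpace hG hG'
  refine ⟨H, isProperMap_iff_isCompact_preimage.2 ⟨H.continuous, fun K hK => ?_⟩⟩
  obtain ⟨T, hT, hKT⟩ := exists_finite_carrier hG hG' hK
  obtain ⟨i, hi⟩ := exists_subset_of_exhaustion hAmono hAex hT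
  refine (isCompact_univ.prod (isCompact_carrier (hfin (i + 1)))).of_isClosed_subset
    (hK.isClosed.preimage H.continuous) ?_
  rintro ⟨t, x⟩ hx
  refine ⟨mem_univ t, ?_⟩
  obtain ⟨e, -, s, rfl⟩ := hG'.carrier_univ x
  refine edgePt_mem_carrier (fun hgood => ?_) s
  -- A square that avoids `A (i + 1)` misses the carrier of `A i`; the extra level is needed since
  -- subgraphs outside `A i` may share vertices with it.
  exact disjoint_left.1 (hdisj i) (carrier_mono hi (hKT hx)) (hgood (t, s))

theorem injective_Psi (hG : G.LocallyFinite) (hG' : G.NoIsolated) (hcore : G.IsCoreGraph)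
    (x₀ : G.Space) : Function.Injective (Psi x₀) := by
  refine (injective_iff_map_eq_one (Psi x₀)).2 fun m hm => ?_
  obtain ⟨⟨h, hh⟩, rfl⟩ := Quotient.exists_rep m
  obtain ⟨Γ, hΓ⟩ := exists_natural hh hm
  exact Quotient.sound (s := selfEquivSetoid G.Space)
    (properHomotopic_id hG hG' hcore hh.choose_spec.1 hΓ)

end TopGraph

theorem mainTheorem12 {V : Type*} {E : Type*} (G : TopGraph V E) (hG : G.LocallyFinite)
    [ConnectedSpace G.Space] (x₀ : G.Space) :
    Continuous (ProperMaps.Psi x₀) ∧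
    (ProperMaps.genus x₀ = ⊤ →
      ¬ IsClosed ((ProperMaps.Psi x₀).range : Set (ProperMaps.Out (FundamentalGroup G.Space x₀)))) ∧
    (ProperMaps.genus x₀ = ⊤ → G.IsCoreGraph →
      Function.Injective (ProperMaps.Psi x₀) ∧
      ¬ IsEmbedding (ProperMaps.Psi x₀)) := by
  refine ⟨ProperMaps.continuous_Psi TopGraph.exists_slim x₀, fun h => ?_, fun h hcore => ?_⟩
  · obtain ⟨D⟩ := TopGraph.nonempty_twistData hG h
    exact D.not_isClosed_range hG (TopGraph.noIsolated_of_genus h)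
  · obtain ⟨D⟩ := TopGraph.nonempty_twistData hG h
    exact ⟨TopGraph.injective_Psi hG (TopGraph.noIsolated_of_genus h) hcore x₀,
      D.not_isEmbedding hG (TopGraph.noIsolated_of_genus h)⟩
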